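/- Write $\langle f|g\rangle=\int_{\mathbb R}f\bar g\,dx$ in $L_2=L_2(\mathbb R)$ (complex valued). For $\lambda=(p,\theta)\in\Phi=\mathbb R\times\mathbb R$ put $|\lambda|=(p^2+\theta^2)^{1/2}$, $\boldsymbol\lambda=p+i\theta\in\mathbb C$, and let $\mathbf e_\lambda(x)=2^{1/4}\exp(-\pi(x-p)^2+2\pi i\theta x)$ be the Gabor functions. Let $\Lambda=\mathbb Z\times\mathbb Z$, $\sharp=(1/2,1/2)$; the elements of $\Lambda+\sharp$ are called sharp points. For $\delta>0$ and $f\in L_2$ let $$\|f\|_\delta=\Big(\int_\Phi(|\lambda|^\delta+1)^2\,|\langle f|\mathbf e_\lambda\rangle|^2\,d\lambda\Big)^{1/2}\in[0,\infty].$$ Let $\mathbf a=\frac1{2\pi}\frac{d}{dx}+x$ be the annihilation operator, where $\mathbf a^jf$ is understood in the sense of tempered distributions and $\|\mathbf a^jf\|_\delta=\infty$ if $\mathbf a^jf\notin L_2$. For an integer $m\ge0$ and $\delta>1$ let $$\|f\|_{\delta,m}=\Big(\sum_{j=0}^m\|\mathbf a^jf\|_\delta^2\Big)^{1/2},\quad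 H^{\delta,m}=\{f\in L_2:\|f\|_{\delta,m}<\infty\},\quad H^m=\bigcup_{\delta>1}H^{\delta,m}.$$ Let $\Theta(z)=2^{1/4}\sum_{q\in\mathbb Z}\exp(2\pi iqz-\pi q^2)$ and let $$\gamma^\sharp(u)=\frac1{i\Theta(0)}\sum_{q\in\mathbb Z}(-1)^q\,u(q+1/2)$$ be the sharp Poisson functional, where $u\in L_2$ is replaced by its continuous representative. **Theorem.** Let $m\ge0$ be an integer and let $\mu_0,\dots,\mu_m\in\Lambda+\sharp$ be distinct, $\mu_s=(q_s,\eta_s)$, $\boldsymbol\mu_s=q_s+i\eta_s$. Let $W=(\boldsymbol\mu_s^{\,k})_{s,k=0}^m$ be the Vandermonde matrix, $h_j^s=(-1)^{\lfloor\eta_s\rfloor}(W^{-1})_{js}$, and $\mathbf d_{m,j}=\sum_{s=0}^m h_j^s\,\mathbf e_{\mu_s}$ for $j=0,\dots,m$. Then: 1. $\gamma^\sharp(\mathbf a^k\mathbf d_{m,j})=\delta_j^k$ for $j,k=0,\dots,m$. 2. For all $f\in H^m$ and $j\le m$, $\mathbf a^jf$ has a continuous representative $g$ and the series $\sum_{q\in\mathbb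 Z}g(q+1/2)$ converges absolutely; thus $\gamma^\sharp(\mathbf a^jf)$ is well defined. 3. There is a family of linear functionals $\gamma_m^\lambda$, $\lambda\in\Lambda$, on $H^m$, each of them continuous (that is, bounded with respect to $\|\cdot\|_{\delta,m}$ on $H^{\delta,m}$ for every $\delta>1$), such that for every $f\in H^m$ $$f=\sum_{j=0}^m\gamma^\sharp(\mathbf a^jf)\,\mathbf d_{m,j}+\sum_{\lambda\in\Lambda}\gamma_m^\lambda(f)\,\mathbf e_\lambda,$$ where the series converges unconditionally in the Sobolev space $W_2^m(\mathbb R)$ (hence in $L_2$), and for every $\delta>1$ there is a constant $C_\delta$ (which may depend on $m,\mu_0,\dots,\mu_m$) such that for all $f\in H^{\delta,m}$ $$\sum_{\lambda\in\Lambda}(|\lambda|^2+1)^m\,|\gamma_m^\lambda(f)|^2\le C_\delta\,\|f\|_{\delta,m}^2 .$$ -/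

import Mathlib

open MeasureTheory Filter Topology
open scoped ENNReal NNReal SchwartzMap

noncomputable section

/-! ### Phase space and Gabor functions -/

/-- The complex number `p + iθ` attached to the point `(p, θ)` of the phase plane `ℝ × ℝ`. -/
def phaseToComplex (l : ℝ × ℝ) : ℂ := (l.1 : ℂ) + (l.2 : ℂ) * Complex.I

/-- The Euclidean length `|λ| = (p² + θ²)^(1/2)` of `λ = (p, θ)` (the norm that Mathlib puts on
`ℝ × ℝ` is the maximum norm). -/
def phaseAbs (l : ℝ × ℝ) : ℝ := Real.sqrt (l.1 ^ 2 + l.2 ^ 2)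

/-- `L₂(ℝ)`, complex valued. -/
abbrev L2R : Type := Lp ℂ 2 (volume : Measure ℝ)

/-- The Gabor function `e_λ(x) = 2^(1/4) exp(-π (x - p)² + 2 π i θ x)`, `λ = (p, θ)`. -/
def gaborFun (l : ℝ × ℝ) (x : ℝ) : ℂ :=
  ((2 : ℝ) ^ (1 / 4 : ℝ) : ℝ) *
    Complex.exp (-(Real.pi : ℂ) * ((x : ℂ) - (l.1 : ℂ)) ^ 2
      + 2 * (Real.pi : ℂ) * Complex.I * (l.2 : ℂ) * (x : ℂ))

theorem continuous_gaborFun_uncurry :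
    Continuous (fun z : (ℝ × ℝ) × ℝ => gaborFun z.1 z.2) := by
  unfold gaborFun
  fun_prop

theorem continuous_gaborFun (l : ℝ × ℝ) : Continuous (gaborFun l) := by
  unfold gaborFun
  fun_prop

theorem norm_gaborFun (l : ℝ × ℝ) (x : ℝ) :
    ‖gaborFun l x‖ = (2 : ℝ) ^ (1 / 4 : ℝ) * Real.exp (-Real.pi * (x - l.1) ^ 2) := by
  have h2 : (0 : ℝ) ≤ (2 : ℝ) ^ (1 / 4 : ℝ) := by positivity
  unfold gaborFun
  rw [norm_mul, Complex.norm_real, Real.norm_of_nonneg h2, Complex.norm_exp]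
  congr 2
  have h : (-(Real.pi : ℂ) * ((x : ℂ) - (l.1 : ℂ)) ^ 2
      + 2 * (Real.pi : ℂ) * Complex.I * (l.2 : ℂ) * (x : ℂ))
      = ((-Real.pi * (x - l.1) ^ 2 : ℝ) : ℂ) + ((2 * Real.pi * l.2 * x : ℝ) : ℂ) * Complex.I := by
    push_cast
    ring
  rw [h, Complex.add_re, Complex.re_ofReal_mul, Complex.ofReal_re, Complex.I_re]
  ring

theorem memLp_gaborFun (l : ℝ × ℝ) : MemLp (gaborFun l) 2 (volume : Measure ℝ) := by
  rw [memLp_two_iff_integrable_sq_norm (continuous_gaborFun l).aestronglyMeasurable]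
  have h : (fun x : ℝ => ‖gaborFun l x‖ ^ 2) =
      fun x : ℝ => ((2 : ℝ) ^ (1 / 4 : ℝ)) ^ 2 * Real.exp (-(2 * Real.pi) * (x - l.1) ^ 2) := by
    funext x
    rw [norm_gaborFun, mul_pow, ← Real.exp_nat_mul]
    congr 2
    push_cast
    ring
  rw [h]
  exact ((integrable_exp_neg_mul_sq (by positivity : 0 < 2 * Real.pi)).comp_sub_right l.1).const_mul
    _

/-- The Gabor function `e_λ` as an element of `L₂(ℝ)`. -/
def gaborVec (l : ℝ × ℝ) : L2R := (memLp_gaborFun l).toLp (gaborFun l)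

/-- The Gabor transform `λ ↦ ⟨f | e_λ⟩ = ∫ f(x) conj(e_λ(x)) dx`. -/
def gaborTransform (f : L2R) (l : ℝ × ℝ) : ℂ := inner ℂ (gaborVec l) f

theorem stronglyMeasurable_gaborTransform (f : L2R) : StronglyMeasurable (gaborTransform f) := by
  have h : gaborTransform f = fun l => ∫ x : ℝ, f x * (starRingEnd ℂ) (gaborFun l x) := by
    funext l
    unfold gaborTransform
    rw [L2.inner_def]
    refine integral_congr_ae ?_
    filter_upwards [(memLp_gaborFun l).coeFn_toLp] with x hx
    simp only [gaborVec, hx, RCLike.inner_apply]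
  rw [h]
  have h1 : StronglyMeasurable
      (fun z : (ℝ × ℝ) × ℝ => f z.2 * (starRingEnd ℂ) (gaborFun z.1 z.2)) :=
    ((Lp.stronglyMeasurable f).comp_measurable measurable_snd).mul
      (Complex.continuous_conj.comp continuous_gaborFun_uncurry).stronglyMeasurable
  exact h1.integral_prod_right

/-! ### The annihilation operator and `L₂` membership of tempered distributions -/

/-- `L₂(ℝ)` inside the space of tempered distributions. -/
def toDist : L2R →L[ℂ] 𝓢'(ℝ, ℂ) := Lp.toTemperedDistributionCLM ℂ (volume : Measure ℝ) 2

theorem toDist_injective : Function.Injective toDist :=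
  LinearMap.ker_eq_bot.mp
    (Lp.ker_toTemperedDistributionCLM_eq_bot (F := ℂ) (μ := (volume : Measure ℝ)) (p := 2))

/-- The annihilation operator `a = (1 / 2π) d/dx + x`, acting on tempered distributions. A function
`f ∈ L₂` is in the domain of the corresponding operator of `L₂` iff this distribution is in `L₂`. -/
def annihilation : 𝓢'(ℝ, ℂ) →L[ℂ] 𝓢'(ℝ, ℂ) :=
  (1 / (2 * Real.pi) : ℂ) • TemperedDistribution.derivCLM ℂ
    + TemperedDistribution.smulLeftCLM ℂ (fun x : ℝ => (x : ℂ))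

/-- `aʲ f` as a tempered distribution. -/
def annihilationPow (j : ℕ) (f : L2R) : 𝓢'(ℝ, ℂ) := annihilation^[j] (toDist f)

/-! ### The spaces `H^δ`, `H^{δ,m}`, `H^m` -/

/-- `‖f‖_δ = (∫ (|λ|^δ + 1)² |⟨f | e_λ⟩|² dλ)^(1/2)`, with values in `[0, ∞]`. -/
def gaborNorm (d : ℝ) (f : L2R) : ℝ≥0∞ :=
  (∫⁻ l : ℝ × ℝ, ENNReal.ofReal ((phaseAbs l ^ d + 1) ^ 2) * ‖gaborTransform f l‖ₑ ^ 2)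
    ^ (1 / 2 : ℝ)

/-- `‖u‖_δ` for a tempered distribution `u`: it is infinite if `u` is not in `L₂`. -/
def gaborNormDist (d : ℝ) (u : 𝓢'(ℝ, ℂ)) : ℝ≥0∞ :=
  ⨅ (g : L2R) (_ : toDist g = u), gaborNorm d g

/-- `‖f‖_{δ,m} = (∑_{j ≤ m} ‖aʲ f‖_δ²)^(1/2)`. -/
def gaborSobolevNorm (d : ℝ) (m : ℕ) (f : L2R) : ℝ≥0∞ :=
  (∑ j ∈ Finset.range (m + 1), gaborNormDist d (annihilationPow j f) ^ 2) ^ (1 / 2 : ℝ)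

theorem gaborNorm_eq_eLpNorm (d : ℝ) (f : L2R) :
    gaborNorm d f =
      eLpNorm (fun l : ℝ × ℝ => ((phaseAbs l ^ d + 1 : ℝ) : ℂ) * gaborTransform f l) 2 volume := by
  rw [eLpNorm_eq_lintegral_rpow_enorm_toReal (by norm_num) (by norm_num)]
  unfold gaborNorm
  have h : ∀ l : ℝ × ℝ, 0 ≤ phaseAbs l ^ d + 1 := fun l => by
    have : 0 ≤ phaseAbs l := Real.sqrt_nonneg _
    positivity
  congr 1
  refine lintegral_congr fun l => ?_
  rw [ENNReal.toReal_ofNat, ENNReal.rpow_ofNat, enorm_mul, mul_pow,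
    ENNReal.ofReal_pow (h l), ← ofReal_norm ((phaseAbs l ^ d + 1 : ℝ) : ℂ),
    Complex.norm_real, Real.norm_of_nonneg (h l)]

theorem aestronglyMeasurable_weighted (d : ℝ) (f : L2R) :
    AEStronglyMeasurable
      (fun l : ℝ × ℝ => ((phaseAbs l ^ d + 1 : ℝ) : ℂ) * gaborTransform f l) volume := by
  have h : Measurable (fun l : ℝ × ℝ => ((phaseAbs l ^ d + 1 : ℝ) : ℂ)) := by
    unfold phaseAbs
    fun_prop
  exact (h.stronglyMeasurable.mul (stronglyMeasurable_gaborTransform f)).aestronglyMeasurable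

theorem gaborNorm_zero (d : ℝ) : gaborNorm d 0 = 0 := by
  simp [gaborNorm_eq_eLpNorm, gaborTransform]

theorem gaborNorm_add_le (d : ℝ) (f g : L2R) :
    gaborNorm d (f + g) ≤ gaborNorm d f + gaborNorm d g := by
  simp only [gaborNorm_eq_eLpNorm]
  refine le_trans (le_of_eq ?_) (eLpNorm_add_le (aestronglyMeasurable_weighted d f)
    (aestronglyMeasurable_weighted d g) (by norm_num))
  congr 1
  funext l
  simp only [gaborTransform, inner_add_right, Pi.add_apply, mul_add]

theorem gaborNorm_smul (d : ℝ) (c : ℂ) (f : L2R) :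
    gaborNorm d (c • f) = ‖c‖ₑ * gaborNorm d f := by
  simp only [gaborNorm_eq_eLpNorm]
  rw [← eLpNorm_const_smul]
  congr 1
  funext l
  simp only [gaborTransform, inner_smul_right, Pi.smul_apply, smul_eq_mul]
  ring

theorem gaborNorm_mono {d e : ℝ} (hd : 0 ≤ d) (hde : d ≤ e) (f : L2R) :
    gaborNorm d f ≤ 2 * gaborNorm e f := by
  simp only [gaborNorm_eq_eLpNorm]
  refine le_trans (eLpNorm_le_mul_eLpNorm_of_ae_le_mul (c := 2)
    (g := fun l : ℝ × ℝ => ((phaseAbs l ^ e + 1 : ℝ) : ℂ) * gaborTransform f l)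
    (ae_of_all _ fun l => ?_) 2) (le_of_eq (by norm_num))
  have h0 : 0 ≤ phaseAbs l := Real.sqrt_nonneg _
  have h1 : phaseAbs l ^ d ≤ phaseAbs l ^ e + 1 := by
    rcases le_total 1 (phaseAbs l) with h | h
    · have := Real.rpow_le_rpow_of_exponent_le h hde
      linarith
    · have := Real.rpow_le_one h0 h hd
      have : 0 ≤ phaseAbs l ^ e := by positivity
      linarith
  have h2 : 0 ≤ phaseAbs l ^ e := by positivity
  have h3 : 0 ≤ phaseAbs l ^ d := by positivity
  rw [norm_mul, norm_mul, Complex.norm_real, Complex.norm_real,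
    Real.norm_of_nonneg (by positivity), Real.norm_of_nonneg (by positivity), ← mul_assoc]
  gcongr
  linarith

theorem gaborNormDist_toDist (d : ℝ) (g : L2R) : gaborNormDist d (toDist g) = gaborNorm d g := by
  unfold gaborNormDist
  refine le_antisymm
    (iInf₂_le (f := fun (g' : L2R) (_ : toDist g' = toDist g) => gaborNorm d g') g rfl)
    (le_iInf₂ fun g' h => ?_)
  rw [toDist_injective h]

theorem gaborNormDist_lt_top_iff (d : ℝ) (u : 𝓢'(ℝ, ℂ)) :
    gaborNormDist d u < ⊤ ↔ ∃ g : L2R, toDist g = u ∧ gaborNorm d g < ⊤ := by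
  simp [gaborNormDist, iInf_lt_iff]

theorem gaborSobolevNorm_lt_top_iff (d : ℝ) (m : ℕ) (f : L2R) :
    gaborSobolevNorm d m f < ⊤ ↔
      ∀ j ≤ m, ∃ g : L2R, toDist g = annihilationPow j f ∧ gaborNorm d g < ⊤ := by
  unfold gaborSobolevNorm
  rw [ENNReal.rpow_lt_top_iff_of_pos (by norm_num), ENNReal.sum_lt_top]
  simp only [Finset.mem_range, Nat.lt_succ_iff, ENNReal.pow_lt_top_iff, gaborNormDist_lt_top_iff]
  simp

theorem annihilationPow_add (j : ℕ) (f g : L2R) :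
    annihilationPow j (f + g) = annihilationPow j f + annihilationPow j g := by
  unfold annihilationPow
  rw [map_add, iterate_map_add]

theorem annihilationPow_smul (j : ℕ) (c : ℂ) (f : L2R) :
    annihilationPow j (c • f) = c • annihilationPow j f := by
  unfold annihilationPow
  rw [map_smul]
  exact (Function.Commute.iterate_left (fun u => map_smul annihilation c u) j) (toDist f)

/-- `H^{δ,m}`: the functions of finite norm `‖f‖_{δ,m}`. -/
def HdeltaM (d : ℝ) (m : ℕ) : Submodule ℂ L2R where
  carrier := {f | gaborSobolevNorm d m f < ⊤}
  zero_mem' := by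
    rw [Set.mem_ofPred_eq, gaborSobolevNorm_lt_top_iff]
    intro j _
    refine ⟨0, ?_, by simp [gaborNorm_zero]⟩
    have := annihilationPow_smul j 0 0
    rw [zero_smul ℂ (0 : L2R), zero_smul ℂ (annihilationPow j 0)] at this
    rw [this, map_zero]
  add_mem' := by
    intro f g hf hg
    rw [Set.mem_ofPred_eq, gaborSobolevNorm_lt_top_iff] at *
    intro j hj
    obtain ⟨u, hu, hu'⟩ := hf j hj
    obtain ⟨v, hv, hv'⟩ := hg j hj
    exact ⟨u + v, by rw [map_add, hu, hv, annihilationPow_add],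
      (gaborNorm_add_le d u v).trans_lt (ENNReal.add_lt_top.2 ⟨hu', hv'⟩)⟩
  smul_mem' := by
    intro c f hf
    rw [Set.mem_ofPred_eq, gaborSobolevNorm_lt_top_iff] at *
    intro j hj
    obtain ⟨u, hu, hu'⟩ := hf j hj
    exact ⟨c • u, by rw [map_smul, hu, annihilationPow_smul],
      by rw [gaborNorm_smul]; exact ENNReal.mul_lt_top (by simp) hu'⟩

theorem HdeltaM_anti {d e : ℝ} (hd : 0 ≤ d) (hde : d ≤ e) (m : ℕ) :
    HdeltaM e m ≤ HdeltaM d m := by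
  intro f hf
  have hf' : gaborSobolevNorm e m f < ⊤ := hf
  change gaborSobolevNorm d m f < ⊤
  rw [gaborSobolevNorm_lt_top_iff] at *
  intro j hj
  obtain ⟨u, hu, hu'⟩ := hf' j hj
  exact ⟨u, hu, (gaborNorm_mono hd hde u).trans_lt (ENNReal.mul_lt_top (by simp) hu')⟩

/-- `H^m = ⋃_{δ > 1} H^{δ,m}`. -/
def HM (m : ℕ) : Submodule ℂ L2R where
  carrier := {f | ∃ d : ℝ, 1 < d ∧ f ∈ HdeltaM d m}
  zero_mem' := ⟨2, by norm_num, zero_mem _⟩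
  add_mem' := by
    rintro f g ⟨d, hd, hf⟩ ⟨e, he, hg⟩
    have h : 1 < min d e := lt_min hd he
    exact ⟨min d e, h, add_mem (HdeltaM_anti (by linarith) (min_le_left d e) m hf)
      (HdeltaM_anti (by linarith) (min_le_right d e) m hg)⟩
  smul_mem' := by
    rintro c f ⟨d, hd, hf⟩
    exact ⟨d, hd, Submodule.smul_mem _ c hf⟩

/-! ### The Sobolev space `W₂^m(ℝ)` -/

/-- The norm `(∑_{k ≤ m} ‖f⁽ᵏ⁾‖²)^(1/2)` of `W₂^m(ℝ)`, with distributional derivatives; it is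
infinite if one of the derivatives up to order `m` is not in `L₂`. -/
def sobolevNorm (m : ℕ) (f : L2R) : ℝ≥0∞ :=
  (∑ k ∈ Finset.range (m + 1),
    (⨅ (g : L2R) (_ : toDist g = (TemperedDistribution.derivCLM ℂ)^[k] (toDist f)), ‖g‖ₑ) ^ 2)
      ^ (1 / 2 : ℝ)

/-! ### Lattice, sharp points, sharp Poisson functional -/

/-- The points of the lattice `Λ = ℤ × ℤ` in the phase plane. -/
def latticePoint (n : ℤ × ℤ) : ℝ × ℝ := ((n.1 : ℝ), (n.2 : ℝ))

/-- The set `Λ + ♯`, `♯ = (1/2, 1/2)`, of sharp points. -/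
def sharpPoints : Set (ℝ × ℝ) := {p | ∃ n : ℤ × ℤ, p = latticePoint n + (1 / 2, 1 / 2)}

/-- `Θ(z) = 2^(1/4) ∑_{q ∈ ℤ} exp(2 π i q z - π q²)`. -/
def gaborTheta (z : ℂ) : ℂ := ((2 : ℝ) ^ (1 / 4 : ℝ) : ℝ) * jacobiTheta₂ z Complex.I

/-- The distribution `u` is an `L₂` function and `g` is its continuous representative. -/
def IsContinuousRep (u : 𝓢'(ℝ, ℂ)) (g : ℝ → ℂ) : Prop :=
  Continuous g ∧ ∃ h : L2R, toDist h = u ∧ (h : ℝ → ℂ) =ᵐ[volume] g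

theorem IsContinuousRep.unique {u : 𝓢'(ℝ, ℂ)} {g g' : ℝ → ℂ} (h : IsContinuousRep u g)
    (h' : IsContinuousRep u g') : g = g' := by
  obtain ⟨hg, v, hv, hvg⟩ := h
  obtain ⟨hg', v', hv', hvg'⟩ := h'
  obtain rfl : v = v' := toDist_injective (hv.trans hv'.symm)
  exact (hg.ae_eq_iff_eq volume hg').1 (hvg.symm.trans hvg')

open Classical in
/-- The continuous representative of `u` (and `0` if there is none). -/
def continuousRep (u : 𝓢'(ℝ, ℂ)) : ℝ → ℂ :=
  if h : ∃ g, IsContinuousRep u g then h.choose else 0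

/-- The sharp Poisson functional `γ♯(u) = (i Θ(0))⁻¹ ∑_{q ∈ ℤ} (-1)^q u(q + 1/2)`. -/
def sharpPoisson (u : 𝓢'(ℝ, ℂ)) : ℂ :=
  (Complex.I * gaborTheta 0)⁻¹ * ∑' q : ℤ, (-1 : ℂ) ^ q * continuousRep u ((q : ℝ) + 1 / 2)

/-! ### The functions `d_{m,j}` -/

/-- `h_j^s = (-1)^[η_s] (W⁻¹)_{j s}` where `μ_s = (q_s, η_s)` and `W` is the Vandermonde matrix with
the entries `W_{s k} = (q_s + i η_s)^k`. -/
def sharpCoeff {m : ℕ} (μ : Fin (m + 1) → ℝ × ℝ) (j s : Fin (m + 1)) : ℂ :=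
  (-1 : ℂ) ^ ⌊(μ s).2⌋ * (Matrix.vandermonde fun i => phaseToComplex (μ i))⁻¹ j s

/-- `d_{m,j} = ∑_s h_j^s e_{μ_s}`. -/
def sharpVec {m : ℕ} (μ : Fin (m + 1) → ℝ × ℝ) (j : Fin (m + 1)) : L2R :=
  ∑ s, sharpCoeff μ j s • gaborVec (μ s)

end

noncomputable section

/-! ### Time-frequency shifts of Schwartz functions -/

/-! The Gabor functions over Λ have an explicit dual window w = `dualWindow`. Between consecutive
half-integers it is a constant multiple of exp(πx²), the constants being tails of the alternating
series of (-1)^q exp(-π(q + 1/2)²), and it is bounded. Let D_λ(f) = `dualCoeff` be the pairing of f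
with the shift of w to λ. Two identities carry the proof.

Duality (`tsum_dualWindow_mul_gaborFun`): ∑_p w(x - p) e_0(x + k - p) equals c ≠ 0 for k = 0 and
vanishes for other integers k. Together with Poisson summation in the frequency variable this gives
∑ D_λ(f) e_λ = c f for integrable f, as soon as the D_λ(f) are square summable
(`hasSum_dualCoeff_smul_gaborVec`).

Integration by parts (`dualCoeff_sub_phaseToComplex_mul`): exp(πx²) conjugates the annihilation
operator a to d/dx up to a factor, so pairing with w leaves only the jumps of w at the
half-integers, whence 2π(D_λ(a f) - λ D_λ(f)) = ± ∑ (-1)^q f(q + 1/2). The right side is γ♯(f) up to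
a constant.

For f = e_l the second identity gives D_λ(e_l) = O(1/(1 + |l - λ|)), which just fails to be square
summable over λ. If γ♯(f) = 0, a multiple of γ♯ may be subtracted under the Gabor inversion integral
f = ∫ ⟨f|e_l⟩ e_l dl. The kernel then gains the factor (♯ - l)/(♯ - λ), becomes square summable, and
its growth in l is absorbed by the weight with δ > 1 (`exists_tsum_enorm_dualCoeff_sq_le`). If
γ♯(a^k f) = 0 for all k ≤ m, then D_λ(a^k f) = λ^k D_λ(f), and the bound for a^m f is the weighted
bound for f.

The vanishing conditions are arranged by the d_{m,j}: a e_μ = μ e_μ, and γ♯(e_μ) is a sign at sharp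
points, so the inverse Vandermonde matrix makes the d_{m,j} dual to the functionals γ♯ ∘ a^k. The
coefficients sought are c⁻¹ D_λ of the residual f - ∑ γ♯(a^j f) d_{m,j}. Convergence in W₂^m follows
from a Bessel inequality for shifts of Schwartz functions, since a derivative of a shift costs at
most one factor of frequency. -/

theorem hasDerivAt_eval_mul_gaussian (P : Polynomial ℂ) (x : ℝ) :
    HasDerivAt (fun y : ℝ => P.eval (y : ℂ) * Complex.exp (-(Real.pi : ℂ) * (y : ℂ) ^ 2))
      ((P.derivative - Polynomial.C (2 * (Real.pi : ℂ)) * Polynomial.X * P).eval (x : ℂ)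
        * Complex.exp (-(Real.pi : ℂ) * (x : ℂ) ^ 2)) x := by
  have h1 : HasDerivAt (fun z : ℂ => P.eval z * Complex.exp (-(Real.pi : ℂ) * z ^ 2))
      (P.derivative.eval (x : ℂ) * Complex.exp (-(Real.pi : ℂ) * (x : ℂ) ^ 2)
        + P.eval (x : ℂ) * (Complex.exp (-(Real.pi : ℂ) * (x : ℂ) ^ 2)
          * (-(Real.pi : ℂ) * (2 * (x : ℂ))))) (x : ℂ) := by
    refine (P.hasDerivAt (x : ℂ)).mul (HasDerivAt.cexp ?_)
    simpa using (hasDerivAt_pow 2 (x : ℂ)).const_mul (-(Real.pi : ℂ))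
  convert h1.comp_ofReal using 1
  simp only [Polynomial.eval_sub, Polynomial.eval_mul, Polynomial.eval_C, Polynomial.eval_X]
  ring

theorem exists_iteratedDeriv_eval_mul_gaussian (n : ℕ) (P : Polynomial ℂ) :
    ∃ Q : Polynomial ℂ,
      iteratedDeriv n (fun y : ℝ => P.eval (y : ℂ) * Complex.exp (-(Real.pi : ℂ) * (y : ℂ) ^ 2))
        = fun y : ℝ => Q.eval (y : ℂ) * Complex.exp (-(Real.pi : ℂ) * (y : ℂ) ^ 2) := by
  induction n generalizing P with
  | zero => exact ⟨P, by simp⟩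
  | succ n ih =>
    obtain ⟨Q, hQ⟩ := ih (P.derivative - Polynomial.C (2 * (Real.pi : ℂ)) * Polynomial.X * P)
    refine ⟨Q, ?_⟩
    rw [iteratedDeriv_succ', ← hQ]
    congr 1
    funext x
    exact (hasDerivAt_eval_mul_gaussian P x).deriv

theorem norm_gaussian (x : ℝ) :
    ‖Complex.exp (-(Real.pi : ℂ) * (x : ℂ) ^ 2)‖ = Real.exp (-Real.pi * x ^ 2) := by
  rw [Complex.norm_exp]
  congr 1
  have : (-(Real.pi : ℂ) * (x : ℂ) ^ 2) = ((-Real.pi * x ^ 2 : ℝ) : ℂ) := by push_cast; ring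
  rw [this, Complex.ofReal_re]

theorem pow_mul_gaussian_le (k : ℕ) (x : ℝ) :
    |x| ^ k * Real.exp (-Real.pi * x ^ 2) ≤ k.factorial * Real.exp 1 := by
  have h1 : |x| ^ k ≤ k.factorial * Real.exp |x| := by
    have := Real.pow_div_factorial_le_exp |x| (abs_nonneg x) k
    rwa [div_le_iff₀ (by positivity), mul_comm] at this
  have h2 : Real.exp |x| * Real.exp (-Real.pi * x ^ 2) ≤ Real.exp 1 := by
    rw [← Real.exp_add]
    refine Real.exp_le_exp.2 ?_
    rw [← sq_abs x]
    nlinarith [Real.pi_gt_three, sq_nonneg (|x| - 1), sq_nonneg |x|]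
  calc |x| ^ k * Real.exp (-Real.pi * x ^ 2)
      ≤ k.factorial * Real.exp |x| * Real.exp (-Real.pi * x ^ 2) := by gcongr
    _ ≤ k.factorial * Real.exp 1 := by rw [mul_assoc]; gcongr

theorem exists_pow_mul_eval_mul_gaussian_le (k : ℕ) (Q : Polynomial ℂ) :
    ∃ C : ℝ, ∀ x : ℝ,
      |x| ^ k * ‖Q.eval (x : ℂ) * Complex.exp (-(Real.pi : ℂ) * (x : ℂ) ^ 2)‖ ≤ C := by
  refine ⟨∑ i ∈ Finset.range (Q.natDegree + 1),
    ‖Q.coeff i‖ * ((i + k).factorial * Real.exp 1), fun x => ?_⟩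
  rw [norm_mul, norm_gaussian, Polynomial.eval_eq_sum_range]
  calc |x| ^ k * (‖∑ i ∈ Finset.range (Q.natDegree + 1), Q.coeff i * (x : ℂ) ^ i‖
        * Real.exp (-Real.pi * x ^ 2))
      ≤ |x| ^ k * ((∑ i ∈ Finset.range (Q.natDegree + 1), ‖Q.coeff i‖ * |x| ^ i)
        * Real.exp (-Real.pi * x ^ 2)) := by
        gcongr
        refine (norm_sum_le _ _).trans_eq (Finset.sum_congr rfl fun i _ => ?_)
        rw [norm_mul, norm_pow, Complex.norm_real, Real.norm_eq_abs]
    _ = ∑ i ∈ Finset.range (Q.natDegree + 1),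
          ‖Q.coeff i‖ * (|x| ^ (i + k) * Real.exp (-Real.pi * x ^ 2)) := by
        rw [Finset.sum_mul, Finset.mul_sum]
        refine Finset.sum_congr rfl fun i _ => ?_
        ring
    _ ≤ _ := by
        refine Finset.sum_le_sum fun i _ => ?_
        exact mul_le_mul_of_nonneg_left (pow_mul_gaussian_le _ _) (norm_nonneg _)

theorem contDiff_gaborFun (l : ℝ × ℝ) (n : WithTop ℕ∞) : ContDiff ℝ n (gaborFun l) := by
  unfold gaborFun
  have : ContDiff ℝ n (fun x : ℝ => (x : ℂ)) := Complex.ofRealCLM.contDiff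
  exact contDiff_const.mul (((contDiff_const.mul ((this.sub contDiff_const).pow 2)).add
    (contDiff_const.mul this)).cexp)

/-- The Gaussian `e_0` as a Schwartz function. -/
def gaussianSchwartz : 𝓢(ℝ, ℂ) where
  toFun := gaborFun 0
  smooth' := contDiff_gaborFun 0 _
  decay' k n := by
    have h : gaborFun 0 = fun y : ℝ =>
        (Polynomial.C (((2 : ℝ) ^ (1 / 4 : ℝ) : ℝ) : ℂ)).eval (y : ℂ)
          * Complex.exp (-(Real.pi : ℂ) * (y : ℂ) ^ 2) := by
      funext y
      simp [gaborFun]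
    obtain ⟨Q, hQ⟩ := exists_iteratedDeriv_eval_mul_gaussian n
      (Polynomial.C (((2 : ℝ) ^ (1 / 4 : ℝ) : ℝ) : ℂ))
    obtain ⟨C, hC⟩ := exists_pow_mul_eval_mul_gaussian_le k Q
    refine ⟨C, fun x => ?_⟩
    rw [norm_iteratedFDeriv_eq_norm_iteratedDeriv, h, hQ, Real.norm_eq_abs]
    exact hC x

@[simp]
theorem gaussianSchwartz_apply (x : ℝ) : gaussianSchwartz x = gaborFun 0 x := rfl

/-- The character `x ↦ exp (2 π i θ x)`. -/
def expChar (t : ℝ) (x : ℝ) : ℂ := Complex.exp (2 * (Real.pi : ℂ) * Complex.I * (t : ℂ) * (x : ℂ))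

theorem norm_expChar (t x : ℝ) : ‖expChar t x‖ = 1 := by
  have : expChar t x = Complex.exp ((2 * Real.pi * t * x : ℝ) * Complex.I) := by
    unfold expChar; congr 1; push_cast; ring
  rw [this, Complex.norm_exp_ofReal_mul_I]

theorem continuous_expChar (t : ℝ) : Continuous (expChar t) := by
  unfold expChar; fun_prop

theorem hasDerivAt_expChar (t x : ℝ) :
    HasDerivAt (expChar t) (2 * (Real.pi : ℂ) * Complex.I * (t : ℂ) * expChar t x) x := by
  unfold expChar
  have h := (((hasDerivAt_id (x : ℂ)).const_mul
    (2 * (Real.pi : ℂ) * Complex.I * (t : ℂ))).cexp).comp_ofReal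
  simpa [mul_comm, mul_left_comm, mul_assoc] using h

theorem hasTemperateGrowth_expChar (t : ℝ) : (expChar t).HasTemperateGrowth := by
  have h2 : ∀ n, iteratedDeriv n (expChar t)
      = fun x => (2 * (Real.pi : ℂ) * Complex.I * (t : ℂ)) ^ n * expChar t x := by
    intro n
    induction n with
    | zero => simp
    | succ n ih =>
      rw [iteratedDeriv_succ, ih]
      funext x
      rw [((hasDerivAt_expChar t x).const_mul _).deriv]
      ring
  refine ⟨?_, fun n => ⟨0, ‖2 * (Real.pi : ℂ) * Complex.I * (t : ℂ)‖ ^ n, fun x => ?_⟩⟩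
  · have : ContDiff ℝ ((⊤ : ℕ∞) : WithTop ℕ∞) (fun x : ℝ => (x : ℂ)) := Complex.ofRealCLM.contDiff
    exact (contDiff_const.mul this).cexp
  · rw [norm_iteratedFDeriv_eq_norm_iteratedDeriv, h2]
    simp [norm_expChar]

/-- The time-frequency shift `x ↦ exp (2 π i θ x) g (x - p)` of a Schwartz function. -/
def tfShift (g : 𝓢(ℝ, ℂ)) (l : ℝ × ℝ) : 𝓢(ℝ, ℂ) :=
  SchwartzMap.smulLeftCLM ℂ (expChar l.2) (g.compSubConstCLM ℂ l.1)

theorem tfShift_apply (g : 𝓢(ℝ, ℂ)) (l : ℝ × ℝ) (x : ℝ) :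
    tfShift g l x = expChar l.2 x * g (x - l.1) := by
  simp [tfShift, SchwartzMap.smulLeftCLM_apply_apply (hasTemperateGrowth_expChar l.2)]

theorem gaborFun_eq (l : ℝ × ℝ) (x : ℝ) :
    gaborFun l x = expChar l.2 x * gaborFun 0 (x - l.1) := by
  unfold gaborFun expChar
  rw [mul_left_comm, ← Complex.exp_add]
  congr 2
  push_cast
  simp
  ring

theorem coe_tfShift_gaussian (l : ℝ × ℝ) : ⇑(tfShift gaussianSchwartz l) = gaborFun l := by
  funext x
  rw [tfShift_apply, gaborFun_eq, gaussianSchwartz_apply]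

/-- The time-frequency shift as an element of `L₂(ℝ)`. -/
def tfVec (g : 𝓢(ℝ, ℂ)) (l : ℝ × ℝ) : L2R := (tfShift g l).toLp 2 volume

theorem tfVec_gaussian (l : ℝ × ℝ) : tfVec gaussianSchwartz l = gaborVec l := by
  refine Lp.ext ?_
  filter_upwards [(tfShift gaussianSchwartz l).coeFn_toLp 2 volume,
    (memLp_gaborFun l).coeFn_toLp] with x h1 h2
  rw [tfVec, h1, gaborVec, h2, coe_tfShift_gaussian]

theorem toDist_apply (f : L2R) (ψ : 𝓢(ℝ, ℂ)) : toDist f ψ = ∫ x, ψ x * f x := by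
  simp [toDist]

theorem toDist_toLp (g : 𝓢(ℝ, ℂ)) :
    toDist (g.toLp 2 volume) = SchwartzMap.toTemperedDistributionCLM ℝ ℂ volume g := by
  simp [toDist]

theorem toDist_toLp_apply (g ψ : 𝓢(ℝ, ℂ)) :
    toDist (g.toLp 2 volume) ψ = ∫ x, ψ x * g x := by
  rw [toDist_apply]
  refine integral_congr_ae ?_
  filter_upwards [g.coeFn_toLp 2 volume] with x hx
  rw [hx]

theorem derivCLM_toDist_toLp (g : 𝓢(ℝ, ℂ)) :
    TemperedDistribution.derivCLM ℂ (toDist (g.toLp 2 volume))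
      = toDist ((SchwartzMap.derivCLM ℂ ℂ g).toLp 2 volume) := by
  rw [toDist_toLp, toDist_toLp]
  exact TemperedDistribution.derivCLM_toTemperedDistributionCLM_eq ℂ g

/-- The product rule. The class of shifts of Schwartz windows is stable under differentiation, at
the price of one factor of frequency; this is why general windows are treated and not only the
Gaussian. -/
theorem derivCLM_tfShift (g : 𝓢(ℝ, ℂ)) (l : ℝ × ℝ) :
    SchwartzMap.derivCLM ℂ ℂ (tfShift g l) = tfShift (SchwartzMap.derivCLM ℂ ℂ g) l
      + (2 * (Real.pi : ℂ) * Complex.I * (l.2 : ℂ)) • tfShift g l := by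
  ext x
  rw [SchwartzMap.derivCLM_apply]
  have h1 : HasDerivAt (fun y => expChar l.2 y * g (y - l.1))
      (2 * (Real.pi : ℂ) * Complex.I * (l.2 : ℂ) * expChar l.2 x * g (x - l.1)
        + expChar l.2 x * deriv g (x - l.1)) x := by
    refine (hasDerivAt_expChar l.2 x).mul ?_
    exact (g.hasDerivAt (x - l.1)).comp_sub_const x l.1
  have h2 : ⇑(tfShift g l) = fun y => expChar l.2 y * g (y - l.1) := by
    funext y; exact tfShift_apply g l y
  rw [h2, h1.deriv]
  simp only [add_apply, smul_apply, tfShift_apply,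
    SchwartzMap.derivCLM_apply, smul_eq_mul]
  ring

theorem derivCLM_tfVec (g : 𝓢(ℝ, ℂ)) (l : ℝ × ℝ) :
    TemperedDistribution.derivCLM ℂ (toDist (tfVec g l))
      = toDist (tfVec (SchwartzMap.derivCLM ℂ ℂ g) l
        + (2 * (Real.pi : ℂ) * Complex.I * (l.2 : ℂ)) • tfVec g l) := by
  rw [tfVec, derivCLM_toDist_toLp, derivCLM_tfShift]
  rfl

/-! ### Gabor functions as eigenfunctions of the annihilation operator. -/

theorem hasDerivAt_gaborFun (l : ℝ × ℝ) (x : ℝ) :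
    HasDerivAt (gaborFun l) (2 * (Real.pi : ℂ) * (phaseToComplex l - x) * gaborFun l x) x := by
  have h0 : HasDerivAt (fun z : ℂ => -(Real.pi : ℂ) * (z - (l.1 : ℂ)) ^ 2
      + 2 * (Real.pi : ℂ) * Complex.I * (l.2 : ℂ) * z)
      (-(Real.pi : ℂ) * (2 * ((x : ℂ) - (l.1 : ℂ))) + 2 * (Real.pi : ℂ) * Complex.I * (l.2 : ℂ))
      (x : ℂ) := by
    refine HasDerivAt.add ?_ ?_
    · refine HasDerivAt.const_mul _ ?_
      exact (((hasDerivAt_id (x : ℂ)).sub_const (l.1 : ℂ)).pow 2).congr_deriv (by simp)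
    · simpa using (hasDerivAt_id (x : ℂ)).const_mul (2 * (Real.pi : ℂ) * Complex.I * (l.2 : ℂ))
  have h1 := ((h0.cexp).const_mul (((2 : ℝ) ^ (1 / 4 : ℝ) : ℝ) : ℂ)).comp_ofReal
  refine h1.congr_deriv ?_
  unfold gaborFun phaseToComplex
  ring

theorem annihilation_toDist_toLp (g : 𝓢(ℝ, ℂ)) (ψ : 𝓢(ℝ, ℂ)) :
    annihilation (toDist (g.toLp 2 volume)) ψ
      = ∫ x, ψ x * ((1 / (2 * Real.pi) : ℂ) * deriv g x + x * g x) := by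
  have hx : Function.HasTemperateGrowth (fun x : ℝ => (x : ℂ)) :=
    Function.Complex.hasTemperateGrowth_ofReal
  have h1 : annihilation (toDist (g.toLp 2 volume)) ψ
      = (1 / (2 * Real.pi) : ℂ) * TemperedDistribution.derivCLM ℂ (toDist (g.toLp 2 volume)) ψ
        + toDist (g.toLp 2 volume) (SchwartzMap.smulLeftCLM ℂ (fun x : ℝ => (x : ℂ)) ψ) := by
    simp [annihilation]
  rw [h1, derivCLM_toDist_toLp, toDist_toLp_apply, toDist_toLp_apply, ← integral_const_mul, ← integral_add]
  · refine integral_congr_ae (ae_of_all _ fun x => ?_)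
    simp only [SchwartzMap.smulLeftCLM_apply_apply hx, SchwartzMap.derivCLM_apply, smul_eq_mul]
    ring
  · refine Integrable.const_mul ?_ _
    exact (SchwartzMap.pairing (ContinuousLinearMap.mul ℂ ℂ) ψ
      (SchwartzMap.derivCLM ℂ ℂ g)).integrable
  · exact (SchwartzMap.pairing (ContinuousLinearMap.mul ℂ ℂ)
      (SchwartzMap.smulLeftCLM ℂ (fun x : ℝ => (x : ℂ)) ψ) g).integrable

/-- The logarithmic derivative of e_λ is 2π(λ - x), so the multiplication by x in a cancels and the
eigenvalue λ remains. -/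
theorem annihilation_gaborVec (l : ℝ × ℝ) :
    annihilation (toDist (gaborVec l)) = toDist (phaseToComplex l • gaborVec l) := by
  ext ψ
  have h : (phaseToComplex l • toDist (gaborVec l)) ψ = phaseToComplex l * toDist (gaborVec l) ψ :=
    rfl
  rw [map_smul, h, ← tfVec_gaussian, tfVec, annihilation_toDist_toLp, toDist_toLp_apply,
    coe_tfShift_gaussian, ← integral_const_mul]
  refine integral_congr_ae (ae_of_all _ fun x => ?_)
  have hpi : (Real.pi : ℂ) ≠ 0 := by exact_mod_cast Real.pi_ne_zero
  simp only [(hasDerivAt_gaborFun l x).deriv]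
  field_simp
  ring

theorem annihilationPow_gaborVec (j : ℕ) (l : ℝ × ℝ) :
    annihilationPow j (gaborVec l) = toDist (phaseToComplex l ^ j • gaborVec l) := by
  induction j with
  | zero => simp [annihilationPow]
  | succ j ih =>
    rw [annihilationPow, Function.iterate_succ_apply', ← annihilationPow, ih, map_smul, map_smul,
      annihilation_gaborVec, map_smul, map_smul, smul_smul, pow_succ]

/-! ### Periodization and the Bessel inequality -/

/-- The sum is 1-periodic in x, so x may be replaced by its fractional part t, and 1 + k² ≤ 3(1 + (t
+ k)²) for t in [0, 1]. -/
theorem exists_tsum_enorm_translates_le {g : ℝ → ℂ} {C : ℝ}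
    (hg : ∀ y, (1 + y ^ 2) * ‖g y‖ ≤ C) :
    ∃ A : ℝ≥0, ∀ x : ℝ, ∑' k : ℤ, ‖g (x + k)‖ₑ ≤ A := by
  have hC : 0 ≤ C := (by positivity : 0 ≤ (1 + (0 : ℝ) ^ 2) * ‖g 0‖).trans (hg 0)
  have hs : Summable fun k : ℤ => 3 * C * ((k : ℝ) ^ 2)⁻¹ := by
    refine Summable.mul_left _ ?_
    have := (Real.summable_one_div_int_pow (p := 2)).2 (by norm_num)
    simpa using this
  -- The comparison series in `hs` has the value 0 at k = 0, because 0⁻¹ = 0; the single missing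
  -- term is added separately.
  have hs' : Summable fun k : ℤ => 3 * C * (1 + (k : ℝ) ^ 2)⁻¹ := by
    refine Summable.of_nonneg_of_le (fun k => by positivity) (fun k => ?_)
      (hs.add (summable_of_ne_finset_zero (s := {0}) (f := fun k : ℤ => if k = 0 then 3 * C else 0)
        (by intro b hb; simp at hb; simp [hb])))
    by_cases hk : k = 0
    · simp [hk]
    · have : (0 : ℝ) < (k : ℝ) ^ 2 := by positivity
      simp only [hk, if_false, add_zero]
      gcongr
      linarith
  refine ⟨⟨∑' k : ℤ, 3 * C * (1 + (k : ℝ) ^ 2)⁻¹, tsum_nonneg fun k => by positivity⟩, fun x => ?_⟩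
  have h1 : ∑' k : ℤ, ‖g (x + k)‖ₑ = ∑' k : ℤ, ‖g (Int.fract x + k)‖ₑ := by
    rw [← (Equiv.addRight ⌊x⌋).tsum_eq (fun k : ℤ => ‖g (Int.fract x + k)‖ₑ)]
    refine tsum_congr fun k => ?_
    congr 2
    simp only [Equiv.coe_addRight, Int.cast_add]
    linarith [Int.floor_add_fract x]
  rw [h1]
  calc ∑' k : ℤ, ‖g (Int.fract x + k)‖ₑ
      ≤ ∑' k : ℤ, ENNReal.ofReal (3 * C * (1 + (k : ℝ) ^ 2)⁻¹) := by
        refine ENNReal.tsum_le_tsum fun k => ?_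
        rw [← ofReal_norm]
        refine ENNReal.ofReal_le_ofReal ?_
        have h0 := Int.fract_nonneg x
        have h1 := (Int.fract_lt_one x).le
        have h2 := hg (Int.fract x + k)
        rw [← div_eq_mul_inv, le_div_iff₀ (by positivity)]
        have h3 : 1 + (k : ℝ) ^ 2 ≤ 3 * (1 + (Int.fract x + k) ^ 2) := by
          nlinarith [sq_nonneg ((Int.fract x + k) + Int.fract x), mul_nonneg h0 (sub_nonneg.2 h1)]
        nlinarith [norm_nonneg (g (Int.fract x + k))]
    _ = _ := by
        rw [← ENNReal.ofReal_tsum_of_nonneg (fun k => by positivity) hs']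
        exact ENNReal.ofReal_eq_coe_nnreal _

theorem SchwartzMap.exists_tsum_enorm_translates_le (g : 𝓢(ℝ, ℂ)) :
    ∃ A : ℝ≥0, ∀ x : ℝ, ∑' k : ℤ, ‖g (x + k)‖ₑ ≤ A := by
  obtain ⟨C0, -, h0⟩ := g.decay 0 0
  obtain ⟨C2, -, h2⟩ := g.decay 2 0
  refine _root_.exists_tsum_enorm_translates_le (C := C0 + C2) fun y => ?_
  have h0 := h0 y
  have h2 := h2 y
  simp only [norm_iteratedFDeriv_zero, Real.norm_eq_abs, sq_abs] at h0 h2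
  linarith

theorem lintegral_eq_lintegral_Ico_tsum {F : ℝ → ℝ≥0∞} (hF : Measurable F) :
    ∫⁻ x, F x = ∫⁻ x in Set.Ico (0 : ℝ) 1, ∑' k : ℤ, F (x + k) := by
  have hFk : ∀ k : ℤ, AEMeasurable (fun x => F (x + k)) (volume.restrict (Set.Ico (0 : ℝ) 1)) :=
    fun k => (hF.comp (measurable_add_const (k : ℝ))).aemeasurable
  rw [lintegral_tsum hFk,
    ← setLIntegral_univ, ← iUnion_Ico_intCast ℝ,
    lintegral_iUnion (fun _ => measurableSet_Ico) (Set.pairwise_disjoint_Ico_intCast ℝ)]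
  refine tsum_congr fun k => ?_
  have h := (measurePreserving_add_right (volume : Measure ℝ) (k : ℝ)).setLIntegral_comp_preimage
    (measurableSet_Ico (a := (k : ℝ)) (b := k + 1)) hF
  rw [← h]
  congr 2
  ext x
  simp

theorem expChar_add_intCast (n : ℤ) (x : ℝ) (k : ℤ) : expChar n (x + k) = expChar n x := by
  unfold expChar
  have : 2 * (Real.pi : ℂ) * Complex.I * ((n : ℝ) : ℂ) * ((x + k : ℝ) : ℂ)
      = 2 * (Real.pi : ℂ) * Complex.I * ((n : ℝ) : ℂ) * (x : ℂ)
        + ((n * k : ℤ) : ℂ) * (2 * Real.pi * Complex.I) := by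
    push_cast; ring
  rw [this, Complex.exp_add, Complex.exp_int_mul_two_pi_mul_I, mul_one]

theorem expChar_mul_conj (s t x : ℝ) :
    expChar s x * (starRingEnd ℂ) (expChar t x) = expChar (s - t) x := by
  unfold expChar
  rw [← Complex.exp_conj, ← Complex.exp_add]
  congr 1
  simp only [map_mul, Complex.conj_ofReal, Complex.conj_I, Complex.conj_ofNat, Complex.ofReal_sub]
  ring

theorem intervalIntegral_expChar (n : ℤ) :
    ∫ x in (0 : ℝ)..1, expChar n x = if n = 0 then 1 else 0 := by
  split_ifs with h
  · simp [h, expChar]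
  · have hc : 2 * (Real.pi : ℂ) * Complex.I * ((n : ℝ) : ℂ) ≠ 0 := by
      simp [h, Real.pi_ne_zero]
    unfold expChar
    rw [integral_exp_mul_complex hc]
    have : 2 * (Real.pi : ℂ) * Complex.I * ((n : ℝ) : ℂ) * ((1 : ℝ) : ℂ)
        = (n : ℂ) * (2 * Real.pi * Complex.I) := by push_cast; ring
    rw [this, Complex.exp_int_mul_two_pi_mul_I]
    simp

/-- Parseval over one period, by expanding the square and using the orthogonality of characters. -/
theorem lintegral_trigPoly (T : Finset ℤ) (c : ℤ → ℂ) :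
    ∫⁻ x in Set.Ico (0 : ℝ) 1, ‖∑ t ∈ T, c t * expChar t x‖ₑ ^ 2 = ∑ t ∈ T, ‖c t‖ₑ ^ 2 := by
  have hcont : Continuous fun x : ℝ => ∑ t ∈ T, c t * expChar t x :=
    continuous_finsetSum _ fun t _ => continuous_const.mul (continuous_expChar t)
  have h1 : ∀ x : ℝ, ‖∑ t ∈ T, c t * expChar t x‖ₑ ^ 2
      = ENNReal.ofReal (‖∑ t ∈ T, c t * expChar t x‖ ^ 2) := fun x => by
    rw [← ofReal_norm, ENNReal.ofReal_pow (norm_nonneg _)]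
  simp_rw [h1]
  rw [setLIntegral_congr Ico_ae_eq_Ioc, ← ofReal_integral_eq_lintegral_ofReal,
    ← intervalIntegral.integral_of_le zero_le_one]
  · have h2 : (∫ x in (0 : ℝ)..1, ‖∑ t ∈ T, c t * expChar t x‖ ^ 2) = ∑ t ∈ T, ‖c t‖ ^ 2 := by
      have h3 : ((∫ x in (0 : ℝ)..1, ‖∑ t ∈ T, c t * expChar t x‖ ^ 2 : ℝ) : ℂ)
          = ((∑ t ∈ T, ‖c t‖ ^ 2 : ℝ) : ℂ) := by
        rw [← intervalIntegral.integral_ofReal]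
        have h4 : ∀ x : ℝ, ((‖∑ t ∈ T, c t * expChar t x‖ ^ 2 : ℝ) : ℂ)
            = ∑ s ∈ T, ∑ t ∈ T, c s * (starRingEnd ℂ) (c t) * expChar ((s - t : ℤ) : ℝ) x := by
          intro x
          rw [Complex.ofReal_pow, ← Complex.mul_conj', map_sum, Finset.sum_mul_sum]
          refine Finset.sum_congr rfl fun s _ => Finset.sum_congr rfl fun t _ => ?_
          rw [Int.cast_sub, ← expChar_mul_conj, map_mul]
          ring
        simp_rw [h4]
        have hci : ∀ s t : ℤ, IntervalIntegrable (fun x : ℝ =>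
            c s * (starRingEnd ℂ) (c t) * expChar ((s - t : ℤ) : ℝ) x) volume 0 1 := fun s t =>
          (continuous_const.mul (continuous_expChar _)).intervalIntegrable _ _
        have hci' : ∀ s ∈ T, IntervalIntegrable (fun x : ℝ => ∑ t ∈ T,
            c s * (starRingEnd ℂ) (c t) * expChar ((s - t : ℤ) : ℝ) x) volume 0 1 := fun s _ =>
          (continuous_finsetSum _ fun t _ =>
            continuous_const.mul (continuous_expChar _)).intervalIntegrable _ _
        rw [intervalIntegral.integral_finsetSum hci']
        rw [Complex.ofReal_sum]
        refine Finset.sum_congr rfl fun s hs => ?_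
        rw [intervalIntegral.integral_finsetSum fun t _ => hci s t, Finset.sum_eq_single s]
        · rw [intervalIntegral.integral_const_mul, intervalIntegral_expChar]
          simp [Complex.mul_conj']
        · intro t _ hts
          rw [intervalIntegral.integral_const_mul, intervalIntegral_expChar, if_neg, mul_zero]
          exact sub_ne_zero.2 (Ne.symm hts)
        · exact fun h => absurd hs h
      exact_mod_cast h3
    rw [h2, ENNReal.ofReal_sum_of_nonneg fun t _ => by positivity]
    refine Finset.sum_congr rfl fun t _ => ?_
    rw [← ofReal_norm, ENNReal.ofReal_pow (norm_nonneg _)]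
  · exact ((hcont.norm.pow 2).integrableOn_Icc (a := 0) (b := 1)).mono_set Set.Ioc_subset_Icc_self
  · exact ae_of_all _ fun x => by positivity

/-- Cauchy–Schwarz with |a b| written as |a|^(1/2) · |a|^(1/2)|b|. In use, a runs over the
translates of the window, whose total mass is uniformly bounded. -/
theorem enorm_sum_mul_sq_le {ι : Type*} (P : Finset ι) (a b : ι → ℂ) :
    ‖∑ p ∈ P, a p * b p‖ₑ ^ 2 ≤ (∑ p ∈ P, ‖a p‖ₑ) * ∑ p ∈ P, ‖a p‖ₑ * ‖b p‖ₑ ^ 2 := by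
  have h : ‖∑ p ∈ P, a p * b p‖ ^ 2 ≤ (∑ p ∈ P, ‖a p‖) * ∑ p ∈ P, ‖a p‖ * ‖b p‖ ^ 2 := by
    calc ‖∑ p ∈ P, a p * b p‖ ^ 2 ≤ (∑ p ∈ P, ‖a p‖ * ‖b p‖) ^ 2 := by
          gcongr
          exact (norm_sum_le _ _).trans_eq (Finset.sum_congr rfl fun p _ => norm_mul _ _)
      _ ≤ _ := Finset.sum_sq_le_sum_mul_sum_of_sq_le_mul _ (fun p _ => norm_nonneg _)
          (fun p _ => by positivity) (fun p _ => le_of_eq (by ring))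
  have h' : ‖∑ p ∈ P, a p * b p‖₊ ^ 2 ≤ (∑ p ∈ P, ‖a p‖₊) * ∑ p ∈ P, ‖a p‖₊ * ‖b p‖₊ ^ 2 := by
    rw [← NNReal.coe_le_coe]
    push_cast
    exact h
  simp only [enorm_eq_nnnorm]
  exact_mod_cast h'

theorem tsum_enorm_translates_sub_le {g : ℝ → ℂ} {A : ℝ≥0}
    (hA : ∀ x : ℝ, ∑' k : ℤ, ‖g (x + k)‖ₑ ≤ A) (x : ℝ) : ∑' p : ℤ, ‖g (x - p)‖ₑ ≤ A := by
  rw [← (Equiv.neg ℤ).tsum_eq]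
  simpa [sub_neg_eq_add] using hA x

theorem measurable_trigPoly (T : Finset ℤ) (c : ℤ → ℂ) :
    Measurable fun x : ℝ => ‖∑ t ∈ T, c t * expChar t x‖ₑ ^ 2 := by
  have h : Continuous fun x : ℝ => ∑ t ∈ T, c t * expChar t x :=
    continuous_finsetSum _ fun t _ => continuous_const.mul (continuous_expChar t)
  have h' : Measurable fun x : ℝ => ‖∑ t ∈ T, c t * expChar t x‖ₑ := h.measurable.enorm
  exact h'.pow_const 2

theorem lintegral_translate_mul_trigPoly_le {g : ℝ → ℂ} (hg : Continuous g) {A : ℝ≥0}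
    (hA : ∀ x : ℝ, ∑' k : ℤ, ‖g (x + k)‖ₑ ≤ A) (T : Finset ℤ) (c : ℤ → ℂ) (p : ℤ) :
    ∫⁻ x : ℝ, ‖g (x - p)‖ₑ * ‖∑ t ∈ T, c t * expChar t x‖ₑ ^ 2 ≤ A * ∑ t ∈ T, ‖c t‖ₑ ^ 2 := by
  have hmg : Measurable fun x : ℝ => ‖g (x - p)‖ₑ :=
    (hg.comp (continuous_id.sub continuous_const)).measurable.enorm
  have h : ∀ (x : ℝ) (k : ℤ), ∑ t ∈ T, c t * expChar t (x + k) = ∑ t ∈ T, c t * expChar t x :=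
    fun x k => Finset.sum_congr rfl fun t _ => by rw [expChar_add_intCast]
  have hm : Measurable fun x : ℝ => ‖g (x - p)‖ₑ * ‖∑ t ∈ T, c t * expChar t x‖ₑ ^ 2 :=
    hmg.mul (measurable_trigPoly T c)
  rw [lintegral_eq_lintegral_Ico_tsum hm,
    ← lintegral_trigPoly T c, ← lintegral_const_mul _ (measurable_trigPoly T c)]
  refine lintegral_mono fun x => ?_
  have h1 := hA (x - p)
  simp only [sub_add_eq_add_sub] at h1
  simp only [h]
  rw [ENNReal.tsum_mul_right]
  exact mul_le_mul' h1 le_rfl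

/-- One factor A is the mass of the translates in Cauchy–Schwarz over p. The other comes from
periodizing |g(x - p)| against a 1-periodic trigonometric polynomial, where Parseval applies. -/
theorem lintegral_gaborSum_le {g : ℝ → ℂ} (hg : Continuous g) {A : ℝ≥0}
    (hA : ∀ x : ℝ, ∑' k : ℤ, ‖g (x + k)‖ₑ ≤ A) (P T : Finset ℤ) (c : ℤ × ℤ → ℂ) :
    ∫⁻ x : ℝ, ‖∑ p ∈ P, g (x - p) * ∑ t ∈ T, c (p, t) * expChar t x‖ₑ ^ 2
      ≤ A ^ 2 * ∑ p ∈ P, ∑ t ∈ T, ‖c (p, t)‖ₑ ^ 2 := by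
  have hmg : ∀ p : ℤ, Measurable fun x : ℝ => ‖g (x - p)‖ₑ := fun p =>
    (hg.comp (continuous_id.sub continuous_const)).measurable.enorm
  have h1 : ∀ x : ℝ, ‖∑ p ∈ P, g (x - p) * ∑ t ∈ T, c (p, t) * expChar t x‖ₑ ^ 2
      ≤ A * ∑ p ∈ P, ‖g (x - p)‖ₑ * ‖∑ t ∈ T, c (p, t) * expChar t x‖ₑ ^ 2 := fun x =>
    (enorm_sum_mul_sq_le P (fun p => g (x - p)) fun p => ∑ t ∈ T, c (p, t) * expChar t x).trans
      (mul_le_mul' ((ENNReal.sum_le_tsum P).trans (tsum_enorm_translates_sub_le hA x)) le_rfl)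
  refine (lintegral_mono h1).trans ?_
  have hm : ∀ p ∈ P,
      Measurable fun x : ℝ => ‖g (x - p)‖ₑ * ‖∑ t ∈ T, c (p, t) * expChar t x‖ₑ ^ 2 :=
    fun p _ => (hmg p).mul (measurable_trigPoly T fun t => c (p, t))
  rw [lintegral_const_mul' _ _ ENNReal.coe_ne_top, lintegral_finsetSum _ hm, pow_two (A : ℝ≥0∞), mul_assoc]
  refine mul_le_mul' le_rfl ?_
  rw [Finset.mul_sum]
  exact Finset.sum_le_sum fun p _ =>
    lintegral_translate_mul_trigPoly_le hg hA T (fun t => c (p, t)) p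

theorem coeFn_tfVec (g : 𝓢(ℝ, ℂ)) (l : ℝ × ℝ) :
    tfVec g l =ᵐ[volume] fun x => expChar l.2 x * g (x - l.1) := by
  filter_upwards [(tfShift g l).coeFn_toLp 2 volume] with x hx
  rw [tfVec, hx, tfShift_apply]

theorem coeFn_sum_smul {ι : Type*} (S : Finset ι) (c : ι → ℂ) (v : ι → L2R) :
    (⇑(∑ n ∈ S, c n • v n) : ℝ → ℂ) =ᵐ[volume] fun x => ∑ n ∈ S, c n * v n x := by
  classical
  induction S using Finset.induction_on with
  | empty => simpa using! Lp.coeFn_zero ℂ 2 volume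
  | insert a S ha ih =>
    rw [Finset.sum_insert ha]
    filter_upwards [Lp.coeFn_add (c a • v a) (∑ n ∈ S, c n • v n), ih, Lp.coeFn_smul (c a) (v a)]
      with x h1 h2 h3
    rw [h1, Pi.add_apply, h2, h3, Finset.sum_insert ha, Pi.smul_apply, smul_eq_mul]

theorem enorm_sq_eq_lintegral (f : L2R) : ‖f‖ₑ ^ 2 = ∫⁻ x, ‖f x‖ₑ ^ 2 := by
  rw [Lp.enorm_def, eLpNorm_eq_lintegral_rpow_enorm_toReal (by norm_num) (by norm_num),
    ← ENNReal.rpow_natCast, ← ENNReal.rpow_mul]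
  simp

/-- On a rectangle of indices the sum is one trigonometric polynomial for each translate, so the
preceding estimate applies with a constant depending on g alone. -/
theorem bessel_tfVec (g : 𝓢(ℝ, ℂ)) : ∃ A : ℝ, ∀ (S : Finset (ℤ × ℤ)) (c : ℤ × ℤ → ℂ),
    ‖∑ n ∈ S, c n • tfVec g (latticePoint n)‖ ^ 2 ≤ A * ∑ n ∈ S, ‖c n‖ ^ 2 := by
  classical
  obtain ⟨A, hA⟩ := g.exists_tsum_enorm_translates_le
  have key : ∀ (P T : Finset ℤ) (c : ℤ × ℤ → ℂ),
      ‖∑ n ∈ P ×ˢ T, c n • tfVec g (latticePoint n)‖ₑ ^ 2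
        ≤ A ^ 2 * ∑ n ∈ P ×ˢ T, ‖c n‖ₑ ^ 2 := by
    intro P T c
    rw [enorm_sq_eq_lintegral, Finset.sum_product (f := fun n => ‖c n‖ₑ ^ 2)]
    refine le_trans (le_of_eq (lintegral_congr_ae ?_))
      (lintegral_gaborSum_le g.continuous hA P T c)
    have hae : ∀ᵐ x : ℝ, ∀ n : ℤ × ℤ,
        tfVec g (latticePoint n) x = expChar n.2 x * g (x - n.1) :=
      ae_all_iff.2 fun n => coeFn_tfVec g (latticePoint n)
    filter_upwards [hae, coeFn_sum_smul (P ×ˢ T) c fun n => tfVec g (latticePoint n)] with x hx h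
    rw [h, Finset.sum_product]
    congr 2
    refine Finset.sum_congr rfl fun p _ => ?_
    rw [Finset.mul_sum]
    refine Finset.sum_congr rfl fun t _ => ?_
    rw [hx]
    ring
  refine ⟨(A : ℝ) ^ 2, fun S c => ?_⟩
  have hS : S ⊆ S.image Prod.fst ×ˢ S.image Prod.snd := Finset.subset_product
  -- An arbitrary finite set is put into the rectangle of its projections, with zero coefficients
  -- outside it.
  have h := key (S.image Prod.fst) (S.image Prod.snd) fun n => if n ∈ S then c n else 0
  rw [← Finset.sum_subset hS fun n _ hn => by simp [hn],
    ← Finset.sum_subset hS fun n _ hn => by simp [hn],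
    Finset.sum_congr rfl fun n hn => by rw [if_pos hn],
    Finset.sum_congr (g := fun n => ‖c n‖ₑ ^ 2) rfl fun n hn => by rw [if_pos hn]] at h
  simp only [enorm_eq_nnnorm] at h
  have h' : ‖∑ n ∈ S, c n • tfVec g (latticePoint n)‖₊ ^ 2 ≤ A ^ 2 * ∑ n ∈ S, ‖c n‖₊ ^ 2 := by
    exact_mod_cast h
  rw [← NNReal.coe_le_coe] at h'
  push_cast at h'
  exact h'

theorem summable_smul_tfVec (g : 𝓢(ℝ, ℂ)) {c : ℤ × ℤ → ℂ} (hc : Summable fun n => ‖c n‖ ^ 2) :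
    Summable fun n => c n • tfVec g (latticePoint n) := by
  obtain ⟨A, hA⟩ := bessel_tfVec g
  rw [summable_iff_vanishing_norm] at *
  intro ε hε
  obtain ⟨s, hs⟩ := hc (ε ^ 2 / (|A| + 1)) (by positivity)
  refine ⟨s, fun t ht => ?_⟩
  have h := hs t ht
  rw [Real.norm_of_nonneg (Finset.sum_nonneg fun _ _ => by positivity),
    lt_div_iff₀ (by positivity)] at h
  have h2 := hA t c
  have h3 : 0 ≤ ∑ n ∈ t, ‖c n‖ ^ 2 := Finset.sum_nonneg fun _ _ => by positivity
  refine lt_of_pow_lt_pow_left₀ 2 hε.le ?_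
  nlinarith [le_abs_self A]

/-! ### Convergence in the Sobolev space -/

/-- Induction over all windows and coefficients at once. One derivative splits the series into one
with window g' and the same coefficients, and one with window g and coefficients multiplied by 2πiθ.
The latter uses up one factor of the weight, since θ² ≤ |λ|² + 1. -/
theorem exists_summable_iterate_deriv (k : ℕ) (g : 𝓢(ℝ, ℂ)) {c : ℤ × ℤ → ℂ}
    (hc : Summable fun n => (phaseAbs (latticePoint n) ^ 2 + 1) ^ k * ‖c n‖ ^ 2) :
    ∃ G : ℤ × ℤ → L2R, Summable G ∧ ∀ n, toDist (G n)
      = (TemperedDistribution.derivCLM ℂ)^[k] (toDist (c n • tfVec g (latticePoint n))) := by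
  induction k generalizing g c with
  | zero => exact ⟨_, summable_smul_tfVec g (by simpa using hc), fun n => rfl⟩
  | succ k ih =>
    have habs : ∀ n : ℤ × ℤ, phaseAbs (latticePoint n) ^ 2 = (n.1 : ℝ) ^ 2 + (n.2 : ℝ) ^ 2 :=
      fun n => Real.sq_sqrt (by positivity)
    obtain ⟨G₁, hs₁, hG₁⟩ := ih (SchwartzMap.derivCLM ℂ ℂ g) (c := c)
      (hc.of_nonneg_of_le (fun n => by positivity) fun n => by
        gcongr
        · linarith [sq_nonneg (phaseAbs (latticePoint n))]
        · exact Nat.le_succ k)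
    obtain ⟨G₂, hs₂, hG₂⟩ := ih g
      (c := fun n => 2 * (Real.pi : ℂ) * Complex.I * ((n.2 : ℝ) : ℂ) * c n) (by
        refine (hc.mul_left ((2 * Real.pi) ^ 2)).of_nonneg_of_le (fun n => by positivity)
          fun n => ?_
        have : ‖2 * (Real.pi : ℂ) * Complex.I * ((n.2 : ℝ) : ℂ) * c n‖ ^ 2
            = (2 * Real.pi) ^ 2 * ((n.2 : ℝ) ^ 2 * ‖c n‖ ^ 2) := by
          simp only [norm_mul, Complex.norm_real, Complex.norm_I, Complex.norm_ofNat, mul_pow,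
            Real.norm_eq_abs, sq_abs]
          ring
        rw [this, pow_succ _ k]
        have h2 : (n.2 : ℝ) ^ 2 ≤ phaseAbs (latticePoint n) ^ 2 + 1 := by
          rw [habs]; nlinarith [sq_nonneg (n.1 : ℝ)]
        calc (phaseAbs (latticePoint n) ^ 2 + 1) ^ k
              * ((2 * Real.pi) ^ 2 * ((n.2 : ℝ) ^ 2 * ‖c n‖ ^ 2))
            = (2 * Real.pi) ^ 2 * ((phaseAbs (latticePoint n) ^ 2 + 1) ^ k
              * (n.2 : ℝ) ^ 2 * ‖c n‖ ^ 2) := by ring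
          _ ≤ _ := by gcongr)
    refine ⟨fun n => G₁ n + G₂ n, hs₁.add hs₂, fun n => ?_⟩
    rw [map_add, hG₁, hG₂, ← iterate_map_add, ← map_add, Function.iterate_succ_apply, map_smul,
      map_smul, derivCLM_tfVec, ← map_smul, smul_add, smul_smul]
    simp only [latticePoint]
    rw [mul_comm (c n)]

theorem tendsto_sobolevNorm_sub_sum {m : ℕ} {c : ℤ × ℤ → ℂ} {f : L2R}
    (hc : Summable fun n => (phaseAbs (latticePoint n) ^ 2 + 1) ^ m * ‖c n‖ ^ 2)
    (hf : HasSum (fun n => c n • gaborVec (latticePoint n)) f) :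
    Tendsto (fun S : Finset (ℤ × ℤ) =>
      sobolevNorm m (f - ∑ n ∈ S, c n • gaborVec (latticePoint n))) atTop (𝓝 0) := by
  have hck : ∀ k ≤ m, Summable fun n => (phaseAbs (latticePoint n) ^ 2 + 1) ^ k * ‖c n‖ ^ 2 :=
    fun k hk => hc.of_nonneg_of_le (fun n => by positivity) fun n => by
      gcongr
      linarith [sq_nonneg (phaseAbs (latticePoint n))]
  have key : ∀ k ∈ Finset.range (m + 1), Tendsto (fun S : Finset (ℤ × ℤ) =>
      (⨅ (g : L2R) (_ : toDist g = (TemperedDistribution.derivCLM ℂ)^[k]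
        (toDist (f - ∑ n ∈ S, c n • gaborVec (latticePoint n)))), ‖g‖ₑ) ^ 2) atTop (𝓝 0) := by
    intro k hk
    obtain ⟨G, ⟨r, hr⟩, hG⟩ := exists_summable_iterate_deriv k gaussianSchwartz
      (hck k (Nat.lt_succ_iff.1 (Finset.mem_range.1 hk)))
    simp only [tfVec_gaussian] at hG
    have hD : Continuous ((TemperedDistribution.derivCLM ℂ)^[k] : 𝓢'(ℝ, ℂ) → 𝓢'(ℝ, ℂ)) :=
      (TemperedDistribution.derivCLM ℂ).continuous.iterate k
    let L : L2R →+ 𝓢'(ℝ, ℂ) :=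
      { toFun := fun u => (TemperedDistribution.derivCLM ℂ)^[k] (toDist u)
        map_zero' := by rw [map_zero, iterate_map_zero]
        map_add' := fun u v => by rw [map_add, iterate_map_add] }
    have hL : Continuous L := hD.comp toDist.continuous
    have h1 : HasSum (fun n => L (c n • gaborVec (latticePoint n))) (L f) := hf.map L hL
    have h2 : HasSum (fun n => toDist (G n)) (toDist r) := hr.mapL toDist
    -- Differentiation is continuous on distributions, so the L₂ sum of the differentiated terms
    -- must be the derivative of f. The tails of that L₂ series are then admissible in the infimum
    -- defining `sobolevNorm`.
    have h3 : toDist r = L f := by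
      refine h2.unique ?_
      convert h1 using 2
      exact hG _
    have h4 : Tendsto (fun S : Finset (ℤ × ℤ) => ‖r - ∑ n ∈ S, G n‖ₑ ^ 2) atTop (𝓝 0) := by
      have h5 : Tendsto (fun S : Finset (ℤ × ℤ) => r - ∑ n ∈ S, G n) atTop (𝓝 (r - r)) :=
        tendsto_const_nhds.sub hr
      rw [sub_self] at h5
      have h6 := (ENNReal.continuous_pow 2).tendsto _ |>.comp h5.enorm
      simpa [Function.comp_def] using h6
    refine tendsto_of_tendsto_of_tendsto_of_le_of_le tendsto_const_nhds h4
      (fun S => zero_le) fun S => ?_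
    refine pow_le_pow_left₀ zero_le (iInf₂_le _ ?_) 2
    change _ = L _
    rw [map_sub, map_sub, map_sum, map_sum, h3]
    congr 1
    exact Finset.sum_congr rfl fun n _ => hG n
  have hsum := tendsto_finsetSum _ key
  rw [Finset.sum_const_zero] at hsum
  have := (ENNReal.continuous_rpow_const (y := 1 / 2)).tendsto 0 |>.comp hsum
  simpa [sobolevNorm, Function.comp_def] using this

/-! ### Gabor inversion -/

theorem norm_gaborFun_le (l : ℝ × ℝ) (x : ℝ) : ‖gaborFun l x‖ ≤ (2 : ℝ) ^ (1 / 4 : ℝ) := by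
  rw [norm_gaborFun]
  refine mul_le_of_le_one_right (by positivity) (Real.exp_le_one_iff.2 ?_)
  nlinarith [Real.pi_pos, sq_nonneg (x - l.1)]

theorem continuous_gaborFun_left (x : ℝ) : Continuous fun l : ℝ × ℝ => gaborFun l x := by
  unfold gaborFun
  fun_prop

theorem gaborTransform_eq_integral (f : L2R) (l : ℝ × ℝ) :
    gaborTransform f l = ∫ x : ℝ, f x * (starRingEnd ℂ) (gaborFun l x) := by
  unfold gaborTransform
  rw [L2.inner_def]
  refine integral_congr_ae ?_
  filter_upwards [(memLp_gaborFun l).coeFn_toLp] with x hx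
  simp only [gaborVec, hx, RCLike.inner_apply]

theorem gaborTransform_add (f g : L2R) :
    gaborTransform (f + g) = gaborTransform f + gaborTransform g := by
  funext l
  simp [gaborTransform, inner_add_right]

theorem gaborTransform_smul (c : ℂ) (f : L2R) :
    gaborTransform (c • f) = c • gaborTransform f := by
  funext l
  simp [gaborTransform, inner_smul_right]

/-- The pointwise Gabor synthesis `x ↦ ∫ ⟨f | e_λ⟩ e_λ(x) dλ`. -/
def gaborRep (f : L2R) (x : ℝ) : ℂ := ∫ l : ℝ × ℝ, gaborTransform f l * gaborFun l x

theorem integral_gaborFun_zero_sq (x : ℝ) :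
    ∫ p : ℝ, gaborFun 0 (x - p) * gaborFun 0 (x - p) = 1 := by
  rw [integral_sub_left_eq_self (fun p => gaborFun 0 p * gaborFun 0 p) volume x]
  have h : ∀ p : ℝ, gaborFun 0 p * gaborFun 0 p
      = ((√2 * Real.exp (-(2 * Real.pi) * p ^ 2) : ℝ) : ℂ) := by
    intro p
    have h2 : (2 : ℝ) ^ (1 / 4 : ℝ) * (2 : ℝ) ^ (1 / 4 : ℝ) = √2 := by
      rw [← Real.rpow_add (by norm_num), Real.sqrt_eq_rpow]; norm_num
    rw [← h2]
    unfold gaborFun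
    rw [mul_mul_mul_comm, ← Complex.exp_add]
    push_cast
    congr 2
    simp
    ring
  simp_rw [h]
  rw [integral_complex_ofReal, integral_const_mul, integral_gaussian]
  rw [show Real.pi / (2 * Real.pi) = 1 / 2 by field_simp, ← Real.sqrt_mul (by norm_num)]
  norm_num

theorem expChar_zero (x : ℝ) : expChar 0 x = 1 := by simp [expChar]

theorem conj_gaborFun (p t x : ℝ) :
    (starRingEnd ℂ) (gaborFun (p, t) x) = expChar (-t) x * gaborFun 0 (x - p) := by
  rw [gaborFun_eq, map_mul]
  congr 1
  · unfold expChar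
    rw [← Complex.exp_conj]
    congr 1
    simp only [map_mul, Complex.conj_ofReal, Complex.conj_I, Complex.conj_ofNat, Complex.ofReal_neg]
    ring
  · unfold gaborFun
    rw [map_mul, ← Complex.exp_conj]
    simp

theorem integrable_mul_of_L2 (f : L2R) (g : 𝓢(ℝ, ℂ)) : Integrable fun x => f x * g x := by
  have h := (Lp.memLp f).integrable_mul (g.memLp 2 volume)
  exact h

/-- The frequency half of Gabor inversion: at a fixed position p, this is Fourier inversion for the
Schwartz function ψ e_0(· - p). -/
theorem integral_mul_gaussian_sq (f : L2R) (ψ : 𝓢(ℝ, ℂ)) (p : ℝ) :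
    ∫ x : ℝ, ψ x * f x * (gaborFun 0 (x - p) * gaborFun 0 (x - p))
      = ∫ t : ℝ, gaborTransform f (p, t) * ∫ x : ℝ, ψ x * gaborFun (p, t) x := by
  set u : 𝓢(ℝ, ℂ) := SchwartzMap.pairing (ContinuousLinearMap.mul ℂ ℂ) ψ
    (tfShift gaussianSchwartz (p, 0)) with hu
  have hux : ∀ x, u x = ψ x * gaborFun 0 (x - p) := fun x => by
    rw [hu, SchwartzMap.pairing_apply_apply, tfShift_apply, expChar_zero]
    simp
  have hv : ∀ t, (FourierTransformInv.fourierInv u : 𝓢(ℝ, ℂ)) t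
      = ∫ x : ℝ, ψ x * gaborFun (p, t) x := by
    intro t
    rw [SchwartzMap.fourierInv_coe, Real.fourierInv_eq']
    refine integral_congr_ae (ae_of_all _ fun x => ?_)
    simp only [hux]
    rw [gaborFun_eq (p, t), expChar, smul_eq_mul]
    simp only [RCLike.inner_apply, conj_trivial]
    push_cast
    rw [show 2 * (Real.pi : ℂ) * (t * x) * Complex.I = 2 * (Real.pi : ℂ) * Complex.I * t * x by ring]
    ring
  have hu2 : ∀ x, u x = ∫ t : ℝ, expChar (-t) x * (FourierTransformInv.fourierInv u : 𝓢(ℝ, ℂ)) t := by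
    intro x
    have h0 : FourierTransform.fourier (FourierTransformInv.fourierInv u : 𝓢(ℝ, ℂ)) = u :=
      FourierTransform.fourier_fourierInv_eq u
    conv_lhs => rw [← h0]
    rw [SchwartzMap.fourier_coe, Real.fourier_eq']
    refine integral_congr_ae (ae_of_all _ fun t => ?_)
    simp only [RCLike.inner_apply, conj_trivial, expChar, smul_eq_mul]
    congr 2
    push_cast
    ring
  have hint : Integrable fun x => f x * gaborFun 0 (x - p) := by
    have := integrable_mul_of_L2 f (tfShift gaussianSchwartz (p, 0))
    simpa [tfShift_apply, expChar_zero] using this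
  have hsw : Integrable (fun z : ℝ × ℝ => expChar (-z.2) z.1 *
      (f z.1 * gaborFun 0 (z.1 - p) * (FourierTransformInv.fourierInv u : 𝓢(ℝ, ℂ)) z.2))
      (volume.prod volume) := by
    refine (hint.mul_prod (FourierTransformInv.fourierInv u : 𝓢(ℝ, ℂ)).integrable).bdd_mul
      (c := 1) ?_ (ae_of_all _ fun z => (norm_expChar _ _).le)
    refine Continuous.aestronglyMeasurable ?_
    unfold expChar
    fun_prop
  calc ∫ x : ℝ, ψ x * f x * (gaborFun 0 (x - p) * gaborFun 0 (x - p))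
      = ∫ x : ℝ, ∫ t : ℝ, expChar (-t) x *
          (f x * gaborFun 0 (x - p) * (FourierTransformInv.fourierInv u : 𝓢(ℝ, ℂ)) t) := by
        refine integral_congr_ae (ae_of_all _ fun x => ?_)
        calc ψ x * f x * (gaborFun 0 (x - p) * gaborFun 0 (x - p))
            = (f x * gaborFun 0 (x - p)) * u x := by rw [hux]; ring
          _ = _ := by
            rw [hu2 x, ← integral_const_mul]
            refine integral_congr_ae (ae_of_all _ fun t => ?_)
            ring
    _ = ∫ t : ℝ, ∫ x : ℝ, expChar (-t) x *
          (f x * gaborFun 0 (x - p) * (FourierTransformInv.fourierInv u : 𝓢(ℝ, ℂ)) t) :=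
        integral_integral_swap hsw
    _ = _ := by
        refine integral_congr_ae (ae_of_all _ fun t => ?_)
        simp only
        rw [← hv, gaborTransform_eq_integral, ← integral_mul_const]
        refine integral_congr_ae (ae_of_all _ fun x => ?_)
        simp only
        rw [conj_gaborFun]
        ring

theorem gaborFun_zero_neg (x : ℝ) : gaborFun 0 (-x) = gaborFun 0 x := by
  simp [gaborFun]

theorem integrable_gaborFun_zero_sq (x : ℝ) :
    Integrable fun p : ℝ => gaborFun 0 (x - p) * gaborFun 0 (x - p) := by
  -- A non-integrable function has Bochner integral 0, whereas this integral is known to be 1.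
  by_contra h
  have := integral_gaborFun_zero_sq x
  rw [integral_undef h] at this
  exact zero_ne_one this

/-- Weak Gabor inversion: the fixed-p identity is integrated over p, where ∫ e_0(x - p)² dp = 1. -/
theorem integral_mul_gaborRep {f : L2R} (hf : Integrable (gaborTransform f)) (ψ : 𝓢(ℝ, ℂ)) :
    ∫ x, ψ x * gaborRep f x = ∫ x, ψ x * f x := by
  have h1 : Integrable (fun z : ℝ × (ℝ × ℝ) => gaborFun z.2 z.1 * (ψ z.1 * gaborTransform f z.2))
      (volume.prod volume) := by
    refine (ψ.integrable.mul_prod hf).bdd_mul (c := (2 : ℝ) ^ (1 / 4 : ℝ)) ?_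
      (ae_of_all _ fun z => norm_gaborFun_le _ _)
    exact (continuous_gaborFun_uncurry.comp continuous_swap).aestronglyMeasurable
  have h2 : Integrable (fun l : ℝ × ℝ => ∫ x : ℝ, gaborFun l x * (ψ x * gaborTransform f l)) :=
    h1.swap.integral_prod_left
  have h3 : Integrable (fun z : ℝ × ℝ =>
      ψ z.2 * f z.2 * (gaborFun 0 (z.2 - z.1) * gaborFun 0 (z.2 - z.1))) (volume.prod volume) := by
    have hm : Integrable (fun z : ℝ × ℝ => ψ z.1 * f z.1 * (gaborFun 0 z.2 * gaborFun 0 z.2))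
        (volume.prod volume) := by
      have ha : Integrable fun x => ψ x * f x := by
        simpa [mul_comm] using integrable_mul_of_L2 f ψ
      have hb : Integrable fun p : ℝ => gaborFun 0 p * gaborFun 0 p := by
        simpa using (integrable_gaborFun_zero_sq 0).comp_neg
      exact ha.mul_prod hb
    -- The shear (p, x) ↦ (x, p - x) turns the integrand into a product of functions of separate
    -- variables; evenness of the Gaussian accounts for the sign.
    have hmp : MeasurePreserving (fun z : ℝ × ℝ => (z.2, z.1 - z.2)) (volume.prod volume)
        (volume.prod volume) := measurePreserving_prod_sub_swap (G := ℝ) volume volume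
    refine ((hmp.integrable_comp hm.aestronglyMeasurable).2 hm).congr (ae_of_all _ fun z => ?_)
    have hneg : gaborFun 0 (z.1 - z.2) = gaborFun 0 (z.2 - z.1) := by
      rw [← gaborFun_zero_neg, neg_sub]
    simp only [Function.comp_apply, hneg]
  calc ∫ x, ψ x * gaborRep f x
      = ∫ x : ℝ, ∫ l : ℝ × ℝ, gaborFun l x * (ψ x * gaborTransform f l) := by
        refine integral_congr_ae (ae_of_all _ fun x => ?_)
        simp only [gaborRep]
        rw [← integral_const_mul]
        refine integral_congr_ae (ae_of_all _ fun l => ?_)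
        ring
    _ = ∫ l : ℝ × ℝ, ∫ x : ℝ, gaborFun l x * (ψ x * gaborTransform f l) :=
        integral_integral_swap h1
    _ = ∫ p : ℝ, ∫ t : ℝ, ∫ x : ℝ, gaborFun (p, t) x * (ψ x * gaborTransform f (p, t)) :=
        integral_prod _ h2
    _ = ∫ p : ℝ, ∫ x : ℝ, ψ x * f x * (gaborFun 0 (x - p) * gaborFun 0 (x - p)) := by
        refine integral_congr_ae (ae_of_all _ fun p => ?_)
        simp only
        rw [integral_mul_gaussian_sq]
        refine integral_congr_ae (ae_of_all _ fun t => ?_)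
        simp only
        rw [← integral_const_mul]
        refine integral_congr_ae (ae_of_all _ fun x => ?_)
        ring
    _ = ∫ x : ℝ, ∫ p : ℝ, ψ x * f x * (gaborFun 0 (x - p) * gaborFun 0 (x - p)) :=
        integral_integral_swap h3
    _ = ∫ x, ψ x * f x := by
        refine integral_congr_ae (ae_of_all _ fun x => ?_)
        simp only
        rw [integral_const_mul, integral_gaborFun_zero_sq, mul_one]

theorem continuous_gaborRep {f : L2R} (hf : Integrable (gaborTransform f)) :
    Continuous (gaborRep f) := by
  refine continuous_of_dominated
    (bound := fun l => (2 : ℝ) ^ (1 / 4 : ℝ) * ‖gaborTransform f l‖) (fun x => ?_) (fun x => ?_)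
    (hf.norm.const_mul _) (ae_of_all _ fun l => ?_)
  · exact hf.aestronglyMeasurable.mul (continuous_gaborFun_left x).aestronglyMeasurable
  · refine ae_of_all _ fun l => ?_
    rw [norm_mul, mul_comm]
    gcongr
    exact norm_gaborFun_le _ _
  · exact continuous_const.mul (continuous_gaborFun l)

theorem ae_eq_gaborRep {f : L2R} (hf : Integrable (gaborTransform f)) :
    (f : ℝ → ℂ) =ᵐ[volume] gaborRep f := by
  refine ae_eq_of_integral_contDiff_smul_eq
    ((Lp.memLp f).locallyIntegrable (by norm_num)) (continuous_gaborRep hf).locallyIntegrable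
    fun g hg hgc => ?_
  have hg₁ : HasCompactSupport (Complex.ofRealCLM ∘ g) := hgc.comp_left rfl
  have hg₂ : ContDiff ℝ ((⊤ : ℕ∞) : WithTop ℕ∞) (Complex.ofRealCLM ∘ g) := by fun_prop
  have h := integral_mul_gaborRep hf (hg₁.toSchwartzMap hg₂)
  simpa using h.symm

theorem isContinuousRep_gaborRep {f : L2R} (hf : Integrable (gaborTransform f)) :
    IsContinuousRep (toDist f) (gaborRep f) :=
  ⟨continuous_gaborRep hf, f, rfl, ae_eq_gaborRep hf⟩

theorem continuousRep_eq {u : 𝓢'(ℝ, ℂ)} {g : ℝ → ℂ} (h : IsContinuousRep u g) :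
    continuousRep u = g := by
  have h' : ∃ g, IsContinuousRep u g := ⟨g, h⟩
  rw [continuousRep, dif_pos h']
  exact h'.choose_spec.unique h

theorem continuousRep_toDist {f : L2R} (hf : Integrable (gaborTransform f)) :
    continuousRep (toDist f) = gaborRep f :=
  continuousRep_eq (isContinuousRep_gaborRep hf)

/-! ### Summability over translates -/

theorem exists_tsum_enorm_gaborFun_le :
    ∃ A : ℝ≥0, ∀ (l : ℝ × ℝ) (x : ℝ), ∑' k : ℤ, ‖gaborFun l (x + k)‖ₑ ≤ A := by
  obtain ⟨A, hA⟩ := gaussianSchwartz.exists_tsum_enorm_translates_le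
  refine ⟨A, fun l x => le_trans (le_of_eq (tsum_congr fun k => ?_)) (hA (x - l.1))⟩
  rw [gaborFun_eq, enorm_mul, ← ofReal_norm (expChar _ _), norm_expChar, ENNReal.ofReal_one,
    one_mul, gaussianSchwartz_apply, sub_add_eq_add_sub]

/-- `gaborRep f` is a superposition of Gabor functions, whose sums over integer translates are
bounded uniformly. The constant depends on neither f nor x, which later yields the continuity of γ♯.
-/
theorem exists_tsum_enorm_gaborRep_le :
    ∃ A : ℝ≥0, ∀ (f : L2R) (x : ℝ),
      ∑' k : ℤ, ‖gaborRep f (x + k)‖ₑ ≤ A * ∫⁻ l, ‖gaborTransform f l‖ₑ := by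
  obtain ⟨A, hA⟩ := exists_tsum_enorm_gaborFun_le
  refine ⟨A, fun f x => ?_⟩
  have hm : ∀ k : ℤ, AEMeasurable (fun l : ℝ × ℝ => ‖gaborTransform f l‖ₑ * ‖gaborFun l (x + k)‖ₑ)
      volume := fun k =>
    ((stronglyMeasurable_gaborTransform f).measurable.enorm.mul
      (continuous_gaborFun_left (x + k)).measurable.enorm).aemeasurable
  calc ∑' k : ℤ, ‖gaborRep f (x + k)‖ₑ
      ≤ ∑' k : ℤ, ∫⁻ l, ‖gaborTransform f l‖ₑ * ‖gaborFun l (x + k)‖ₑ := by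
        refine ENNReal.tsum_le_tsum fun k => ?_
        refine (enorm_integral_le_lintegral_enorm _).trans (le_of_eq ?_)
        simp only [enorm_mul]
    _ = ∫⁻ l, ∑' k : ℤ, ‖gaborTransform f l‖ₑ * ‖gaborFun l (x + k)‖ₑ := by
        rw [lintegral_tsum hm]
    _ ≤ ∫⁻ l, A * ‖gaborTransform f l‖ₑ := by
        refine lintegral_mono fun l => ?_
        simp only
        rw [ENNReal.tsum_mul_left, mul_comm]
        exact mul_le_mul' (hA l x) le_rfl
    _ = _ := lintegral_const_mul' _ _ ENNReal.coe_ne_top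

theorem exists_tsum_enorm_gaborRep_le_of_integrable {f : L2R}
    (hf : Integrable (gaborTransform f)) :
    ∃ A : ℝ≥0, ∀ x : ℝ, ∑' k : ℤ, ‖gaborRep f (x + k)‖ₑ ≤ A := by
  obtain ⟨A, hA⟩ := exists_tsum_enorm_gaborRep_le
  refine ⟨A * (∫⁻ l, ‖gaborTransform f l‖ₑ).toNNReal, fun x => (hA f x).trans (le_of_eq ?_)⟩
  rw [ENNReal.coe_mul, ENNReal.coe_toNNReal hf.hasFiniteIntegral.ne]

theorem summable_gaborRep {f : L2R} (hf : Integrable (gaborTransform f)) (x : ℝ) :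
    Summable fun k : ℤ => ‖gaborRep f (x + k)‖ := by
  obtain ⟨A, hA⟩ := exists_tsum_enorm_gaborRep_le_of_integrable hf
  have h := ((hA x).trans_lt ENNReal.coe_lt_top).ne
  exact tsum_enorm_ne_top_iff_summable_norm.1 h

theorem integrable_of_tsum_enorm_le {g : ℝ → ℂ} (hg : Continuous g) {A : ℝ≥0}
    (hA : ∀ x : ℝ, ∑' k : ℤ, ‖g (x + k)‖ₑ ≤ A) : Integrable g := by
  refine ⟨hg.aestronglyMeasurable, ?_⟩
  rw [HasFiniteIntegral, lintegral_eq_lintegral_Ico_tsum hg.measurable.enorm]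
  calc ∫⁻ x in Set.Ico (0 : ℝ) 1, ∑' k : ℤ, ‖g (x + k)‖ₑ
      ≤ ∫⁻ _ in Set.Ico (0 : ℝ) 1, (A : ℝ≥0∞) := lintegral_mono fun x => hA x
    _ < ⊤ := by simp

theorem integrable_gaborRep {f : L2R} (hf : Integrable (gaborTransform f)) :
    Integrable (gaborRep f) := by
  obtain ⟨A, hA⟩ := exists_tsum_enorm_gaborRep_le_of_integrable hf
  exact integrable_of_tsum_enorm_le (continuous_gaborRep hf) hA

/-- Integrability on the line is what makes the pairing with a merely bounded dual window
meaningful. -/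
theorem integrable_coeFn {f : L2R} (hf : Integrable (gaborTransform f)) :
    Integrable (f : ℝ → ℂ) :=
  (integrable_gaborRep hf).congr (ae_eq_gaborRep hf).symm

/-! ### The dual window -/

theorem summable_exp_neg_pi_sq (x : ℝ) : Summable fun k : ℤ => Real.exp (-Real.pi * (x + k) ^ 2) := by
  obtain ⟨A, hA⟩ := exists_tsum_enorm_gaborFun_le
  have h := tsum_enorm_ne_top_iff_summable_norm.1 ((hA 0 x).trans_lt ENNReal.coe_lt_top).ne
  simp only [norm_gaborFun, Prod.fst_zero, sub_zero] at h
  exact (summable_mul_left_iff (by positivity)).1 h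

/-- The term `(-1)^q exp (-π (q + 1/2)²)`. -/
def altTerm (q : ℤ) : ℝ := (-1) ^ q * Real.exp (-Real.pi * (q + 1 / 2) ^ 2)

theorem abs_altTerm (q : ℤ) : |altTerm q| = Real.exp (-Real.pi * (q + 1 / 2) ^ 2) := by
  rw [altTerm, abs_mul, abs_zpow, abs_neg, abs_one, one_zpow, one_mul, Real.abs_exp]

theorem summable_altTerm : Summable altTerm := by
  refine Summable.of_norm ?_
  simp only [Real.norm_eq_abs, abs_altTerm]
  simpa [add_comm] using summable_exp_neg_pi_sq (1 / 2)

theorem neg_one_zpow_neg (q : ℤ) : (-1 : ℝ) ^ (-q) = (-1) ^ q := by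
  rcases Int.even_or_odd q with h | h
  · rw [h.neg_one_zpow, h.neg.neg_one_zpow]
  · rw [h.neg_one_zpow, h.neg.neg_one_zpow]

/-- The reflection sends q + 1/2 to its negative and flips the parity of q. Both the vanishing of
the full sum and the evenness of the tails rest on it. -/
theorem altTerm_reflect (q : ℤ) : altTerm (-1 - q) = -altTerm q := by
  have h : (-1 : ℝ) ^ (-1 - q) = -(-1) ^ q := by
    rw [sub_eq_add_neg, zpow_add₀ (by norm_num), neg_one_zpow_neg q]
    simp
  unfold altTerm
  rw [h, neg_mul]
  congr 3
  push_cast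
  ring

theorem tsum_altTerm : ∑' q : ℤ, altTerm q = 0 := by
  have h := (Equiv.subLeft (-1 : ℤ)).tsum_eq altTerm
  simp only [Equiv.subLeft_apply, altTerm_reflect, tsum_neg] at h
  linarith

/-- The tail `∑_{q ≥ j} (-1)^q exp (-π (q + 1/2)²)`. -/
def altTail (j : ℤ) : ℝ := ∑' i : ℕ, altTerm (j + i)

theorem summable_altTerm_add (j : ℤ) : Summable fun i : ℕ => altTerm (j + i) :=
  summable_altTerm.comp_injective fun a b h => by simpa using h

theorem altTail_eq (j : ℤ) : altTail j = altTerm j + altTail (j + 1) := by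
  unfold altTail
  rw [(summable_altTerm_add j).tsum_eq_zero_add]
  simp only [Nat.cast_zero, add_zero, Nat.cast_add, Nat.cast_one]
  congr 1
  refine tsum_congr fun i => ?_
  congr 1
  ring

/-- The two tails differ by the terms with -n ≤ q < n, which cancel in pairs under the reflection.
-/
theorem altTail_neg_natCast (n : ℕ) : altTail (-n) = altTail n := by
  induction n with
  | zero => simp
  | succ n ih =>
    have h1 := altTail_eq (-(n + 1 : ℕ))
    have h2 := altTail_eq n
    have h3 := altTerm_reflect n
    have e1 : -((n + 1 : ℕ) : ℤ) + 1 = -n := by push_cast; ring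
    have e2 : -1 - (n : ℤ) = -((n + 1 : ℕ) : ℤ) := by push_cast; ring
    rw [e1, ih] at h1
    rw [e2] at h3
    push_cast at *
    linarith

theorem altTail_neg (j : ℤ) : altTail (-j) = altTail j := by
  obtain ⟨n, rfl | rfl⟩ := j.eq_nat_or_neg
  · exact altTail_neg_natCast n
  · rw [neg_neg, altTail_neg_natCast]

theorem altTail_abs (j : ℤ) : altTail |j| = altTail j := by
  rcases abs_choice j with h | h <;> rw [h]
  exact altTail_neg j

/-- By evenness only |j| matters, and (|j| + i + 1/2)² ≥ i² + (|j| + 1/2)² makes the tail comparable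
to its first term. -/
theorem exists_abs_altTail_le :
    ∃ C : ℝ, 0 ≤ C ∧ ∀ j : ℤ, |altTail j| ≤ C * Real.exp (-Real.pi * (|(j : ℝ)| + 1 / 2) ^ 2) := by
  have hs : Summable fun i : ℕ => Real.exp (-Real.pi * (i : ℝ) ^ 2) := by
    have := (summable_exp_neg_pi_sq 0).comp_injective (i := ((↑) : ℕ → ℤ)) Nat.cast_injective
    simpa [Function.comp_def] using this
  refine ⟨∑' i : ℕ, Real.exp (-Real.pi * (i : ℝ) ^ 2), tsum_nonneg fun _ => (Real.exp_pos _).le,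
    fun j => ?_⟩
  have hb : ∀ i : ℕ, ‖altTerm (|j| + i)‖
      ≤ Real.exp (-Real.pi * (i : ℝ) ^ 2) * Real.exp (-Real.pi * (|(j : ℝ)| + 1 / 2) ^ 2) := by
    intro i
    rw [Real.norm_eq_abs, abs_altTerm, ← Real.exp_add]
    refine Real.exp_le_exp.2 ?_
    push_cast
    have : 0 ≤ Real.pi * (2 * (i : ℝ) * (|(j : ℝ)| + 1 / 2)) := by positivity
    nlinarith
  rw [← altTail_abs, ← tsum_mul_right, ← Real.norm_eq_abs]
  exact tsum_of_norm_bounded (hs.mul_right _).hasSum hb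

/-- The window dual to the Gaussian: `w(x) = exp (π x²) ∑_{q ≥ j} (-1)^q exp (-π (q + 1/2)²)` for
`x ∈ [j - 1/2, j + 1/2)`. -/
def dualWindow (x : ℝ) : ℝ := Real.exp (Real.pi * x ^ 2) * altTail ⌊x + 1 / 2⌋

theorem measurable_dualWindow : Measurable dualWindow := by
  unfold dualWindow
  refine Measurable.mul (by fun_prop) ?_
  exact (measurable_of_countable altTail).comp (Int.measurable_floor.comp (by fun_prop))

/-- The growth of exp(πx²) is matched exactly by the decay of the tail. The point x is not tied to
the interval of j, because at a half-integer the values from both sides are needed. -/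
theorem exp_mul_altTail_le {C : ℝ} (hC : 0 ≤ C)
    (h : ∀ j : ℤ, |altTail j| ≤ C * Real.exp (-Real.pi * (|(j : ℝ)| + 1 / 2) ^ 2))
    {x : ℝ} {j : ℤ} (hx : |x| ≤ |(j : ℝ)| + 1 / 2) :
    Real.exp (Real.pi * x ^ 2) * |altTail j| ≤ C := by
  calc Real.exp (Real.pi * x ^ 2) * |altTail j|
      ≤ Real.exp (Real.pi * x ^ 2) * (C * Real.exp (-Real.pi * (|(j : ℝ)| + 1 / 2) ^ 2)) := by
        gcongr
        exact h j
    _ = C * Real.exp (Real.pi * x ^ 2 + -Real.pi * (|(j : ℝ)| + 1 / 2) ^ 2) := by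
        rw [Real.exp_add]; ring
    _ ≤ C * 1 := by
        gcongr
        refine Real.exp_le_one_iff.2 ?_
        have : x ^ 2 ≤ (|(j : ℝ)| + 1 / 2) ^ 2 := sq_le_sq' (by linarith [neg_abs_le x])
          ((le_abs_self x).trans hx)
        nlinarith [Real.pi_pos]
    _ = C := mul_one C

theorem exists_abs_dualWindow_le : ∃ C : ℝ, 0 ≤ C ∧ ∀ x, |dualWindow x| ≤ C := by
  obtain ⟨C, hC, h⟩ := exists_abs_altTail_le
  refine ⟨C, hC, fun x => ?_⟩
  rw [dualWindow, abs_mul, Real.abs_exp]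
  refine exp_mul_altTail_le hC h ?_
  have h1 := Int.floor_le (x + 1 / 2)
  have h2 := Int.lt_floor_add_one (x + 1 / 2)
  have h3 : |x - ⌊x + 1 / 2⌋| ≤ 1 / 2 := abs_le.2 ⟨by linarith, by linarith⟩
  calc |x| = |(⌊x + 1 / 2⌋ : ℝ) + (x - ⌊x + 1 / 2⌋)| := by ring_nf
    _ ≤ _ := (abs_add_le _ _).trans (by linarith)

/-- The dual window inverts the annihilation operator up to the alternating sum over the
half-integers. -/
theorem integral_mul_dualWindow {F K : ℝ → ℂ}
    (hF : ∀ x : ℝ, HasDerivAt F (2 * (Real.pi : ℂ) * (K x - x * F x)) x)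
    (hKc : Continuous K) (hK : Integrable K)
    (hs : Summable fun q : ℤ => ‖F ((q : ℝ) + 1 / 2)‖) :
    2 * (Real.pi : ℂ) * ∫ x, K x * dualWindow x = ∑' q : ℤ, (-1 : ℂ) ^ q * F ((q : ℝ) + 1 / 2) := by
  obtain ⟨C, hC, hCb⟩ := exists_abs_altTail_le
  obtain ⟨B, hB, hBb⟩ := exists_abs_dualWindow_le
  -- With this integrating factor the equation for F becomes U' = 2πK exp(πx²).
  set U : ℝ → ℂ := fun x => F x * Real.exp (Real.pi * x ^ 2) with hU
  have hUd : ∀ x, HasDerivAt U (2 * (Real.pi : ℂ) * (K x * Real.exp (Real.pi * x ^ 2))) x := by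
    intro x
    have h1 : HasDerivAt (fun x : ℝ => Real.exp (Real.pi * x ^ 2))
        (Real.exp (Real.pi * x ^ 2) * (Real.pi * (2 * x))) x := by
      refine HasDerivAt.exp ?_
      simpa using (hasDerivAt_pow 2 x).const_mul Real.pi
    refine ((hF x).mul h1.ofReal_comp).congr_deriv ?_
    push_cast
    ring
  have hKw : Integrable fun x => K x * (dualWindow x : ℂ) := by
    refine hK.mul_bdd (c := B)
      (Complex.measurable_ofReal.comp measurable_dualWindow).aestronglyMeasurable
      (ae_of_all _ fun x => ?_)
    rw [Complex.norm_real]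
    exact hBb x
  -- The line is cut at the half-integers; on each piece w is a constant times exp(πx²), and the
  -- fundamental theorem of calculus applies to U.
  have hsum := hKw.hasSum_intervalIntegral (-(1 / 2))
  have hterm : ∀ j : ℤ, 2 * (Real.pi : ℂ) *
      ∫ x in (-(1 / 2) + (j : ℝ))..(-(1 / 2) + (j : ℝ) + 1), K x * (dualWindow x : ℂ)
      = altTail j * U (j + 1 / 2) - altTail j * U (j - 1 / 2) := by
    intro j
    have h1 : ∫ x in (-(1 / 2) + (j : ℝ))..(-(1 / 2) + (j : ℝ) + 1), K x * (dualWindow x : ℂ)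
        = ∫ x in (-(1 / 2) + (j : ℝ))..(-(1 / 2) + (j : ℝ) + 1),
            (altTail j : ℂ) * (K x * Real.exp (Real.pi * x ^ 2)) := by
      rw [intervalIntegral.integral_of_le (by linarith),
        intervalIntegral.integral_of_le (by linarith), ← integral_Ico_eq_integral_Ioc,
        ← integral_Ico_eq_integral_Ioc]
      refine setIntegral_congr_fun measurableSet_Ico fun x hx => ?_
      have : ⌊x + 1 / 2⌋ = j := by
        rw [Int.floor_eq_iff]
        constructor <;> linarith [hx.1, hx.2]
      simp only [dualWindow, this]
      push_cast
      ring
    have h2 : ∫ x in (-(1 / 2) + (j : ℝ))..(-(1 / 2) + (j : ℝ) + 1),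
        2 * (Real.pi : ℂ) * (K x * Real.exp (Real.pi * x ^ 2))
        = U (-(1 / 2) + (j : ℝ) + 1) - U (-(1 / 2) + (j : ℝ)) := by
      refine intervalIntegral.integral_eq_sub_of_hasDerivAt (fun x _ => hUd x) ?_
      refine Continuous.intervalIntegrable ?_ _ _
      fun_prop
    rw [h1, intervalIntegral.integral_const_mul, mul_left_comm,
      ← intervalIntegral.integral_const_mul, h2]
    ring_nf
  have hs1 : Summable fun j : ℤ => (altTail j : ℂ) * U (j + 1 / 2) := by
    refine Summable.of_norm_bounded (hs.mul_left C) fun j => ?_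
    have := exp_mul_altTail_le hC hCb (x := (j : ℝ) + 1 / 2) (j := j)
      ((abs_add_le _ _).trans (by norm_num))
    rw [hU, norm_mul, norm_mul, Complex.norm_real, Complex.norm_real, Real.norm_eq_abs,
      Real.norm_eq_abs, Real.abs_exp]
    nlinarith [norm_nonneg (F ((j : ℝ) + 1 / 2))]
  have hs2 : Summable fun j : ℤ => (altTail (j + 1) : ℂ) * U (j + 1 / 2) := by
    refine Summable.of_norm_bounded (hs.mul_left C) fun j => ?_
    have := exp_mul_altTail_le hC hCb (x := (j : ℝ) + 1 / 2) (j := j + 1) (by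
      have := abs_sub_abs_le_abs_sub ((j : ℝ) + 1 / 2) ((j : ℝ) + 1)
      have h4 : |(j : ℝ) + 1 / 2 - (j + 1)| = 1 / 2 := by
        rw [show (j : ℝ) + 1 / 2 - (j + 1) = -(1 / 2) by ring]; norm_num
      push_cast
      linarith)
    rw [hU, norm_mul, norm_mul, Complex.norm_real, Complex.norm_real, Real.norm_eq_abs,
      Real.norm_eq_abs, Real.abs_exp]
    nlinarith [norm_nonneg (F ((j : ℝ) + 1 / 2))]
  have hs3 : HasSum (fun j : ℤ => (altTail j : ℂ) * U (j - 1 / 2))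
      (∑' j : ℤ, (altTail (j + 1) : ℂ) * U (j + 1 / 2)) := by
    rw [← (Equiv.addRight (1 : ℤ)).hasSum_iff]
    convert hs2.hasSum using 2 with j
    simp only [Function.comp_apply, Equiv.coe_addRight]
    congr 2
    push_cast
    ring
  -- Summation by parts: the boundary terms regroup at each half-integer into a difference of
  -- consecutive tails, that is one alternating term, whose Gaussian cancels the factor in U.
  have h5 := (hs1.hasSum.sub hs3).unique (by
    simpa only [hterm] using hsum.mul_left (2 * (Real.pi : ℂ)))
  rw [← h5, ← hs1.tsum_sub hs2]
  refine tsum_congr fun j => ?_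
  rw [← sub_mul, ← Complex.ofReal_sub, show altTail j - altTail (j + 1) = altTerm j by
    rw [altTail_eq j]; ring, altTerm, hU]
  push_cast
  rw [show (-1 : ℂ) ^ j * Complex.exp (-(Real.pi : ℂ) * ((j : ℂ) + 1 / 2) ^ 2)
      * (F ((j : ℝ) + 1 / 2) * Complex.exp ((Real.pi : ℂ) * ((j : ℂ) + 1 / 2) ^ 2))
      = (-1 : ℂ) ^ j * F ((j : ℝ) + 1 / 2) * (Complex.exp (-(Real.pi : ℂ) * ((j : ℂ) + 1 / 2) ^ 2)
        * Complex.exp ((Real.pi : ℂ) * ((j : ℂ) + 1 / 2) ^ 2)) by ring, ← Complex.exp_add]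
  simp

/-! ### Duality of the window with the Gaussian. -/

theorem summable_exp_mul_altTail (k : ℤ) :
    Summable fun j : ℤ => Real.exp (-(2 * Real.pi * k * j)) * altTail j := by
  obtain ⟨C, hC, hCb⟩ := exists_abs_altTail_le
  have h := (summable_exp_neg_pi_sq k).mul_left (C * Real.exp (Real.pi * k ^ 2))
  refine Summable.of_norm_bounded h fun j => ?_
  rw [norm_mul, Real.norm_eq_abs, Real.norm_eq_abs, Real.abs_exp]
  calc Real.exp (-(2 * Real.pi * k * j)) * |altTail j|
      ≤ Real.exp (-(2 * Real.pi * k * j)) *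
          (C * Real.exp (-Real.pi * (|(j : ℝ)| + 1 / 2) ^ 2)) := by
        gcongr
        exact hCb j
    _ ≤ Real.exp (-(2 * Real.pi * k * j)) * (C * Real.exp (-Real.pi * (j : ℝ) ^ 2)) := by
        have : (j : ℝ) ^ 2 ≤ (|(j : ℝ)| + 1 / 2) ^ 2 := by
          rw [← sq_abs (j : ℝ)]
          gcongr
          linarith
        gcongr ?_ * (C * Real.exp ?_)
        nlinarith [Real.pi_pos]
    _ = C * (Real.exp (-(2 * Real.pi * k * j)) * Real.exp (-Real.pi * (j : ℝ) ^ 2)) := by ring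
    _ = C * (Real.exp (Real.pi * k ^ 2) * Real.exp (-Real.pi * ((k : ℝ) + j) ^ 2)) := by
        rw [← Real.exp_add, ← Real.exp_add]
        congr 2
        ring
    _ = _ := by ring

/-- Replacing j by j + 1 multiplies the sum by exp(2πk), so (1 - exp(2πk)) times the sum is ∑
exp(-2πkj) `altTerm j`. Completing the square makes this a multiple of the shifted full alternating
sum, which is 0. -/
theorem tsum_exp_mul_altTail {k : ℤ} (hk : k ≠ 0) :
    ∑' j : ℤ, Real.exp (-(2 * Real.pi * k * j)) * altTail j = 0 := by
  have hs := summable_exp_mul_altTail k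
  have h1 : ∑' j : ℤ, Real.exp (-(2 * Real.pi * k * j)) * altTail (j + 1)
      = Real.exp (2 * Real.pi * k)
        * ∑' j : ℤ, Real.exp (-(2 * Real.pi * k * j)) * altTail j := by
    rw [← (Equiv.addRight (1 : ℤ)).tsum_eq
      (fun j : ℤ => Real.exp (-(2 * Real.pi * k * j)) * altTail j), ← tsum_mul_left]
    refine tsum_congr fun j => ?_
    rw [Equiv.coe_addRight, ← mul_assoc, ← Real.exp_add]
    congr 2
    push_cast
    ring
  have hs' : Summable fun j : ℤ => Real.exp (-(2 * Real.pi * k * j)) * altTail (j + 1) := by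
    have := ((Equiv.addRight (1 : ℤ)).summable_iff.2 hs).mul_left (Real.exp (2 * Real.pi * k))
    refine this.congr fun j => ?_
    rw [Function.comp_apply, Equiv.coe_addRight, ← mul_assoc, ← Real.exp_add]
    congr 2
    push_cast
    ring
  have h2 : ∑' j : ℤ, Real.exp (-(2 * Real.pi * k * j)) * altTerm j = 0 := by
    have h3 := (Equiv.addRight k).tsum_eq altTerm
    rw [tsum_altTerm] at h3
    rw [← mul_zero (Real.exp (Real.pi * k + Real.pi * k ^ 2) * (-1) ^ k), ← h3, ← tsum_mul_left]
    refine tsum_congr fun j => ?_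
    have h4 : (-1 : ℝ) ^ k * (-1) ^ (j + k) = (-1) ^ j := by
      rw [zpow_add₀ (by norm_num), mul_left_comm, ← mul_zpow]
      norm_num
    rw [Equiv.coe_addRight, altTerm, altTerm, ← h4]
    have h5 : Real.exp (-(2 * Real.pi * k * j)) * Real.exp (-Real.pi * ((j : ℝ) + 1 / 2) ^ 2)
        = Real.exp (Real.pi * k + Real.pi * k ^ 2)
          * Real.exp (-Real.pi * (((j + k : ℤ) : ℝ) + 1 / 2) ^ 2) := by
      rw [← Real.exp_add, ← Real.exp_add]
      congr 1
      push_cast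
      ring
    linear_combination ((-1 : ℝ) ^ k * (-1) ^ (j + k)) * h5
  have h6 : ∑' j : ℤ, Real.exp (-(2 * Real.pi * k * j)) * altTerm j
      = ∑' j : ℤ, Real.exp (-(2 * Real.pi * k * j)) * altTail j
        - ∑' j : ℤ, Real.exp (-(2 * Real.pi * k * j)) * altTail (j + 1) := by
    rw [← hs.tsum_sub hs']
    refine tsum_congr fun j => ?_
    rw [altTail_eq j]
    ring
  rw [h2, h1] at h6
  have h7 : Real.exp (2 * Real.pi * k) ≠ 1 := by
    rw [Ne, Real.exp_eq_one_iff]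
    have : (k : ℝ) ≠ 0 := by exact_mod_cast hk
    positivity
  have h8 : (1 - Real.exp (2 * Real.pi * k))
      * ∑' j : ℤ, Real.exp (-(2 * Real.pi * k * j)) * altTail j = 0 := by linarith
  rcases mul_eq_zero.1 h8 with h | h
  · exact absurd (by linarith) h7
  · exact h

/-- The normalization constant `∑_j ∑_{q ≥ j} (-1)^q exp (-π (q + 1/2)²)`. -/
def altTailSum : ℝ := ∑' j : ℤ, altTail j

/-- By evenness the constant is `altTerm 0` + `altTail 1` + 2 ∑_{n ≥ 1} `altTail n`. The first term
is E = exp(-π/4), and the tails decay geometrically with ratio a = exp(-2π) ≤ 1/6, so the constant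
is at least E(1 - 1/5 - 12/25) > 0. -/
theorem altTailSum_ne_zero : altTailSum ≠ 0 := by
  set a : ℝ := Real.exp (-(2 * Real.pi)) with ha
  set E : ℝ := Real.exp (-Real.pi / 4) with hE
  have ha0 : 0 < a := Real.exp_pos _
  have hE0 : 0 < E := Real.exp_pos _
  have ha1 : a ≤ 1 / 6 := by
    rw [ha, Real.exp_neg, one_div]
    refine inv_anti₀ (by norm_num) ?_
    have := Real.add_one_le_exp (2 * Real.pi)
    linarith [Real.pi_gt_three]
  have hgeo : HasSum (fun i : ℕ => a ^ i) (1 - a)⁻¹ := hasSum_geometric_of_lt_one ha0.le (by linarith)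
  have hterm : ∀ q : ℕ, |altTerm (q + 1)| ≤ E * a ^ (q + 1) := by
    intro q
    rw [abs_altTerm, hE, ha, ← Real.exp_nat_mul, ← Real.exp_add]
    refine Real.exp_le_exp.2 ?_
    push_cast
    have : 0 ≤ Real.pi * ((q : ℝ) * (q + 1)) := by positivity
    nlinarith
  have htail : ∀ n : ℕ, |altTail (n + 1)| ≤ E * (1 - a)⁻¹ * a ^ (n + 1) := by
    intro n
    rw [altTail, ← Real.norm_eq_abs]
    have := hgeo.mul_left (E * a ^ (n + 1))
    rw [show E * (1 - a)⁻¹ * a ^ (n + 1) = E * a ^ (n + 1) * (1 - a)⁻¹ by ring]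
    refine tsum_of_norm_bounded this fun i => ?_
    have h := hterm (n + i)
    rw [Real.norm_eq_abs, mul_assoc, ← pow_add]
    convert h using 3
    · push_cast; ring
    · ring
  have hsum : Summable altTail := by simpa using summable_exp_mul_altTail 0
  have h1 : altTailSum = altTail 0 + 2 * ∑' n : ℕ, altTail (n + 1) := by
    rw [altTailSum, tsum_int_eq_zero_add_two_mul_tsum_pnat (fun j => altTail_neg j) hsum,
      tsum_pnat_eq_tsum_succ (f := fun n : ℕ => altTail n)]
    simp
  have h2 : altTail 0 = altTerm 0 + altTail 1 := altTail_eq 0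
  have h3 : altTerm 0 = E := by
    rw [altTerm, hE]
    norm_num
    ring_nf
  have h4 : |altTail 1| ≤ E * (1 - a)⁻¹ * a := by simpa using htail 0
  have h5 : |∑' n : ℕ, altTail (n + 1)| ≤ E * (1 - a)⁻¹ * a * (1 - a)⁻¹ := by
    rw [← Real.norm_eq_abs]
    refine tsum_of_norm_bounded (hgeo.mul_left (E * (1 - a)⁻¹ * a)) fun n => ?_
    rw [Real.norm_eq_abs, mul_assoc, ← pow_succ']
    exact htail n
  have hinv : (1 - a)⁻¹ ≤ 6 / 5 := by
    rw [inv_le_comm₀ (by linarith) (by norm_num)]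
    norm_num
    linarith
  have hinv0 : 0 < (1 - a)⁻¹ := inv_pos.2 (by linarith)
  have h6 : (1 - a)⁻¹ * a ≤ 1 / 5 := by nlinarith
  have h7 : (1 - a)⁻¹ * a * (1 - a)⁻¹ ≤ 6 / 25 := by nlinarith [mul_pos hinv0 ha0]
  have h8 := neg_abs_le (altTail 1)
  have h9 := neg_abs_le (∑' n : ℕ, altTail (n + 1))
  have : 0 < altTailSum := by
    rw [h1, h2, h3]
    have e1 : E * (1 - a)⁻¹ * a ≤ E * (1 / 5) := by rw [mul_assoc]; gcongr
    have e2 : E * (1 - a)⁻¹ * a * (1 - a)⁻¹ ≤ E * (6 / 25) := by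
      calc E * (1 - a)⁻¹ * a * (1 - a)⁻¹ = E * ((1 - a)⁻¹ * a * (1 - a)⁻¹) := by ring
        _ ≤ _ := by gcongr
    linarith
  exact this.ne'

/-- The product of exp(π(x - p)²) with the Gaussian at x + k - p has a purely linear exponent in p,
so x survives only in a prefactor. The sum over p is one of the tail sums above, zero unless k = 0.
-/
theorem tsum_dualWindow_mul_gaborFun (x : ℝ) (k : ℤ) :
    ∑' p : ℤ, (dualWindow (x - p) : ℂ) * gaborFun 0 (x + k - p)
      = if k = 0 then (((2 : ℝ) ^ (1 / 4 : ℝ) * altTailSum : ℝ) : ℂ) else 0 := by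
  set j₀ : ℤ := ⌊x + 1 / 2⌋ with hj₀
  have h1 : ∀ p : ℤ, (dualWindow (x - p) : ℂ) * gaborFun 0 (x + k - p)
      = (((2 : ℝ) ^ (1 / 4 : ℝ) * Real.exp (-Real.pi * k ^ 2 - 2 * Real.pi * k * (x - j₀))
        * (Real.exp (-(2 * Real.pi * k * ((j₀ - p : ℤ) : ℝ))) * altTail (j₀ - p)) : ℝ) : ℂ) := by
    intro p
    have hfl : ⌊x - p + 1 / 2⌋ = j₀ - p := by
      rw [hj₀, ← Int.floor_sub_intCast]
      congr 1
      ring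
    have hg : gaborFun 0 (x + k - p)
        = (((2 : ℝ) ^ (1 / 4 : ℝ) * Real.exp (-Real.pi * (x + k - p) ^ 2) : ℝ) : ℂ) := by
      unfold gaborFun
      push_cast
      simp
    rw [hg, dualWindow, hfl, ← Complex.ofReal_mul]
    congr 1
    have he : Real.exp (Real.pi * (x - p) ^ 2) * Real.exp (-Real.pi * (x + k - p) ^ 2)
        = Real.exp (-Real.pi * k ^ 2 - 2 * Real.pi * k * (x - j₀))
          * Real.exp (-(2 * Real.pi * k * ((j₀ - p : ℤ) : ℝ))) := by
      rw [← Real.exp_add, ← Real.exp_add]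
      congr 1
      push_cast
      ring
    linear_combination ((2 : ℝ) ^ (1 / 4 : ℝ) * altTail (j₀ - p)) * he
  simp_rw [h1]
  have h2 := (Equiv.subLeft j₀).tsum_eq
    (fun j : ℤ => Real.exp (-(2 * Real.pi * k * (j : ℝ))) * altTail j)
  simp only [Equiv.subLeft_apply] at h2
  rw [← Complex.ofReal_tsum, tsum_mul_left, h2]
  split_ifs with hk
  · simp [hk, altTailSum]
  · rw [tsum_exp_mul_altTail hk]
    simp

/-! ### Dual coefficients and reconstruction -/

/-- The coefficient `∫ f(x) w(x - p) exp (-2 π i θ x) dx` for `n = (p, θ)`. -/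
def dualCoeff (n : ℤ × ℤ) (f : L2R) : ℂ :=
  ∫ x : ℝ, f x * ((dualWindow (x - n.1) : ℂ) * expChar (-n.2) x)

/-- The Schwartz function `ψ · e_0(· - p)`. -/
def windowed (ψ : 𝓢(ℝ, ℂ)) (p : ℝ) : 𝓢(ℝ, ℂ) :=
  SchwartzMap.pairing (ContinuousLinearMap.mul ℂ ℂ) ψ (tfShift gaussianSchwartz (p, 0))

theorem windowed_apply (ψ : 𝓢(ℝ, ℂ)) (p x : ℝ) :
    windowed ψ p x = ψ x * gaborFun 0 (x - p) := by
  rw [windowed, SchwartzMap.pairing_apply_apply, tfShift_apply, expChar_zero]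
  simp

theorem integral_mul_gaborFun_eq_fourier (ψ : 𝓢(ℝ, ℂ)) (p t : ℝ) :
    ∫ x : ℝ, ψ x * gaborFun (p, t) x = FourierTransform.fourier (windowed ψ p) (-t) := by
  rw [SchwartzMap.fourier_coe, Real.fourier_eq']
  refine integral_congr_ae (ae_of_all _ fun x => ?_)
  simp only [windowed_apply, RCLike.inner_apply, conj_trivial, smul_eq_mul]
  rw [gaborFun_eq (p, t), expChar]
  push_cast
  rw [show -2 * (Real.pi : ℂ) * (-(t : ℂ) * x) * Complex.I
    = 2 * (Real.pi : ℂ) * Complex.I * t * x by ring]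
  ring

theorem summable_norm_fourier_int (u : 𝓢(ℝ, ℂ)) :
    Summable fun t : ℤ => ‖(FourierTransform.fourier u : 𝓢(ℝ, ℂ)) (-(t : ℝ))‖ := by
  obtain ⟨A, hA⟩ := (FourierTransform.fourier u : 𝓢(ℝ, ℂ)).exists_tsum_enorm_translates_le
  have h := tsum_enorm_ne_top_iff_summable_norm.1 ((hA 0).trans_lt ENNReal.coe_lt_top).ne
  simp only [zero_add] at h
  simpa [Function.comp_def] using (Equiv.neg ℤ).summable_iff.2 h

theorem tsum_translates_eq_tsum_fourier (u : 𝓢(ℝ, ℂ)) (x : ℝ) :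
    ∑' k : ℤ, u (x + k)
      = ∑' t : ℤ, expChar (-(t : ℝ)) x * (FourierTransform.fourier u : 𝓢(ℝ, ℂ)) (-(t : ℝ)) := by
  rw [SchwartzMap.tsum_eq_tsum_fourier, ← (Equiv.neg ℤ).tsum_eq]
  refine tsum_congr fun t => ?_
  rw [fourier_coe_apply, SchwartzMap.fourier_coe, mul_comm, expChar, Equiv.neg_apply]
  push_cast
  congr 2
  ring

theorem norm_dualAtom_le {C : ℝ} (hC : ∀ x, |dualWindow x| ≤ C) (p t x : ℝ) :
    ‖(dualWindow (x - p) : ℂ) * expChar t x‖ ≤ C := by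
  rw [norm_mul, norm_expChar, mul_one, Complex.norm_real]
  exact hC _

theorem measurable_dualAtom (p t : ℝ) :
    Measurable fun x : ℝ => (dualWindow (x - p) : ℂ) * expChar t x := by
  have h : Measurable fun x : ℝ => dualWindow (x - p) :=
    measurable_dualWindow.comp (measurable_id.sub_const p)
  have h' : Measurable fun x : ℝ => (dualWindow (x - p) : ℂ) := Complex.measurable_ofReal.comp h
  exact h'.mul (continuous_expChar t).measurable

theorem integrable_mul_dualAtom {h : ℝ → ℂ} (hh : Integrable h) (p t : ℝ) :
    Integrable fun x : ℝ => h x * ((dualWindow (x - p) : ℂ) * expChar t x) := by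
  obtain ⟨C, -, hC⟩ := exists_abs_dualWindow_le
  exact hh.mul_bdd (c := C) (measurable_dualAtom p t).aestronglyMeasurable
    (ae_of_all _ fun x => norm_dualAtom_le hC p t x)

/-- At a fixed position p the sum over frequencies is a Fourier series, which Poisson summation for
ψ e_0(· - p) turns into a sum over integer translates. -/
theorem tsum_dualCoeff_mul {f : L2R} (hf : Integrable (f : ℝ → ℂ)) (ψ : 𝓢(ℝ, ℂ)) (p : ℤ) :
    ∑' t : ℤ, dualCoeff (p, t) f * ∫ x : ℝ, ψ x * gaborFun (latticePoint (p, t)) x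
      = ∫ x : ℝ, ∑' k : ℤ, f x * ψ (x + k)
          * ((dualWindow (x - p) : ℂ) * gaborFun 0 (x + k - p)) := by
  obtain ⟨C, hC0, hC⟩ := exists_abs_dualWindow_le
  set b : ℤ → ℂ := fun t => FourierTransform.fourier (windowed ψ p) (-(t : ℝ)) with hb
  have hbs : Summable fun t => ‖b t‖ := summable_norm_fourier_int _
  have hint : ∀ t : ℤ, Integrable fun x : ℝ =>
      f x * ((dualWindow (x - p) : ℂ) * expChar (-(t : ℝ)) x) * b t := fun t =>
    (integrable_mul_dualAtom hf p (-(t : ℝ))).mul_const _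
  have hsum : Summable fun t : ℤ => ∫ x : ℝ,
      ‖f x * ((dualWindow (x - p) : ℂ) * expChar (-(t : ℝ)) x) * b t‖ := by
    refine Summable.of_nonneg_of_le (fun t => integral_nonneg fun x => norm_nonneg _) (fun t => ?_)
      (hbs.mul_left (C * ∫ x, ‖f x‖))
    rw [← integral_const_mul, ← integral_mul_const]
    refine integral_mono (hint t).norm ((hf.norm.const_mul C).mul_const _) fun x => ?_
    simp only [norm_mul (_ * _ : ℂ) (b t)]
    rw [norm_mul (f x), mul_comm C]
    gcongr
    exact norm_dualAtom_le hC _ _ _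
  have h := integral_tsum_of_summable_integral_norm hint hsum
  have h1 : ∀ t : ℤ, dualCoeff (p, t) f * ∫ x : ℝ, ψ x * gaborFun (latticePoint (p, t)) x
      = ∫ x : ℝ, f x * ((dualWindow (x - p) : ℂ) * expChar (-(t : ℝ)) x) * b t := by
    intro t
    rw [integral_mul_const, dualCoeff, latticePoint, integral_mul_gaborFun_eq_fourier]
  simp_rw [h1]
  rw [h]
  refine integral_congr_ae (ae_of_all _ fun x => ?_)
  have h2 := tsum_translates_eq_tsum_fourier (windowed ψ p) x
  simp only
  calc ∑' t : ℤ, f x * ((dualWindow (x - p) : ℂ) * expChar (-(t : ℝ)) x) * b t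
      = f x * (dualWindow (x - p) : ℂ) * ∑' t : ℤ, expChar (-(t : ℝ)) x * b t := by
        rw [← tsum_mul_left]
        exact tsum_congr fun t => by ring
    _ = _ := by
        rw [hb, ← h2, ← tsum_mul_left]
        exact tsum_congr fun k => by rw [windowed_apply]; ring

/-- The majorant for exchanging the sums over p and k with each other and with the integral. Summing
over p first uses only that w is bounded and that the Gaussian has summable translates. -/
theorem exists_tsum_tsum_enorm_le (ψ : 𝓢(ℝ, ℂ)) : ∃ A : ℝ≥0, ∀ x : ℝ,
    ∑' p : ℤ, ∑' k : ℤ, ‖ψ (x + k) * ((dualWindow (x - p) : ℂ) * gaborFun 0 (x + k - p))‖ₑ ≤ A := by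
  obtain ⟨C, hC0, hC⟩ := exists_abs_dualWindow_le
  obtain ⟨A, hA⟩ := ψ.exists_tsum_enorm_translates_le
  obtain ⟨B, hB⟩ := gaussianSchwartz.exists_tsum_enorm_translates_le
  refine ⟨A * (C.toNNReal * B), fun x => ?_⟩
  rw [ENNReal.tsum_comm]
  calc ∑' k : ℤ, ∑' p : ℤ, ‖ψ (x + k) * ((dualWindow (x - p) : ℂ) * gaborFun 0 (x + k - p))‖ₑ
      ≤ ∑' k : ℤ, ∑' p : ℤ, ‖ψ (x + k)‖ₑ * (C.toNNReal * ‖gaborFun 0 (x + k - p)‖ₑ) := by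
        refine ENNReal.tsum_le_tsum fun k => ENNReal.tsum_le_tsum fun p => ?_
        rw [enorm_mul, enorm_mul]
        gcongr
        rw [← ofReal_norm, Complex.norm_real]
        exact ENNReal.ofReal_le_ofReal (hC _)
    _ = ∑' k : ℤ, ‖ψ (x + k)‖ₑ * (C.toNNReal * ∑' p : ℤ, ‖gaussianSchwartz (x + k - p)‖ₑ) := by
        simp only [ENNReal.tsum_mul_left, gaussianSchwartz_apply]
    _ ≤ ∑' k : ℤ, ‖ψ (x + k)‖ₑ * (C.toNNReal * B) := by
        gcongr with k
        exact tsum_enorm_translates_sub_le hB _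
    _ ≤ _ := by
        rw [ENNReal.tsum_mul_right]
        push_cast
        gcongr
        exact hA x

/-- The Bessel inequality supplies an L₂ limit r. It is identified by testing against Schwartz
functions, where Poisson summation and then duality can be applied. -/
theorem hasSum_dualCoeff_smul_gaborVec {f : L2R} (hf : Integrable (f : ℝ → ℂ))
    (hs : Summable fun n => ‖dualCoeff n f‖ ^ 2) :
    HasSum (fun n => dualCoeff n f • gaborVec (latticePoint n))
      ((((2 : ℝ) ^ (1 / 4 : ℝ) * altTailSum : ℝ) : ℂ) • f) := by
  have hsum : Summable fun n => dualCoeff n f • gaborVec (latticePoint n) := by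
    simpa only [tfVec_gaussian] using summable_smul_tfVec gaussianSchwartz hs
  obtain ⟨r, hr⟩ := hsum
  convert hr using 1
  apply toDist_injective
  ext ψ
  have h1 : HasSum (fun n => dualCoeff n f * ∫ x : ℝ, ψ x * gaborFun (latticePoint n) x)
      (toDist r ψ) := by
    have h := (hr.mapL toDist).mapL (PointwiseConvergenceCLM.evalCLM (RingHom.id ℂ) ℂ ψ)
    have h' : ∀ n, dualCoeff n f * ∫ x : ℝ, ψ x * gaborFun (latticePoint n) x
        = toDist (dualCoeff n f • gaborVec (latticePoint n)) ψ := fun n => by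
      have e : toDist (gaborVec (latticePoint n)) ψ
          = ∫ x : ℝ, ψ x * gaborFun (latticePoint n) x := by
        rw [← tfVec_gaussian, tfVec, toDist_toLp_apply, coe_tfShift_gaussian]
      rw [map_smul, ← e]
      rfl
    simp_rw [h']
    exact h
  have h2 : HasSum (fun p : ℤ => ∫ x : ℝ, ∑' k : ℤ, f x * ψ (x + k)
      * ((dualWindow (x - p) : ℂ) * gaborFun 0 (x + k - p))) (toDist r ψ) := by
    simp_rw [← tsum_dualCoeff_mul hf ψ]
    exact h1.prod_fiberwise fun p => (h1.summable.prod_factor p).hasSum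
  obtain ⟨A, hA⟩ := exists_tsum_tsum_enorm_le ψ
  have hbound : ∀ x : ℝ, ∑' p : ℤ, ∑' k : ℤ, ‖f x * ψ (x + k)
      * ((dualWindow (x - p) : ℂ) * gaborFun 0 (x + k - p))‖ₑ ≤ A * ‖f x‖ₑ := fun x => by
    simp only [mul_assoc (f x), enorm_mul (f x), ENNReal.tsum_mul_left]
    rw [mul_comm (A : ℝ≥0∞)]
    gcongr
    exact hA x
  have hmk : ∀ p k : ℤ, Measurable fun x : ℝ => ψ (x + k)
      * ((dualWindow (x - p) : ℂ) * gaborFun 0 (x + k - p)) := fun p k => by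
    have e1 : Measurable fun x : ℝ => ψ (x + k) :=
      (ψ.continuous.comp (continuous_id.add continuous_const)).measurable
    have e2 : Measurable fun x : ℝ => gaborFun 0 (x + k - p) :=
      ((continuous_gaborFun 0).comp
        ((continuous_id.add continuous_const).sub continuous_const)).measurable
    have e3 : Measurable fun x : ℝ => (dualWindow (x - p) : ℂ) := by
      have h : Measurable fun x : ℝ => dualWindow (x - p) :=
        measurable_dualWindow.comp (measurable_id.sub_const (p : ℝ))
      exact Complex.measurable_ofReal.comp h
    exact e1.mul (e3.mul e2)
  have hfm : AEStronglyMeasurable (f : ℝ → ℂ) volume := hf.aestronglyMeasurable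
  have hG : ∀ p k : ℤ, AEStronglyMeasurable (fun x : ℝ => f x * ψ (x + k)
      * ((dualWindow (x - p) : ℂ) * gaborFun 0 (x + k - p))) volume := fun p k => by
    simp only [mul_assoc (f _)]
    exact hfm.mul (hmk p k).aestronglyMeasurable
  have hlt : ∀ x : ℝ, ∑' p : ℤ, ∑' k : ℤ, ‖f x * ψ (x + k)
      * ((dualWindow (x - p) : ℂ) * gaborFun 0 (x + k - p))‖ₑ ≠ ⊤ := fun x =>
    ((hbound x).trans_lt (ENNReal.mul_lt_top ENNReal.coe_lt_top enorm_lt_top)).ne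
  have hsumm : ∀ x : ℝ, Summable (Function.uncurry fun p k : ℤ => f x * ψ (x + k)
      * ((dualWindow (x - p) : ℂ) * gaborFun 0 (x + k - p))) := fun x => by
    refine Summable.of_enorm ?_
    rw [ENNReal.tsum_prod']
    exact hlt x
  -- With the order of summation exchanged, duality leaves only the translate k = 0.
  have h3 : ∀ x : ℝ, ∑' p : ℤ, ∑' k : ℤ, f x * ψ (x + k)
      * ((dualWindow (x - p) : ℂ) * gaborFun 0 (x + k - p))
      = ψ x * ((((2 : ℝ) ^ (1 / 4 : ℝ) * altTailSum : ℝ) : ℂ) * f x) := fun x => by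
    rw [← (hsumm x).tsum_comm]
    simp only [tsum_mul_left, tsum_dualWindow_mul_gaborFun]
    rw [tsum_eq_single 0 fun k hk => by rw [if_neg hk, mul_zero]]
    simp
    ring
  have h4 : ∫ x : ℝ, ∑' p : ℤ, ∑' k : ℤ, f x * ψ (x + k)
      * ((dualWindow (x - p) : ℂ) * gaborFun 0 (x + k - p)) = toDist r ψ := by
    rw [integral_tsum, h2.tsum_eq]
    · intro p
      have hS : ∀ x : ℝ, Summable fun k : ℤ => f x * ψ (x + k)
          * ((dualWindow (x - p) : ℂ) * gaborFun 0 (x + k - p)) := fun x =>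
        (hsumm x).prod_factor p
      refine aestronglyMeasurable_of_tendsto_ae (atTop : Filter (Finset ℤ))
        (f := fun (S : Finset ℤ) (x : ℝ) => ∑ k ∈ S, f x * ψ (x + k)
          * ((dualWindow (x - p) : ℂ) * gaborFun 0 (x + k - p))) (fun S => ?_)
        (ae_of_all _ fun x => (hS x).hasSum)
      exact Finset.aestronglyMeasurable_fun_sum S fun k _ => hG p k
    · refine ne_top_of_le_ne_top (ENNReal.mul_ne_top (ENNReal.coe_ne_top (r := A))
        hf.hasFiniteIntegral.ne) ?_
      rw [← lintegral_const_mul' _ _ ENNReal.coe_ne_top]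
      calc ∑' p : ℤ, ∫⁻ x : ℝ, ‖∑' k : ℤ, f x * ψ (x + k)
            * ((dualWindow (x - p) : ℂ) * gaborFun 0 (x + k - p))‖ₑ
          ≤ ∑' p : ℤ, ∫⁻ x : ℝ, ∑' k : ℤ, ‖f x * ψ (x + k)
            * ((dualWindow (x - p) : ℂ) * gaborFun 0 (x + k - p))‖ₑ := by
            gcongr with p x
            exact enorm_tsum_le_tsum_enorm
        _ = ∫⁻ x : ℝ, ∑' p : ℤ, ∑' k : ℤ, ‖f x * ψ (x + k)
            * ((dualWindow (x - p) : ℂ) * gaborFun 0 (x + k - p))‖ₑ := by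
            rw [lintegral_tsum]
            intro p
            exact AEMeasurable.tsum fun k => (hG p k).enorm
        _ ≤ _ := lintegral_mono hbound
  rw [← h4, toDist_apply]
  refine integral_congr_ae ?_
  filter_upwards [Lp.coeFn_smul (((2 : ℝ) ^ (1 / 4 : ℝ) * altTailSum : ℝ) : ℂ) f] with x hx
  rw [h3, hx, Pi.smul_apply, smul_eq_mul]

/-! ### Functions with a continuous distributional derivative -/

theorem exists_compactSupport_primitive {k : ℝ → ℝ} (hk : ContDiff ℝ ((⊤ : ℕ∞) : WithTop ℕ∞) k)
    (hkc : HasCompactSupport k) (hk0 : ∫ x, k x = 0) :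
    ∃ G : ℝ → ℝ, ContDiff ℝ ((⊤ : ℕ∞) : WithTop ℕ∞) G ∧ HasCompactSupport G ∧ deriv G = k := by
  obtain ⟨R, hR⟩ := hkc.isCompact.isBounded.subset_closedBall 0
  rw [Real.closedBall_eq_Icc] at hR
  simp only [zero_sub, zero_add] at hR
  have hz : ∀ x, x ∉ Set.Icc (-R) R → k x = 0 := fun x hx => by
    by_contra h
    exact hx (hR (subset_tsupport k h))
  have hz' : ∀ x, x ∉ Set.Ioc (-R - 1) R → k x = 0 := fun x hx => hz x fun h =>
    hx ⟨by linarith [h.1], h.2⟩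
  have hd : ∀ x, HasDerivAt (fun x => ∫ t in (-R - 1)..x, k t) (k x) x := fun x =>
    intervalIntegral.integral_hasDerivAt_right (hk.continuous.intervalIntegrable _ _)
      hk.continuous.stronglyMeasurable.stronglyMeasurableAtFilter hk.continuous.continuousAt
  have hderiv : deriv (fun x => ∫ t in (-R - 1)..x, k t) = k := funext fun x => (hd x).deriv
  refine ⟨fun x => ∫ t in (-R - 1)..x, k t, ?_, ?_, hderiv⟩
  · rw [contDiff_infty_iff_deriv, hderiv]
    exact ⟨fun x => (hd x).differentiableAt, hk⟩
  · refine HasCompactSupport.intro (isCompact_Icc (a := -R - 1) (b := R)) fun x hx => ?_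
    rcases lt_or_ge x (-R - 1) with h | h
    · rw [intervalIntegral.integral_symm, neg_eq_zero]
      refine intervalIntegral.integral_zero_ae (ae_of_all _ fun t ht => hz' t fun ht' => ?_)
      rw [Set.uIoc_of_le h.le] at ht
      exact absurd ht.2 (not_le.2 ht'.1)
    · have h' : R < x := by
        by_contra hc
        exact hx ⟨h, not_lt.1 hc⟩
      rw [intervalIntegral.integral_of_le h, ← hk0]
      exact setIntegral_eq_integral_of_forall_compl_eq_zero fun t ht => hz' t fun ht' =>
        ht ⟨ht'.1, ht'.2.trans h'.le⟩

/-- The du Bois-Reymond lemma: if e is a fixed bump of integral 1, every test function g is (∫ g) e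
plus a function of zero mean, and the latter is the derivative of a test function. -/
theorem exists_eq_const_of_integral_deriv_smul_eq_zero {W : ℝ → ℂ} (hW : Continuous W)
    (h : ∀ g : ℝ → ℝ, ContDiff ℝ ((⊤ : ℕ∞) : WithTop ℕ∞) g → HasCompactSupport g →
      ∫ x, deriv g x • W x = 0) : ∃ c, ∀ x, W x = c := by
  let η : ContDiffBump (0 : ℝ) := ⟨1, 2, one_pos, one_lt_two⟩
  set e : ℝ → ℝ := η.normed volume with he
  have he1 : ContDiff ℝ ((⊤ : ℕ∞) : WithTop ℕ∞) e := η.contDiff_normed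
  have he2 : HasCompactSupport e := η.hasCompactSupport_normed
  have he3 : ∫ x, e x = 1 := η.integral_normed
  refine ⟨∫ x, e x • W x, fun x => ?_⟩
  have hae : W =ᵐ[volume] fun _ => ∫ x, e x • W x := by
    refine ae_eq_of_integral_contDiff_smul_eq hW.locallyIntegrable
      continuous_const.locallyIntegrable fun g hg hgc => ?_
    have hgi : Integrable g := hg.continuous.integrable_of_hasCompactSupport hgc
    have hei : Integrable e := he1.continuous.integrable_of_hasCompactSupport he2
    obtain ⟨G, hG1, hG2, hG3⟩ := exists_compactSupport_primitive
      (k := fun x => g x - (∫ y, g y) * e x) (hg.sub (contDiff_const.mul he1))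
      (hgc.sub he2.mul_left) (by
        rw [integral_sub hgi (hei.const_mul _), integral_const_mul, he3, mul_one, sub_self])
    have h0 := h G hG1 hG2
    rw [hG3] at h0
    have hgW : Integrable fun x => g x • W x :=
      (hg.continuous.smul hW).integrable_of_hasCompactSupport hgc.smul_right
    have heW : Integrable fun x => e x • W x :=
      (he1.continuous.smul hW).integrable_of_hasCompactSupport he2.smul_right
    have heW' : Integrable fun x => (∫ y, g y) • e x • W x := heW.smul (∫ y, g y)
    simp only [sub_smul, mul_smul] at h0
    rw [integral_sub hgW heW', integral_smul, sub_eq_zero] at h0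
    rw [h0, integral_smul_const]
  exact congrFun ((hW.ae_eq_iff_eq volume continuous_const).1 hae) x

theorem hasDerivAt_of_integral_deriv_smul {F v : ℝ → ℂ} (hF : Continuous F) (hv : Continuous v)
    (h : ∀ g : ℝ → ℝ, ContDiff ℝ ((⊤ : ℕ∞) : WithTop ℕ∞) g → HasCompactSupport g →
      ∫ x, deriv g x • F x = -∫ x, g x • v x) (x : ℝ) : HasDerivAt F (v x) x := by
  set V : ℝ → ℂ := fun x => ∫ t in (0 : ℝ)..x, v t with hVdef
  have hV : ∀ x, HasDerivAt V (v x) x := fun x =>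
    intervalIntegral.integral_hasDerivAt_right (hv.intervalIntegrable _ _)
      hv.stronglyMeasurable.stronglyMeasurableAtFilter hv.continuousAt
  have hVc : Continuous V := continuous_iff_continuousAt.2 fun x => (hV x).continuousAt
  obtain ⟨c, hc⟩ := exists_eq_const_of_integral_deriv_smul_eq_zero (hF.sub hVc) fun g hg hgc => by
    have hgd : Continuous (deriv g) := hg.continuous_deriv (by simp)
    have i1 : Integrable fun x => deriv g x • F x :=
      (hgd.smul hF).integrable_of_hasCompactSupport hgc.deriv.smul_right
    have i2 : Integrable fun x => deriv g x • V x :=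
      (hgd.smul hVc).integrable_of_hasCompactSupport hgc.deriv.smul_right
    have i3 : Integrable fun x => g x • v x :=
      (hg.continuous.smul hv).integrable_of_hasCompactSupport hgc.smul_right
    have i4 : Integrable fun x => g x • V x :=
      (hg.continuous.smul hVc).integrable_of_hasCompactSupport hgc.smul_right
    have hgda : ∀ x, HasDerivAt g (deriv g x) x := fun x =>
      (hg.differentiable (by simp) x).hasDerivAt
    have h1 : ∫ x, (deriv g x • V x + g x • v x) = 0 := by
      refine integral_eq_zero_of_hasDerivAt_of_integrable (f := fun x => g x • V x)
        (fun x => ?_) (i2.add i3) i4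
      exact ((hgda x).smul (hV x)).congr_deriv (add_comm _ _)
    rw [integral_add i2 i3] at h1
    simp only [Pi.sub_apply, smul_sub]
    rw [integral_sub i1 i2, h g hg hgc]
    linear_combination -h1
  have hFV : F = fun x => V x + c := funext fun x => by
    have := hc x
    simp only [Pi.sub_apply] at this
    rw [← this]
    ring
  rw [hFV]
  exact (hV x).add_const c

/-- The distributional relation becomes a classical one because both sides have continuous
representatives. The fundamental theorem of calculus between half-integers needs this form. -/
theorem hasDerivAt_gaborRep {f h : L2R} (hf : Integrable (gaborTransform f))
    (hh : Integrable (gaborTransform h)) (hfh : toDist h = annihilation (toDist f)) (x : ℝ) :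
    HasDerivAt (gaborRep f) (2 * (Real.pi : ℂ) * (gaborRep h x - x * gaborRep f x)) x := by
  have hfc := continuous_gaborRep hf
  have hhc := continuous_gaborRep hh
  refine hasDerivAt_of_integral_deriv_smul
    (v := fun x : ℝ => 2 * (Real.pi : ℂ) * (gaborRep h x - x * gaborRep f x)) hfc
    (by fun_prop) (fun g hg hgc => ?_) x
  have hx : Function.HasTemperateGrowth (fun x : ℝ => (x : ℂ)) :=
    Function.Complex.hasTemperateGrowth_ofReal
  have hg₁ : HasCompactSupport (Complex.ofRealCLM ∘ g) := hgc.comp_left rfl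
  have hg₂ : ContDiff ℝ ((⊤ : ℕ∞) : WithTop ℕ∞) (Complex.ofRealCLM ∘ g) := by fun_prop
  set ψ : 𝓢(ℝ, ℂ) := hg₁.toSchwartzMap hg₂ with hψ
  have hψx : ∀ x, ψ x = (g x : ℂ) := fun x => rfl
  have hψd : ∀ x, deriv ψ x = ((deriv g x : ℝ) : ℂ) := fun x => by
    have : HasDerivAt ψ ((deriv g x : ℝ) : ℂ) x :=
      (hg.differentiable (by simp) x).hasDerivAt.ofReal_comp
    exact this.deriv
  have hgd : Continuous (deriv g) := hg.continuous_deriv (by simp)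
  have i1 : Integrable fun x => deriv g x • gaborRep f x :=
    (hgd.smul hfc).integrable_of_hasCompactSupport hgc.deriv.smul_right
  have i2 : Integrable fun x => g x • gaborRep h x :=
    (hg.continuous.smul hhc).integrable_of_hasCompactSupport hgc.smul_right
  have i3 : Integrable fun x : ℝ => g x • ((x : ℂ) * gaborRep f x) :=
    (hg.continuous.smul (Complex.continuous_ofReal.mul hfc)).integrable_of_hasCompactSupport
      hgc.smul_right
  have h1 : toDist h ψ = ∫ x, g x • gaborRep h x := by
    rw [toDist_apply]
    refine integral_congr_ae ?_
    filter_upwards [ae_eq_gaborRep hh] with x hx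
    rw [hx, hψx, Complex.real_smul]
  have h2 : annihilation (toDist f) ψ = -(1 / (2 * Real.pi) : ℂ) * (∫ x, deriv g x • gaborRep f x)
      + ∫ x : ℝ, g x • ((x : ℂ) * gaborRep f x) := by
    have h3 : annihilation (toDist f) ψ
        = (1 / (2 * Real.pi) : ℂ) * toDist f (-SchwartzMap.derivCLM ℂ ℂ ψ)
          + toDist f (SchwartzMap.smulLeftCLM ℂ (fun x : ℝ => (x : ℂ)) ψ) := by
      simp [annihilation]
    rw [h3, map_neg, mul_neg, ← neg_mul, toDist_apply, toDist_apply]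
    congr 1
    · congr 1
      refine integral_congr_ae ?_
      filter_upwards [ae_eq_gaborRep hf] with x hx
      rw [hx, SchwartzMap.derivCLM_apply ℂ, hψd, Complex.real_smul]
    · refine integral_congr_ae ?_
      filter_upwards [ae_eq_gaborRep hf] with x hx'
      rw [hx', SchwartzMap.smulLeftCLM_apply_apply hx, hψx, Complex.real_smul, smul_eq_mul]
      ring
  rw [← hfh, h1] at h2
  have h4 : ∫ x : ℝ, g x • (2 * (Real.pi : ℂ) * (gaborRep h x - x * gaborRep f x))
      = 2 * (Real.pi : ℂ) * ((∫ x, g x • gaborRep h x)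
        - ∫ x : ℝ, g x • ((x : ℂ) * gaborRep f x)) := by
    rw [← integral_sub i2 i3, ← integral_const_mul]
    refine integral_congr_ae (ae_of_all _ fun x => ?_)
    simp only [Complex.real_smul]
    ring
  have hpi : (Real.pi : ℂ) ≠ 0 := by exact_mod_cast Real.pi_ne_zero
  rw [h4, h2]
  generalize (∫ x, deriv g x • gaborRep f x) = D
  generalize (∫ x : ℝ, g x • ((x : ℂ) * gaborRep f x)) = X
  have e : 2 * (Real.pi : ℂ) * (1 / (2 * Real.pi)) = 1 := by field_simp
  linear_combination -D * e

/-! ### Weighted estimates for the Gabor transform -/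

/-- The reciprocal of the weight of `gaborNorm`. -/
def invWeight (d : ℝ) (l : ℝ × ℝ) : ℝ≥0∞ := (ENNReal.ofReal ((phaseAbs l ^ d + 1) ^ 2))⁻¹

theorem phaseAbs_nonneg (l : ℝ × ℝ) : 0 ≤ phaseAbs l := Real.sqrt_nonneg _

theorem norm_le_phaseAbs (l : ℝ × ℝ) : ‖l‖ ≤ phaseAbs l := by
  rw [Prod.norm_def, phaseAbs]
  refine max_le ?_ ?_ <;> rw [Real.norm_eq_abs] <;> refine Real.abs_le_sqrt ?_ <;>
    nlinarith [sq_nonneg l.1, sq_nonneg l.2]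

theorem measurable_phaseAbs : Measurable phaseAbs := by
  unfold phaseAbs
  fun_prop

theorem measurable_invWeight (d : ℝ) : Measurable (invWeight d) := by
  unfold invWeight
  have := measurable_phaseAbs
  fun_prop

theorem gaborNorm_sq (d : ℝ) (f : L2R) : gaborNorm d f ^ 2
    = ∫⁻ l : ℝ × ℝ, ENNReal.ofReal ((phaseAbs l ^ d + 1) ^ 2) * ‖gaborTransform f l‖ₑ ^ 2 := by
  rw [gaborNorm, ← ENNReal.rpow_natCast, ← ENNReal.rpow_mul]
  norm_num

theorem weight_pos (d : ℝ) (l : ℝ × ℝ) : 0 < (phaseAbs l ^ d + 1) ^ 2 := by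
  have := Real.rpow_nonneg (phaseAbs_nonneg l) d
  positivity

theorem lintegral_mul_sq_le {α : Type*} [MeasurableSpace α] {ν : Measure α} {u v : α → ℝ≥0∞}
    (hu : AEMeasurable u ν) (hv : AEMeasurable v ν) :
    (∫⁻ a, u a * v a ∂ν) ^ 2 ≤ (∫⁻ a, u a ^ 2 ∂ν) * ∫⁻ a, v a ^ 2 ∂ν := by
  have h := ENNReal.lintegral_mul_le_Lp_mul_Lq ν Real.HolderConjugate.two_two hu hv
  calc (∫⁻ a, u a * v a ∂ν) ^ 2
      ≤ ((∫⁻ a, u a ^ (2 : ℝ) ∂ν) ^ (1 / (2 : ℝ)) * (∫⁻ a, v a ^ (2 : ℝ) ∂ν) ^ (1 / (2 : ℝ))) ^ 2 :=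
        pow_le_pow_left₀ zero_le h 2
    _ = _ := by
        rw [mul_pow, ← ENNReal.rpow_natCast, ← ENNReal.rpow_mul, ← ENNReal.rpow_natCast,
          ← ENNReal.rpow_mul]
        norm_num

theorem lintegral_gaborTransform_mul_sq_le (d : ℝ) (f : L2R) {k : ℝ × ℝ → ℝ≥0∞}
    (hk : Measurable k) :
    (∫⁻ l, ‖gaborTransform f l‖ₑ * k l) ^ 2
      ≤ gaborNorm d f ^ 2 * ∫⁻ l, k l ^ 2 * invWeight d l := by
  have hφ := (stronglyMeasurable_gaborTransform f).measurable.enorm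
  have hw : Measurable fun l => ENNReal.ofReal (phaseAbs l ^ d + 1) := by
    have := measurable_phaseAbs
    fun_prop
  have hpos : ∀ l, 0 < phaseAbs l ^ d + 1 := fun l => by
    have := Real.rpow_nonneg (phaseAbs_nonneg l) d
    positivity
  have h1 : ∀ l, ENNReal.ofReal ((phaseAbs l ^ d + 1) ^ 2)
      = ENNReal.ofReal (phaseAbs l ^ d + 1) ^ 2 := fun l => ENNReal.ofReal_pow (hpos l).le 2
  have h := lintegral_mul_sq_le (ν := volume)
    (u := fun l => ENNReal.ofReal (phaseAbs l ^ d + 1) * ‖gaborTransform f l‖ₑ)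
    (v := fun l => k l * (ENNReal.ofReal (phaseAbs l ^ d + 1))⁻¹)
    (hw.mul hφ).aemeasurable (hk.mul hw.inv).aemeasurable
  rw [gaborNorm_sq]
  convert h using 2
  · refine lintegral_congr fun l => ?_
    have hc := ENNReal.mul_inv_cancel (a := ENNReal.ofReal (phaseAbs l ^ d + 1))
      (by simpa using hpos l) ENNReal.ofReal_ne_top
    calc _ = (ENNReal.ofReal (phaseAbs l ^ d + 1) * (ENNReal.ofReal (phaseAbs l ^ d + 1))⁻¹)
          * (‖gaborTransform f l‖ₑ * k l) := by rw [hc, one_mul]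
      _ = _ := by ring
  · refine lintegral_congr fun l => ?_
    rw [h1, mul_pow]
  · refine lintegral_congr fun l => ?_
    rw [mul_pow, invWeight, h1, ENNReal.inv_pow]

theorem invWeight_le {d : ℝ} (hd : 0 ≤ d) (l : ℝ × ℝ) :
    invWeight d l ≤ ENNReal.ofReal (4 ^ d * (1 + ‖l‖) ^ (-(2 * d))) := by
  have h0 := norm_nonneg l
  have h1 := norm_le_phaseAbs l
  have h2 := phaseAbs_nonneg l
  rw [invWeight, ← ENNReal.ofReal_inv_of_pos (weight_pos d l)]
  refine ENNReal.ofReal_le_ofReal ?_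
  have h3 : (1 + ‖l‖) ^ d ≤ 2 ^ d * (phaseAbs l ^ d + 1) := by
    have h5 := Real.rpow_nonneg h2 d
    have hd2 : (0 : ℝ) < 2 ^ d := by positivity
    rcases le_total (phaseAbs l) 1 with h | h
    · calc (1 + ‖l‖) ^ d ≤ 2 ^ d := Real.rpow_le_rpow (by positivity) (by linarith) hd
        _ ≤ _ := le_mul_of_one_le_right hd2.le (by linarith)
    · calc (1 + ‖l‖) ^ d ≤ (2 * phaseAbs l) ^ d :=
            Real.rpow_le_rpow (by positivity) (by linarith) hd
        _ = 2 ^ d * phaseAbs l ^ d := Real.mul_rpow (by norm_num) h2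
        _ ≤ _ := by gcongr; linarith
  have h4 : (0 : ℝ) < (1 + ‖l‖) ^ d := by positivity
  have e4 : (4 : ℝ) ^ d = (2 ^ d) ^ 2 := by
    rw [← Real.rpow_natCast, ← Real.rpow_mul (by norm_num), mul_comm, Real.rpow_mul (by norm_num)]
    norm_num
  have e5 : (1 + ‖l‖) ^ (-(2 * d)) = (((1 + ‖l‖) ^ d) ^ 2)⁻¹ := by
    rw [Real.rpow_neg (by positivity), ← Real.rpow_natCast, ← Real.rpow_mul (by positivity)]
    congr 2
    push_cast
    ring
  rw [e4, e5, ← div_eq_mul_inv, inv_le_comm₀ (weight_pos d l) (by positivity), inv_div,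
    div_le_iff₀ (by positivity)]
  calc ((1 + ‖l‖) ^ d) ^ 2 ≤ (2 ^ d * (phaseAbs l ^ d + 1)) ^ 2 := by gcongr
    _ = _ := by ring

theorem lintegral_one_add_norm_rpow_lt_top {s : ℝ} (hs : 2 < s) :
    ∫⁻ l : ℝ × ℝ, ENNReal.ofReal ((1 + ‖l‖) ^ (-s)) < ⊤ := by
  have h := integrable_one_add_norm (E := ℝ × ℝ) (μ := volume) (r := s) (by simpa using hs)
  have h2 := h.hasFiniteIntegral
  rw [HasFiniteIntegral] at h2
  refine lt_of_eq_of_lt (lintegral_congr fun l => ?_) h2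
  rw [← ofReal_norm, Real.norm_of_nonneg (by positivity)]

/-- Cauchy–Schwarz against the weight. The condition δ > 1 is what makes (1 + |l|)^(-2δ) integrable
over the plane. -/
theorem exists_lintegral_gaborTransform_sq_le {d : ℝ} (hd : 1 < d) :
    ∃ C : ℝ≥0, ∀ f : L2R, (∫⁻ l, ‖gaborTransform f l‖ₑ) ^ 2 ≤ C * gaborNorm d f ^ 2 := by
  have hfin : ∫⁻ l, invWeight d l < ⊤ := by
    refine (lintegral_mono fun l => invWeight_le (by linarith : 0 ≤ d) l).trans_lt ?_
    simp only [ENNReal.ofReal_mul (by positivity : (0 : ℝ) ≤ 4 ^ d)]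
    rw [lintegral_const_mul' _ _ ENNReal.ofReal_ne_top]
    exact ENNReal.mul_lt_top ENNReal.ofReal_lt_top
      (lintegral_one_add_norm_rpow_lt_top (by linarith))
  refine ⟨(∫⁻ l, invWeight d l).toNNReal, fun f => ?_⟩
  have h := lintegral_gaborTransform_mul_sq_le d f (k := fun _ => 1) measurable_const
  simp only [mul_one, one_pow, one_mul] at h
  rw [ENNReal.coe_toNNReal hfin.ne, mul_comm]
  exact h

theorem integrable_gaborTransform {d : ℝ} (hd : 1 < d) {f : L2R} (hf : gaborNorm d f < ⊤) :
    Integrable (gaborTransform f) := by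
  obtain ⟨C, hC⟩ := exists_lintegral_gaborTransform_sq_le hd
  refine ⟨(stronglyMeasurable_gaborTransform f).aestronglyMeasurable, ?_⟩
  rw [HasFiniteIntegral]
  have h : (∫⁻ l, ‖gaborTransform f l‖ₑ) ^ 2 < ⊤ :=
    (hC f).trans_lt (ENNReal.mul_lt_top ENNReal.coe_lt_top (ENNReal.pow_lt_top hf))
  exact (ENNReal.pow_lt_top_iff.1 h).resolve_right two_ne_zero

/-! ### Gabor transforms of the Gabor functions. -/

theorem norm_gaborTransform_gaborVec (a l : ℝ × ℝ) :
    ‖gaborTransform (gaborVec a) l‖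
      = Real.exp (-(Real.pi / 2) * ((l.1 - a.1) ^ 2 + (l.2 - a.2) ^ 2)) := by
  have h1 : gaborTransform (gaborVec a) l
      = ∫ x : ℝ, gaborFun a x * (starRingEnd ℂ) (gaborFun l x) := by
    rw [gaborTransform_eq_integral]
    refine integral_congr_ae ?_
    filter_upwards [(memLp_gaborFun a).coeFn_toLp] with x hx
    rw [gaborVec, hx]
  have h2 : ∀ x : ℝ, gaborFun a x * (starRingEnd ℂ) (gaborFun l x)
      = ((√2 : ℝ) : ℂ) * Complex.exp (-(2 * Real.pi : ℂ) * (x : ℂ) ^ 2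
        + (2 * Real.pi * ((a.1 + l.1) + (a.2 - l.2) * Complex.I) : ℂ) * x
        + (-Real.pi * ((a.1 : ℂ) ^ 2 + (l.1 : ℂ) ^ 2))) := by
    intro x
    have e2 : (2 : ℝ) ^ (1 / 4 : ℝ) * (2 : ℝ) ^ (1 / 4 : ℝ) = √2 := by
      rw [← Real.rpow_add (by norm_num), Real.sqrt_eq_rpow]; norm_num
    rw [← e2]
    unfold gaborFun
    rw [map_mul, Complex.conj_ofReal, mul_mul_mul_comm, ← Complex.exp_conj, ← Complex.exp_add,
      Complex.ofReal_mul]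
    congr 2
    simp only [map_add, map_mul, map_neg, map_pow, map_sub, Complex.conj_ofReal, Complex.conj_I,
      Complex.conj_ofNat]
    ring
  rw [h1]
  simp_rw [h2]
  rw [integral_const_mul, integral_cexp_quadratic (by simp [Real.pi_pos]), norm_mul, norm_mul,
    Complex.norm_real, Complex.norm_exp]
  have e3 : ((Real.pi : ℂ) / -(-(2 * Real.pi : ℂ))) = ((1 / 2 : ℝ) : ℂ) := by
    have hpi : (Real.pi : ℂ) ≠ 0 := by exact_mod_cast Real.pi_ne_zero
    push_cast
    field_simp
  have e4 : ‖((Real.pi : ℂ) / -(-(2 * Real.pi : ℂ))) ^ (1 / 2 : ℂ)‖ = √(1 / 2) := by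
    rw [e3, Complex.norm_cpow_eq_rpow_re_of_pos (by norm_num), Real.sqrt_eq_rpow]
    norm_num
  have e5 : (-Real.pi * ((a.1 : ℂ) ^ 2 + (l.1 : ℂ) ^ 2))
      - (2 * Real.pi * ((a.1 + l.1) + (a.2 - l.2) * Complex.I) : ℂ) ^ 2 / (4 * -(2 * Real.pi : ℂ))
      = ((-(Real.pi / 2) * ((l.1 - a.1) ^ 2 + (l.2 - a.2) ^ 2) : ℝ) : ℂ)
        + ((Real.pi * (a.1 + l.1) * (a.2 - l.2) : ℝ) : ℂ) * Complex.I := by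
    have hpi : (Real.pi : ℂ) ≠ 0 := by exact_mod_cast Real.pi_ne_zero
    push_cast
    field_simp
    ring_nf
    simp only [Complex.I_sq]
    ring
  rw [e4, e5, ← mul_assoc, Real.norm_of_nonneg (Real.sqrt_nonneg _), ← Real.sqrt_mul (by norm_num),
    Complex.add_re, Complex.re_ofReal_mul, Complex.ofReal_re, Complex.I_re]
  norm_num

theorem phaseAbs_le (l : ℝ × ℝ) : phaseAbs l ≤ 2 * ‖l‖ := by
  have h1 : |l.1| ≤ ‖l‖ := norm_fst_le l
  have h2 : |l.2| ≤ ‖l‖ := norm_snd_le l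
  have h0 := norm_nonneg l
  refine Real.sqrt_le_iff.2 ⟨by positivity, ?_⟩
  have h3 : l.1 ^ 2 ≤ ‖l‖ ^ 2 := sq_le_sq.2 (by rwa [abs_of_nonneg h0])
  have h4 : l.2 ^ 2 ≤ ‖l‖ ^ 2 := sq_le_sq.2 (by rwa [abs_of_nonneg h0])
  nlinarith

theorem exists_one_add_pow_mul_gaussian_le (M : ℕ) :
    ∃ K : ℝ, ∀ x, 0 ≤ x → (1 + x) ^ M * Real.exp (-Real.pi * x ^ 2) ≤ K := by
  refine ⟨2 ^ (M - 1) * (1 + M.factorial * Real.exp 1), fun x hx => ?_⟩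
  have h1 := add_pow_le zero_le_one hx M
  have h2 := pow_mul_gaussian_le M x
  rw [abs_of_nonneg hx] at h2
  have h3 : Real.exp (-Real.pi * x ^ 2) ≤ 1 :=
    Real.exp_le_one_iff.2 (by nlinarith [Real.pi_pos, sq_nonneg x])
  have h4 := Real.exp_pos (-Real.pi * x ^ 2)
  calc (1 + x) ^ M * Real.exp (-Real.pi * x ^ 2)
      ≤ (2 ^ (M - 1) * (1 ^ M + x ^ M)) * Real.exp (-Real.pi * x ^ 2) := by gcongr
    _ = 2 ^ (M - 1) * (Real.exp (-Real.pi * x ^ 2) + x ^ M * Real.exp (-Real.pi * x ^ 2)) := by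
        rw [one_pow]; ring
    _ ≤ _ := by gcongr

theorem gaborNorm_gaborVec_lt_top {d : ℝ} (hd : 0 ≤ d) (a : ℝ × ℝ) :
    gaborNorm d (gaborVec a) < ⊤ := by
  obtain ⟨N, hN⟩ := exists_nat_ge d
  -- Of the exponent, 2N pays for the squared weight and 3 for decay integrable over the plane.
  -- Polynomial factors are moved to l - a by 1 + |l| ≤ (1 + |a|)(1 + |l - a|).
  obtain ⟨K, hK⟩ := exists_one_add_pow_mul_gaussian_le (2 * N + 3)
  have key : ∀ l : ℝ × ℝ, (phaseAbs l ^ d + 1) ^ 2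
      * Real.exp (-(Real.pi / 2) * ((l.1 - a.1) ^ 2 + (l.2 - a.2) ^ 2)) ^ 2
      ≤ (2 * 2 ^ N) ^ 2 * (1 + ‖a‖) ^ (2 * N + 3) * K * (1 + ‖l‖) ^ (-(3 : ℝ)) := by
    intro l
    have h0 := phaseAbs_nonneg l
    have h1 : phaseAbs l ^ d + 1 ≤ 2 * 2 ^ N * (1 + ‖l‖) ^ N := by
      have e1 : phaseAbs l ^ d ≤ (1 + phaseAbs l) ^ N := by
        calc phaseAbs l ^ d ≤ (1 + phaseAbs l) ^ d := Real.rpow_le_rpow h0 (by linarith) hd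
          _ ≤ (1 + phaseAbs l) ^ (N : ℝ) := Real.rpow_le_rpow_of_exponent_le (by linarith) hN
          _ = _ := Real.rpow_natCast _ _
      have e2 : (1 : ℝ) ≤ (1 + phaseAbs l) ^ N := one_le_pow₀ (by linarith)
      have e3 : (1 + phaseAbs l) ^ N ≤ (2 * (1 + ‖l‖)) ^ N :=
        pow_le_pow_left₀ (by linarith) (by linarith [phaseAbs_le l]) N
      rw [mul_pow] at e3
      linarith
    have h2 : 1 + ‖l‖ ≤ (1 + ‖a‖) * (1 + ‖l - a‖) := by
      have := norm_le_norm_add_norm_sub' l a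
      nlinarith [norm_nonneg a, norm_nonneg (l - a)]
    have h3 : Real.exp (-(Real.pi / 2) * ((l.1 - a.1) ^ 2 + (l.2 - a.2) ^ 2)) ^ 2
        ≤ Real.exp (-Real.pi * ‖l - a‖ ^ 2) := by
      rw [← Real.exp_nat_mul]
      refine Real.exp_le_exp.2 ?_
      have h4 : ‖l - a‖ ^ 2 ≤ (l.1 - a.1) ^ 2 + (l.2 - a.2) ^ 2 := by
        have := pow_le_pow_left₀ (norm_nonneg _) (norm_le_phaseAbs (l - a)) 2
        rwa [phaseAbs, Real.sq_sqrt (by positivity)] at this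
      push_cast
      nlinarith [Real.pi_pos]
    have h5 : (0 : ℝ) < 1 + ‖l‖ := by positivity
    have e6 : (1 + ‖l‖) ^ (-(3 : ℝ)) = ((1 + ‖l‖) ^ 3)⁻¹ := by
      rw [Real.rpow_neg h5.le]; norm_cast
    have hw : 0 ≤ phaseAbs l ^ d + 1 := by positivity
    rw [e6, ← div_eq_mul_inv, le_div_iff₀ (by positivity)]
    calc (phaseAbs l ^ d + 1) ^ 2
          * Real.exp (-(Real.pi / 2) * ((l.1 - a.1) ^ 2 + (l.2 - a.2) ^ 2)) ^ 2 * (1 + ‖l‖) ^ 3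
        ≤ (2 * 2 ^ N * (1 + ‖l‖) ^ N) ^ 2 * Real.exp (-Real.pi * ‖l - a‖ ^ 2)
          * (1 + ‖l‖) ^ 3 := by gcongr
      _ = (2 * 2 ^ N) ^ 2 * ((1 + ‖l‖) ^ (2 * N + 3) * Real.exp (-Real.pi * ‖l - a‖ ^ 2)) := by
          ring
      _ ≤ (2 * 2 ^ N) ^ 2 * (((1 + ‖a‖) * (1 + ‖l - a‖)) ^ (2 * N + 3)
          * Real.exp (-Real.pi * ‖l - a‖ ^ 2)) := by gcongr
      _ = (2 * 2 ^ N) ^ 2 * (1 + ‖a‖) ^ (2 * N + 3) * ((1 + ‖l - a‖) ^ (2 * N + 3)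
          * Real.exp (-Real.pi * ‖l - a‖ ^ 2)) := by rw [mul_pow (1 + ‖a‖), mul_assoc, mul_assoc]
      _ ≤ _ := by gcongr; exact hK _ (norm_nonneg _)
  have hK0 : 0 ≤ K := le_trans (by positivity) (hK 0 le_rfl)
  have hfin : gaborNorm d (gaborVec a) ^ 2 < ⊤ := by
    rw [gaborNorm_sq]
    calc ∫⁻ l : ℝ × ℝ, ENNReal.ofReal ((phaseAbs l ^ d + 1) ^ 2)
          * ‖gaborTransform (gaborVec a) l‖ₑ ^ 2
        ≤ ∫⁻ l : ℝ × ℝ, ENNReal.ofReal ((2 * 2 ^ N) ^ 2 * (1 + ‖a‖) ^ (2 * N + 3) * K)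
          * ENNReal.ofReal ((1 + ‖l‖) ^ (-(3 : ℝ))) := by
          refine lintegral_mono fun l => ?_
          rw [← ofReal_norm (gaborTransform (gaborVec a) l), norm_gaborTransform_gaborVec,
            ← ENNReal.ofReal_pow (by positivity), ← ENNReal.ofReal_mul (by positivity),
            ← ENNReal.ofReal_mul (by positivity)]
          exact ENNReal.ofReal_le_ofReal (key l)
      _ < ⊤ := by
          rw [lintegral_const_mul' _ _ ENNReal.ofReal_ne_top]
          exact ENNReal.mul_lt_top ENNReal.ofReal_lt_top
            (lintegral_one_add_norm_rpow_lt_top (by norm_num))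
  exact (ENNReal.pow_lt_top_iff.1 hfin).resolve_right two_ne_zero

theorem integrable_gaborTransform_gaborVec (a : ℝ × ℝ) :
    Integrable (gaborTransform (gaborVec a)) :=
  integrable_gaborTransform one_lt_two (gaborNorm_gaborVec_lt_top zero_le_two a)

theorem gaborRep_gaborVec (a : ℝ × ℝ) : gaborRep (gaborVec a) = gaborFun a :=
  ((continuous_gaborRep (integrable_gaborTransform_gaborVec a)).ae_eq_iff_eq volume
    (continuous_gaborFun a)).1 ((ae_eq_gaborRep (integrable_gaborTransform_gaborVec a)).symm.trans
      (memLp_gaborFun a).coeFn_toLp)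

/-! ### The alternating sum over half-integers and the dual coefficients -/

theorem exists_lintegral_enorm_gaborFun_le :
    ∃ A : ℝ≥0, ∀ l : ℝ × ℝ, ∫⁻ x, ‖gaborFun l x‖ₑ ≤ A := by
  obtain ⟨A, hA⟩ := exists_tsum_enorm_gaborFun_le
  refine ⟨A, fun l => ?_⟩
  rw [lintegral_eq_lintegral_Ico_tsum (continuous_gaborFun l).measurable.enorm]
  calc ∫⁻ x in Set.Ico (0 : ℝ) 1, ∑' k : ℤ, ‖gaborFun l (x + k)‖ₑ
      ≤ ∫⁻ _ in Set.Ico (0 : ℝ) 1, (A : ℝ≥0∞) := lintegral_mono fun x => hA l x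
    _ = A := by simp

/-- The alternating sum `∑ (-1)^q f(q + 1/2)`. -/
def sharpSum (f : L2R) : ℂ := ∑' q : ℤ, (-1 : ℂ) ^ q * gaborRep f ((q : ℝ) + 1 / 2)

theorem enorm_neg_one_zpow (q : ℤ) : ‖(-1 : ℂ) ^ q‖ₑ = 1 := by
  rw [← ofReal_norm, norm_zpow, norm_neg, norm_one, one_zpow, ENNReal.ofReal_one]

theorem neg_one_zpow_mul_self (q : ℤ) : (-1 : ℂ) ^ q * (-1 : ℂ) ^ q = 1 := by
  rw [← mul_zpow]; norm_num

theorem exists_enorm_sharpSum_le :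
    ∃ A : ℝ≥0, ∀ f : L2R, ‖sharpSum f‖ₑ ≤ A * ∫⁻ l, ‖gaborTransform f l‖ₑ := by
  obtain ⟨A, hA⟩ := exists_tsum_enorm_gaborRep_le
  refine ⟨A, fun f => ?_⟩
  refine enorm_tsum_le_tsum_enorm.trans (le_trans (le_of_eq (tsum_congr fun q => ?_)) (hA f (1 / 2)))
  rw [enorm_mul, enorm_neg_one_zpow, one_mul, add_comm]

theorem summable_sharpSum {f : L2R} (hf : Integrable (gaborTransform f)) :
    Summable fun q : ℤ => ‖gaborRep f ((q : ℝ) + 1 / 2)‖ := by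
  simpa only [add_comm] using summable_gaborRep hf (1 / 2)

theorem expChar_neg_half_integer (t q : ℤ) : expChar (-(t : ℝ)) ((q : ℝ) + 1 / 2) = (-1) ^ t := by
  have h1 := expChar_add_intCast (-t) (1 / 2) q
  push_cast at h1
  rw [add_comm, h1, expChar]
  have h2 : 2 * (Real.pi : ℂ) * Complex.I * ((-(t : ℝ) : ℝ) : ℂ) * ((1 / 2 : ℝ) : ℂ)
      = ((-t : ℤ) : ℂ) * (Real.pi * Complex.I) := by push_cast; ring
  rw [h2, Complex.exp_int_mul, Complex.exp_pi_mul_I, zpow_neg, ← inv_zpow]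
  norm_num

theorem dualCoeff_eq_integral_gaborRep {f : L2R} (hf : Integrable (gaborTransform f)) (n : ℤ × ℤ) :
    dualCoeff n f = ∫ x : ℝ, gaborRep f x * ((dualWindow (x - n.1) : ℂ) * expChar (-n.2) x) := by
  refine integral_congr_ae ?_
  filter_upwards [ae_eq_gaborRep hf] with x hx
  rw [hx]

/-- `integral_mul_dualWindow` is applied to f translated by p and demodulated by θ, which changes a
into a - λ. The signs come from translating the half-integers by p and from the value of the
character at them. -/
theorem dualCoeff_sub_phaseToComplex_mul {f h : L2R} (hf : Integrable (gaborTransform f))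
    (hh : Integrable (gaborTransform h)) (hfh : toDist h = annihilation (toDist f)) (n : ℤ × ℤ) :
    2 * (Real.pi : ℂ) * (dualCoeff n h - phaseToComplex (latticePoint n) * dualCoeff n f)
      = (-1) ^ n.1 * (-1) ^ n.2 * sharpSum f := by
  obtain ⟨p, t⟩ := n
  simp only
  set z : ℂ := phaseToComplex (latticePoint (p, t)) with hz
  have hz' : z = (p : ℂ) + t * Complex.I := by simp [hz, phaseToComplex, latticePoint]
  have hfc := continuous_gaborRep hf
  have hhc := continuous_gaborRep hh
  have hec := continuous_expChar (-(t : ℝ))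
  have hF : ∀ x : ℝ, HasDerivAt (fun x : ℝ => gaborRep f (x + p) * expChar (-(t : ℝ)) x)
      (2 * (Real.pi : ℂ) * ((gaborRep h (x + p) - z * gaborRep f (x + p)) * expChar (-(t : ℝ)) x
        - x * (gaborRep f (x + p) * expChar (-(t : ℝ)) x))) x := fun x => by
    refine (((hasDerivAt_gaborRep hf hh hfh (x + p)).comp_add_const x (p : ℝ)).mul
      (hasDerivAt_expChar (-(t : ℝ)) x)).congr_deriv ?_
    rw [hz']
    push_cast
    ring
  have i1 : Integrable fun x => gaborRep h x * ((dualWindow (x - p) : ℂ) * expChar (-t) x) :=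
    integrable_mul_dualAtom (integrable_gaborRep hh) p (-t)
  have i2 : Integrable fun x => gaborRep f x * ((dualWindow (x - p) : ℂ) * expChar (-t) x) :=
    integrable_mul_dualAtom (integrable_gaborRep hf) p (-t)
  have hKc : Continuous fun x : ℝ =>
      (gaborRep h (x + p) - z * gaborRep f (x + p)) * expChar (-(t : ℝ)) x := by
    have e1 : Continuous fun x : ℝ => gaborRep h (x + p) := hhc.comp (continuous_add_const _)
    have e2 : Continuous fun x : ℝ => gaborRep f (x + p) := hfc.comp (continuous_add_const _)
    exact (e1.sub (continuous_const.mul e2)).mul hec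
  have hK : Integrable fun x : ℝ =>
      (gaborRep h (x + p) - z * gaborRep f (x + p)) * expChar (-(t : ℝ)) x := by
    have e1 : Integrable fun x : ℝ => gaborRep h (x + p) - z * gaborRep f (x + p) :=
      ((integrable_gaborRep hh).comp_add_right (p : ℝ)).sub
        (((integrable_gaborRep hf).comp_add_right (p : ℝ)).const_mul z)
    exact e1.mul_bdd (c := 1) hec.aestronglyMeasurable (ae_of_all _ fun x => (norm_expChar _ x).le)
  have hs : Summable fun q : ℤ =>
      ‖(fun x : ℝ => gaborRep f (x + p) * expChar (-(t : ℝ)) x) ((q : ℝ) + 1 / 2)‖ := by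
    simp only [norm_mul, norm_expChar, mul_one]
    have := (Equiv.addRight p).summable_iff.2 (summable_sharpSum hf)
    refine this.congr fun q => ?_
    simp only [Function.comp_apply, Equiv.coe_addRight]
    push_cast
    congr 2
    ring
  have key := integral_mul_dualWindow hF hKc hK hs
  have hL : ∫ x : ℝ, (gaborRep h (x + p) - z * gaborRep f (x + p)) * expChar (-(t : ℝ)) x
      * dualWindow x = dualCoeff (p, t) h - z * dualCoeff (p, t) f := by
    rw [dualCoeff_eq_integral_gaborRep hf, dualCoeff_eq_integral_gaborRep hh, ← integral_const_mul,
      ← integral_sub i1 (i2.const_mul z), ← integral_add_right_eq_self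
        (fun x => gaborRep h x * ((dualWindow (x - p) : ℂ) * expChar (-t) x)
          - z * (gaborRep f x * ((dualWindow (x - p) : ℂ) * expChar (-t) x))) (p : ℝ)]
    refine integral_congr_ae (ae_of_all _ fun x => ?_)
    have := expChar_add_intCast (-t) x p
    push_cast at this
    simp only [add_sub_cancel_right, this]
    ring
  rw [← hL, key, sharpSum, ← tsum_mul_left, ← (Equiv.addRight p).tsum_eq (fun q : ℤ =>
    (-1 : ℂ) ^ p * (-1) ^ t * ((-1) ^ q * gaborRep f ((q : ℝ) + 1 / 2)))]
  refine tsum_congr fun q => ?_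
  have e : ((q : ℝ) + 1 / 2 + p) = (q : ℝ) + p + 1 / 2 := by ring
  simp only [Equiv.coe_addRight, expChar_neg_half_integer, zpow_add₀ (by norm_num : (-1 : ℂ) ≠ 0)]
  push_cast
  rw [e]
  linear_combination (-(-1 : ℂ) ^ q * (-1) ^ t * gaborRep f ((q : ℝ) + p + 1 / 2))
    * neg_one_zpow_mul_self p

theorem dualCoeff_gaborVec (n : ℤ × ℤ) (l : ℝ × ℝ) : dualCoeff n (gaborVec l)
    = ∫ x : ℝ, gaborFun l x * ((dualWindow (x - n.1) : ℂ) * expChar (-n.2) x) := by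
  rw [dualCoeff_eq_integral_gaborRep (integrable_gaborTransform_gaborVec l), gaborRep_gaborVec]

theorem exists_lintegral_enorm_gaborFun_mul_dualAtom_le :
    ∃ A : ℝ≥0, ∀ (n : ℤ × ℤ) (l : ℝ × ℝ),
      ∫⁻ x : ℝ, ‖gaborFun l x * ((dualWindow (x - n.1) : ℂ) * expChar (-n.2) x)‖ₑ ≤ A := by
  obtain ⟨A, hA⟩ := exists_lintegral_enorm_gaborFun_le
  obtain ⟨C, hC0, hC⟩ := exists_abs_dualWindow_le
  refine ⟨A * C.toNNReal, fun n l => ?_⟩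
  calc ∫⁻ x : ℝ, ‖gaborFun l x * ((dualWindow (x - n.1) : ℂ) * expChar (-n.2) x)‖ₑ
      ≤ ∫⁻ x : ℝ, ‖gaborFun l x‖ₑ * ENNReal.ofReal C := by
        refine lintegral_mono fun x => ?_
        rw [enorm_mul]
        refine mul_le_mul' le_rfl ?_
        rw [← ofReal_norm]
        exact ENNReal.ofReal_le_ofReal (norm_dualAtom_le hC _ _ x)
    _ = (∫⁻ x : ℝ, ‖gaborFun l x‖ₑ) * ENNReal.ofReal C := lintegral_mul_const' _ _ ENNReal.ofReal_ne_top
    _ ≤ A * ENNReal.ofReal C := mul_le_mul' (hA l) le_rfl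
    _ = _ := by rw [ENNReal.coe_mul]; rfl

theorem exists_norm_dualCoeff_gaborVec_le :
    ∃ A : ℝ≥0, ∀ (n : ℤ × ℤ) (l : ℝ × ℝ), ‖dualCoeff n (gaborVec l)‖ ≤ A := by
  obtain ⟨A, hA⟩ := exists_lintegral_enorm_gaborFun_mul_dualAtom_le
  refine ⟨A, fun n l => ?_⟩
  have h := (enorm_integral_le_lintegral_enorm _).trans (hA n l)
  rw [← dualCoeff_gaborVec, enorm_le_coe] at h
  exact_mod_cast h

/-- The functional passes under the Gabor inversion integral by Fubini, so estimates reduce to its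
values on the Gabor functions. -/
theorem dualCoeff_eq_integral {f : L2R} (hf : Integrable (gaborTransform f)) (n : ℤ × ℤ) :
    dualCoeff n f = ∫ l, gaborTransform f l * dualCoeff n (gaborVec l) := by
  obtain ⟨A, hA⟩ := exists_lintegral_enorm_gaborFun_mul_dualAtom_le
  have hm : Measurable fun z : (ℝ × ℝ) × ℝ => gaborFun z.1 z.2
      * ((dualWindow (z.2 - n.1) : ℂ) * expChar (-n.2) z.2) :=
    continuous_gaborFun_uncurry.measurable.mul
      ((measurable_dualAtom n.1 (-n.2)).comp measurable_snd)
  have hφ : Measurable fun z : (ℝ × ℝ) × ℝ => gaborTransform f z.1 :=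
    (stronglyMeasurable_gaborTransform f).measurable.comp measurable_fst
  have hint : Integrable (fun z : (ℝ × ℝ) × ℝ => gaborTransform f z.1 * (gaborFun z.1 z.2
      * ((dualWindow (z.2 - n.1) : ℂ) * expChar (-n.2) z.2))) (volume.prod volume) := by
    refine ⟨(hφ.mul hm).aestronglyMeasurable, ?_⟩
    have hm' : Measurable fun z : (ℝ × ℝ) × ℝ => ‖gaborTransform f z.1 * (gaborFun z.1 z.2
        * ((dualWindow (z.2 - n.1) : ℂ) * expChar (-n.2) z.2))‖ₑ := (hφ.mul hm).enorm
    rw [HasFiniteIntegral, lintegral_prod _ hm'.aemeasurable]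
    calc ∫⁻ l : ℝ × ℝ, ∫⁻ x : ℝ, ‖gaborTransform f l * (gaborFun l x
          * ((dualWindow (x - n.1) : ℂ) * expChar (-n.2) x))‖ₑ
        ≤ ∫⁻ l : ℝ × ℝ, ‖gaborTransform f l‖ₑ * A := by
          refine lintegral_mono fun l => ?_
          simp only [enorm_mul (gaborTransform f l)]
          rw [lintegral_const_mul' _ _ enorm_ne_top]
          exact mul_le_mul' le_rfl (hA n l)
      _ < ⊤ := by
          rw [lintegral_mul_const' _ _ ENNReal.coe_ne_top]
          exact ENNReal.mul_lt_top hf.2 ENNReal.coe_lt_top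
  rw [dualCoeff_eq_integral_gaborRep hf]
  calc ∫ x : ℝ, gaborRep f x * ((dualWindow (x - n.1) : ℂ) * expChar (-n.2) x)
      = ∫ x : ℝ, ∫ l : ℝ × ℝ, gaborTransform f l * (gaborFun l x
          * ((dualWindow (x - n.1) : ℂ) * expChar (-n.2) x)) := by
        refine integral_congr_ae (ae_of_all _ fun x => ?_)
        simp only [gaborRep]
        rw [← integral_mul_const]
        simp only [mul_assoc]
    _ = ∫ l : ℝ × ℝ, ∫ x : ℝ, gaborTransform f l * (gaborFun l x
          * ((dualWindow (x - n.1) : ℂ) * expChar (-n.2) x)) := (integral_integral_swap hint).symm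
    _ = _ := by
        refine integral_congr_ae (ae_of_all _ fun l => ?_)
        simp only [integral_const_mul, dualCoeff_gaborVec]

theorem sharpSum_gaborVec (l : ℝ × ℝ) :
    sharpSum (gaborVec l) = ∑' q : ℤ, (-1 : ℂ) ^ q * gaborFun l ((q : ℝ) + 1 / 2) := by
  rw [sharpSum, gaborRep_gaborVec]

theorem exists_norm_sharpSum_gaborVec_le : ∃ A : ℝ≥0, ∀ l, ‖sharpSum (gaborVec l)‖ ≤ A := by
  obtain ⟨A, hA⟩ := exists_tsum_enorm_gaborFun_le
  refine ⟨A, fun l => ?_⟩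
  have h : ‖sharpSum (gaborVec l)‖ₑ ≤ A := by
    rw [sharpSum_gaborVec]
    refine enorm_tsum_le_tsum_enorm.trans
      (le_trans (le_of_eq (tsum_congr fun q => ?_)) (hA l (1 / 2)))
    rw [enorm_mul, enorm_neg_one_zpow, one_mul, add_comm]
  rw [enorm_le_coe] at h
  exact_mod_cast h

theorem sharpSum_eq_integral {f : L2R} (hf : Integrable (gaborTransform f)) :
    sharpSum f = ∫ l, gaborTransform f l * sharpSum (gaborVec l) := by
  obtain ⟨A, hA⟩ := exists_tsum_enorm_gaborFun_le
  have hm : ∀ q : ℤ, AEStronglyMeasurable (fun l : ℝ × ℝ =>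
      (-1 : ℂ) ^ q * (gaborTransform f l * gaborFun l ((q : ℝ) + 1 / 2))) volume := fun q =>
    (hf.aestronglyMeasurable.mul (continuous_gaborFun_left _).aestronglyMeasurable).const_mul _
  have hfin : ∑' q : ℤ, ∫⁻ l : ℝ × ℝ,
      ‖(-1 : ℂ) ^ q * (gaborTransform f l * gaborFun l ((q : ℝ) + 1 / 2))‖ₑ ≠ ⊤ := by
    rw [← lintegral_tsum fun q => (hm q).enorm]
    refine ne_of_lt ?_
    calc ∫⁻ l : ℝ × ℝ, ∑' q : ℤ,
          ‖(-1 : ℂ) ^ q * (gaborTransform f l * gaborFun l ((q : ℝ) + 1 / 2))‖ₑ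
        ≤ ∫⁻ l : ℝ × ℝ, ‖gaborTransform f l‖ₑ * A := by
          refine lintegral_mono fun l => ?_
          simp only [enorm_mul, enorm_neg_one_zpow, one_mul]
          rw [ENNReal.tsum_mul_left]
          refine mul_le_mul' le_rfl (le_trans (le_of_eq (tsum_congr fun q => ?_)) (hA l (1 / 2)))
          rw [add_comm]
      _ < ⊤ := by
          rw [lintegral_mul_const' _ _ ENNReal.coe_ne_top]
          exact ENNReal.mul_lt_top hf.2 ENNReal.coe_lt_top
  calc sharpSum f = ∑' q : ℤ, ∫ l : ℝ × ℝ,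
        (-1 : ℂ) ^ q * (gaborTransform f l * gaborFun l ((q : ℝ) + 1 / 2)) := by
        simp only [sharpSum, gaborRep, integral_const_mul]
    _ = ∫ l : ℝ × ℝ, ∑' q : ℤ,
        (-1 : ℂ) ^ q * (gaborTransform f l * gaborFun l ((q : ℝ) + 1 / 2)) :=
        (integral_tsum hm hfin).symm
    _ = _ := by
        refine integral_congr_ae (ae_of_all _ fun l => ?_)
        simp only [sharpSum_gaborVec, ← tsum_mul_left]
        refine tsum_congr fun q => ?_
        ring

theorem dualCoeff_smul (n : ℤ × ℤ) (c : ℂ) (f : L2R) :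
    dualCoeff n (c • f) = c * dualCoeff n f := by
  rw [dualCoeff, dualCoeff, ← integral_const_mul]
  refine integral_congr_ae ?_
  filter_upwards [Lp.coeFn_smul c f] with x hx
  rw [hx, Pi.smul_apply, smul_eq_mul, mul_assoc]

/-- The integration by parts identity on an eigenfunction: up to signs the kernel D_λ(e_l) is one
bounded function of l divided by l - λ. -/
theorem sub_mul_dualCoeff_gaborVec (n : ℤ × ℤ) (l : ℝ × ℝ) :
    2 * (Real.pi : ℂ) * ((phaseToComplex l - phaseToComplex (latticePoint n))
        * dualCoeff n (gaborVec l))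
      = (-1) ^ n.1 * (-1) ^ n.2 * sharpSum (gaborVec l) := by
  have hl := integrable_gaborTransform_gaborVec l
  have h1 : Integrable (gaborTransform (phaseToComplex l • gaborVec l)) := by
    rw [gaborTransform_smul]
    exact hl.smul _
  rw [← dualCoeff_sub_phaseToComplex_mul hl h1 (annihilation_gaborVec l).symm n]
  rw [dualCoeff_smul]
  ring

/-! ### The `ℓ²` bound for the dual coefficients -/

theorem exists_tsum_one_add_abs_sub_rpow_le {r : ℝ} (hr : 1 < r) :
    ∃ T : ℝ≥0, ∀ x : ℝ, ∑' k : ℤ, ENNReal.ofReal ((1 + |x - k|) ^ (-r)) ≤ T := by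
  have hs : Summable fun k : ℤ => (2 : ℝ) ^ r * (1 + |(k : ℝ)|) ^ (-r) := by
    refine Summable.mul_left _ ?_
    refine (Real.summable_abs_int_rpow hr).of_norm_bounded_eventually ?_
    filter_upwards [(Set.finite_singleton (0 : ℤ)).compl_mem_cofinite] with k hk
    have hk' : 0 < |(k : ℝ)| := abs_pos.2 (by exact_mod_cast hk)
    rw [Real.norm_of_nonneg (by positivity)]
    exact Real.rpow_le_rpow_of_nonpos hk' (by linarith) (by linarith)
  refine ⟨(∑' k : ℤ, (2 : ℝ) ^ r * (1 + |(k : ℝ)|) ^ (-r)).toNNReal, fun x => ?_⟩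
  rw [← (Equiv.addRight ⌊x⌋).tsum_eq]
  calc ∑' k : ℤ, ENNReal.ofReal ((1 + |x - ((Equiv.addRight ⌊x⌋ k : ℤ) : ℝ)|) ^ (-r))
      ≤ ∑' k : ℤ, ENNReal.ofReal ((2 : ℝ) ^ r * (1 + |(k : ℝ)|) ^ (-r)) := by
        refine ENNReal.tsum_le_tsum fun k => ENNReal.ofReal_le_ofReal ?_
        have h1 : (1 + |(k : ℝ)|) / 2 ≤ 1 + |x - ((Equiv.addRight ⌊x⌋ k : ℤ) : ℝ)| := by
          rw [Equiv.coe_addRight]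
          push_cast
          have e1 := Int.floor_le x
          have e2 := Int.lt_floor_add_one x
          have e3 := abs_sub_abs_le_abs_sub (k : ℝ) (x - ⌊x⌋)
          have e4 : |(k : ℝ) - (x - ⌊x⌋)| = |x - (k + ⌊x⌋)| := by
            rw [abs_sub_comm]; congr 1; ring
          have e5 : |x - ⌊x⌋| ≤ 1 := abs_le.2 ⟨by linarith, by linarith⟩
          have e6 := abs_nonneg (x - ((k : ℝ) + ⌊x⌋))
          linarith
        calc _ ≤ ((1 + |(k : ℝ)|) / 2) ^ (-r) :=
              Real.rpow_le_rpow_of_nonpos (by positivity) h1 (by linarith)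
          _ = _ := by
              rw [div_eq_mul_inv, Real.mul_rpow (by positivity) (by norm_num), Real.inv_rpow
                (by norm_num), ← Real.rpow_neg (by norm_num), neg_neg, mul_comm]
    _ = _ := (ENNReal.ofReal_tsum_of_nonneg (fun k => by positivity) hs).symm

/-- The maximum norm dominates each coordinate, so the exponent is split into halves s/2 > 1 and the
sum factors. -/
theorem exists_tsum_one_add_norm_sub_rpow_le {s : ℝ} (hs : 2 < s) :
    ∃ T : ℝ≥0, ∀ l : ℝ × ℝ,
      ∑' n : ℤ × ℤ, ENNReal.ofReal ((1 + ‖l - latticePoint n‖) ^ (-s)) ≤ T := by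
  obtain ⟨T, hT⟩ := exists_tsum_one_add_abs_sub_rpow_le (r := s / 2) (by linarith)
  refine ⟨T * T, fun l => ?_⟩
  calc ∑' n : ℤ × ℤ, ENNReal.ofReal ((1 + ‖l - latticePoint n‖) ^ (-s))
      ≤ ∑' n : ℤ × ℤ, ENNReal.ofReal ((1 + |l.1 - n.1|) ^ (-(s / 2)))
        * ENNReal.ofReal ((1 + |l.2 - n.2|) ^ (-(s / 2))) := by
        refine ENNReal.tsum_le_tsum fun n => ?_
        rw [← ENNReal.ofReal_mul (by positivity)]
        refine ENNReal.ofReal_le_ofReal ?_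
        have h1 : |l.1 - n.1| ≤ ‖l - latticePoint n‖ := norm_fst_le (l - latticePoint n)
        have h2 : |l.2 - n.2| ≤ ‖l - latticePoint n‖ := norm_snd_le (l - latticePoint n)
        have h3 : (1 + ‖l - latticePoint n‖) ^ (-s)
            = (1 + ‖l - latticePoint n‖) ^ (-(s / 2)) * (1 + ‖l - latticePoint n‖) ^ (-(s / 2)) := by
          rw [← Real.rpow_add (by positivity)]
          congr 1
          ring
        rw [h3]
        have e : -(s / 2) ≤ 0 := by linarith
        exact mul_le_mul (Real.rpow_le_rpow_of_nonpos (by positivity) (by linarith) e)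
          (Real.rpow_le_rpow_of_nonpos (by positivity) (by linarith) e)
          (by positivity) (by positivity)
    _ = (∑' p : ℤ, ENNReal.ofReal ((1 + |l.1 - p|) ^ (-(s / 2))))
        * ∑' t : ℤ, ENNReal.ofReal ((1 + |l.2 - t|) ^ (-(s / 2))) := by
        rw [ENNReal.tsum_prod', ← ENNReal.tsum_mul_right]
        simp only [ENNReal.tsum_mul_left]
    _ ≤ T * T := mul_le_mul' (hT _) (hT _)
    _ = _ := (ENNReal.coe_mul _ _).symm

/-! ### Kernel estimates and the gain from a vanishing sharp sum. -/

theorem norm_phaseToComplex (l : ℝ × ℝ) : ‖phaseToComplex l‖ = phaseAbs l := by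
  rw [phaseToComplex, Complex.norm_add_mul_I, phaseAbs]

theorem phaseToComplex_sub (l l' : ℝ × ℝ) :
    phaseToComplex l - phaseToComplex l' = phaseToComplex (l - l') := by
  simp only [phaseToComplex, Prod.fst_sub, Prod.snd_sub]
  push_cast
  ring

/-- If A ≤ B then D ≤ 2B, so B absorbs all but D^e, and the leftover B^(-e) is given to A. The
resulting exponent 2 + e is summable over a planar lattice. -/
theorem sq_div_le_rpow {A B D e : ℝ} (hA : 1 ≤ A) (hB : 1 ≤ B) (hD : 1 ≤ D) (hDAB : D ≤ A + B)
    (he : 0 ≤ e) (he2 : e ≤ 2) :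
    (D / (A * B)) ^ 2 ≤ 4 * D ^ e * (A ^ (-(2 + e)) + B ^ (-(2 + e))) := by
  wlog h : A ≤ B generalizing A B
  · have := this hB hA (by linarith) (by linarith)
    rwa [mul_comm B A, add_comm (B ^ _)] at this
  have hA0 : 0 < A := by linarith
  have hB0 : 0 < B := by linarith
  have hD0 : 0 < D := by linarith
  have h1 : D ^ (2 - e) ≤ 4 * B ^ (2 - e) := by
    calc D ^ (2 - e) ≤ (2 * B) ^ (2 - e) :=
          Real.rpow_le_rpow hD0.le (by linarith) (by linarith)
      _ = 2 ^ (2 - e) * B ^ (2 - e) := Real.mul_rpow (by norm_num) hB0.le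
      _ ≤ 2 ^ (2 : ℝ) * B ^ (2 - e) := by
          gcongr
          · norm_num
          · linarith
      _ = _ := by norm_num
  have h2 : D ^ 2 = D ^ e * D ^ (2 - e) := by
    rw [← Real.rpow_add hD0, ← Real.rpow_natCast]; congr 1; push_cast; ring
  have h3 : B ^ (2 - e) = B ^ 2 * B ^ (-e) := by
    rw [← Real.rpow_natCast, ← Real.rpow_add hB0]; congr 1
  have h4 : A ^ (-(2 + e)) = (A ^ 2)⁻¹ * A ^ (-e) := by
    rw [neg_add, Real.rpow_add hA0, Real.rpow_neg hA0.le]; norm_cast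
  have h5 : B ^ (-e) ≤ A ^ (-e) := Real.rpow_le_rpow_of_nonpos hA0 h (by linarith)
  have h6 : 0 < B ^ (-(2 + e)) := by positivity
  calc (D / (A * B)) ^ 2 = D ^ e * D ^ (2 - e) * ((A ^ 2)⁻¹ * (B ^ 2)⁻¹) := by
        rw [← h2]; field_simp
    _ ≤ D ^ e * (4 * (B ^ 2 * A ^ (-e))) * ((A ^ 2)⁻¹ * (B ^ 2)⁻¹) := by
        gcongr
        refine h1.trans ?_
        rw [h3]
        gcongr
    _ = 4 * D ^ e * A ^ (-(2 + e)) := by rw [h4]; field_simp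
    _ ≤ _ := by
        gcongr
        linarith

/-- The sharp point `(1/2, 1/2)`. -/
def sharpPoint : ℝ × ℝ := (1 / 2, 1 / 2)

theorem half_le_norm_sharpPoint_sub (n : ℤ × ℤ) : 1 / 2 ≤ ‖sharpPoint - latticePoint n‖ := by
  refine le_trans ?_ (norm_fst_le (sharpPoint - latticePoint n))
  simp only [sharpPoint, latticePoint, Prod.fst_sub, Real.norm_eq_abs]
  rcases le_or_gt n.1 0 with h | h
  · have : (n.1 : ℝ) ≤ 0 := by exact_mod_cast h
    exact le_trans (by linarith) (le_abs_self _)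
  · have : (1 : ℝ) ≤ n.1 := by exact_mod_cast h
    exact le_trans (by linarith) (neg_le_abs _)

/-- The uniform bound serves for l near the lattice point, the product identity elsewhere. This
decay is borderline: its square is not summable over the lattice. -/
theorem exists_norm_dualCoeff_gaborVec_le_div :
    ∃ M : ℝ, 0 ≤ M ∧ ∀ (n : ℤ × ℤ) (l : ℝ × ℝ),
      ‖dualCoeff n (gaborVec l)‖ ≤ M / (1 + ‖l - latticePoint n‖) := by
  obtain ⟨A, hA⟩ := exists_norm_dualCoeff_gaborVec_le
  obtain ⟨B, hB⟩ := exists_norm_sharpSum_gaborVec_le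
  refine ⟨A + B, by positivity, fun n l => ?_⟩
  rw [le_div_iff₀ (by positivity), mul_add, mul_one]
  have h := congrArg norm (sub_mul_dualCoeff_gaborVec n l)
  rw [norm_mul, norm_mul, norm_mul, norm_mul, norm_mul, norm_zpow, norm_zpow, norm_neg, norm_one,
    one_zpow, one_zpow, phaseToComplex_sub, norm_phaseToComplex, Complex.norm_real,
    Real.norm_of_nonneg Real.pi_pos.le, one_mul, one_mul, Complex.norm_ofNat] at h
  have h1 := norm_le_phaseAbs (l - latticePoint n)
  have h2 : phaseAbs (l - latticePoint n) * ‖dualCoeff n (gaborVec l)‖ ≤ B := by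
    have h3 : 0 ≤ phaseAbs (l - latticePoint n) * ‖dualCoeff n (gaborVec l)‖ :=
      mul_nonneg (phaseAbs_nonneg _) (norm_nonneg _)
    nlinarith [Real.pi_gt_three, hB l]
  nlinarith [hA n l, norm_nonneg (dualCoeff n (gaborVec l))]

theorem stronglyMeasurable_dualCoeff_gaborVec (n : ℤ × ℤ) :
    StronglyMeasurable fun l => dualCoeff n (gaborVec l) := by
  have hm : Measurable fun z : (ℝ × ℝ) × ℝ => gaborFun z.1 z.2
      * ((dualWindow (z.2 - n.1) : ℂ) * expChar (-n.2) z.2) :=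
    continuous_gaborFun_uncurry.measurable.mul
      ((measurable_dualAtom n.1 (-n.2)).comp measurable_snd)
  simp only [dualCoeff_gaborVec]
  exact hm.stronglyMeasurable.integral_prod_right

theorem continuous_phaseToComplex : Continuous phaseToComplex := by
  unfold phaseToComplex
  fun_prop

/-- Measurability is read off from the product identity at the lattice point 0. -/
theorem stronglyMeasurable_sharpSum_gaborVec :
    StronglyMeasurable fun l => sharpSum (gaborVec l) := by
  have h : (fun l => sharpSum (gaborVec l)) = fun l => 2 * (Real.pi : ℂ)
      * ((phaseToComplex l - phaseToComplex (latticePoint 0)) * dualCoeff 0 (gaborVec l)) := by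
    funext l
    rw [sub_mul_dualCoeff_gaborVec]
    simp
  rw [h]
  have h1 : Continuous fun l => phaseToComplex l - phaseToComplex (latticePoint 0) :=
    continuous_phaseToComplex.sub continuous_const
  exact (h1.stronglyMeasurable.mul (stronglyMeasurable_dualCoeff_gaborVec 0)).const_mul _

/-- Since (♯ - l)/(♯ - λ) = 1 - (l - λ)/(♯ - λ), the extra factor changes the kernel by a multiple
of `sharpSum (gaborVec l)`, which integrates to `sharpSum f` = 0. The point ♯ lies off the lattice,
so the denominator never vanishes. -/
theorem dualCoeff_eq_integral_of_sharpSum_eq_zero {f : L2R} (hf : Integrable (gaborTransform f))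
    (h0 : sharpSum f = 0) (n : ℤ × ℤ) :
    dualCoeff n f = ∫ l, gaborTransform f l * (dualCoeff n (gaborVec l)
      * phaseToComplex (sharpPoint - l) / phaseToComplex (sharpPoint - latticePoint n)) := by
  obtain ⟨A, hA⟩ := exists_norm_dualCoeff_gaborVec_le
  set z := phaseToComplex (sharpPoint - latticePoint n) with hz
  have hz0 : z ≠ 0 := by
    rw [← norm_pos_iff, hz, norm_phaseToComplex]
    exact lt_of_lt_of_le (by norm_num)
      ((half_le_norm_sharpPoint_sub n).trans (norm_le_phaseAbs _))
  have key : ∀ l, gaborTransform f l * (dualCoeff n (gaborVec l) * phaseToComplex (sharpPoint - l)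
      / z) = gaborTransform f l * dualCoeff n (gaborVec l)
        - (2 * Real.pi * z)⁻¹ * ((-1) ^ n.1 * (-1) ^ n.2)
          * (gaborTransform f l * sharpSum (gaborVec l)) := by
    intro l
    have h1 := sub_mul_dualCoeff_gaborVec n l
    have h2 : phaseToComplex (sharpPoint - l)
        = z - (phaseToComplex l - phaseToComplex (latticePoint n)) := by
      rw [hz, ← phaseToComplex_sub, ← phaseToComplex_sub]; ring
    have hpi : (Real.pi : ℂ) ≠ 0 := by exact_mod_cast Real.pi_ne_zero
    have h3 : (2 * Real.pi * z)⁻¹ * ((-1) ^ n.1 * (-1) ^ n.2)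
          * (gaborTransform f l * sharpSum (gaborVec l))
        = (2 * Real.pi * z)⁻¹ * gaborTransform f l
          * ((-1) ^ n.1 * (-1) ^ n.2 * sharpSum (gaborVec l)) := by ring
    rw [h3, ← h1, h2]
    field_simp
  obtain ⟨B, hB⟩ := exists_norm_sharpSum_gaborVec_le
  have i1 : Integrable fun l => gaborTransform f l * dualCoeff n (gaborVec l) :=
    hf.mul_bdd (c := A) (stronglyMeasurable_dualCoeff_gaborVec n).aestronglyMeasurable
      (ae_of_all _ fun l => hA n l)
  have i2 : Integrable fun l => gaborTransform f l * sharpSum (gaborVec l) :=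
    hf.mul_bdd (c := B) stronglyMeasurable_sharpSum_gaborVec.aestronglyMeasurable
      (ae_of_all _ fun l => hB l)
  simp_rw [key]
  rw [integral_sub i1 (i2.const_mul _), integral_const_mul, ← sharpSum_eq_integral hf, h0, mul_zero,
    sub_zero, ← dualCoeff_eq_integral hf]

theorem exists_tsum_enorm_dualCoeff_sq_le {d : ℝ} (hd : 1 < d) :
    ∃ C : ℝ≥0, ∀ f : L2R, gaborNorm d f < ⊤ → sharpSum f = 0 →
      ∑' n : ℤ × ℤ, ‖dualCoeff n f‖ₑ ^ 2 ≤ C * gaborNorm d f ^ 2 := by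
  obtain ⟨M, hM0, hM⟩ := exists_norm_dualCoeff_gaborVec_le_div
  -- The exponent must be positive for summability over λ, at most 1 for the elementary
  -- inequalities, and small enough that 2δ - e > 2 for integrability over l.
  set e : ℝ := min (d - 1) 1 with he
  have he0 : 0 < e := lt_min (by linarith) one_pos
  have he1 : e ≤ 1 := min_le_right _ _
  have hed : e ≤ d - 1 := min_le_left _ _
  obtain ⟨T, hT⟩ := exists_tsum_one_add_norm_sub_rpow_le (s := 2 + e) (by linarith)
  -- The 6 is a 2 from comparing the Euclidean and maximum norms and a 3 from 1 + t ≤ 3t for t ≥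
  -- 1/2. Below, 288 = 6² · 4 · 2.
  set k : ℤ × ℤ → ℝ × ℝ → ℝ≥0∞ := fun n l => ENNReal.ofReal (6 * M * ((1 + ‖l - sharpPoint‖)
    / ((1 + ‖l - latticePoint n‖) * (1 + ‖sharpPoint - latticePoint n‖)))) with hk
  have hkm : ∀ n, Measurable (k n) := fun n => by
    refine ENNReal.measurable_ofReal.comp (Continuous.measurable ?_)
    refine continuous_const.mul (Continuous.div (by fun_prop) (by fun_prop) fun l => ?_)
    positivity
  have hle : ∀ f : L2R, gaborNorm d f < ⊤ → sharpSum f = 0 → ∀ n,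
      ‖dualCoeff n f‖ₑ ≤ ∫⁻ l, ‖gaborTransform f l‖ₑ * k n l := by
    intro f hf h0 n
    rw [dualCoeff_eq_integral_of_sharpSum_eq_zero (integrable_gaborTransform hd hf) h0 n]
    refine (enorm_integral_le_lintegral_enorm _).trans (lintegral_mono fun l => ?_)
    rw [enorm_mul]
    refine mul_le_mul' le_rfl ?_
    rw [← ofReal_norm, norm_div, norm_mul, norm_phaseToComplex, norm_phaseToComplex]
    refine ENNReal.ofReal_le_ofReal ?_
    have h1 : phaseAbs (sharpPoint - l) ≤ 2 * (1 + ‖l - sharpPoint‖) := by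
      have := phaseAbs_le (sharpPoint - l)
      rw [norm_sub_rev] at this
      linarith
    have h2 : (1 + ‖sharpPoint - latticePoint n‖) / 3 ≤ phaseAbs (sharpPoint - latticePoint n) := by
      linarith [half_le_norm_sharpPoint_sub n, norm_le_phaseAbs (sharpPoint - latticePoint n)]
    calc ‖dualCoeff n (gaborVec l)‖ * phaseAbs (sharpPoint - l)
          / phaseAbs (sharpPoint - latticePoint n)
        ≤ (M / (1 + ‖l - latticePoint n‖)) * (2 * (1 + ‖l - sharpPoint‖))
          / ((1 + ‖sharpPoint - latticePoint n‖) / 3) := by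
          have := phaseAbs_nonneg (sharpPoint - l)
          have := hM n l
          gcongr
      _ = _ := by field_simp; ring
  have hksum : ∀ l : ℝ × ℝ, ∑' n, k n l ^ 2
      ≤ ENNReal.ofReal (288 * M ^ 2 * (1 + ‖l‖) ^ e) * (T + T) := by
    intro l
    calc ∑' n, k n l ^ 2 ≤ ∑' n, ENNReal.ofReal (288 * M ^ 2 * (1 + ‖l‖) ^ e)
          * (ENNReal.ofReal ((1 + ‖l - latticePoint n‖) ^ (-(2 + e)))
            + ENNReal.ofReal ((1 + ‖sharpPoint - latticePoint n‖) ^ (-(2 + e)))) := by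
          refine ENNReal.tsum_le_tsum fun n => ?_
          rw [hk, ← ENNReal.ofReal_pow (by positivity), ← ENNReal.ofReal_add (by positivity)
            (by positivity), ← ENNReal.ofReal_mul (by positivity)]
          refine ENNReal.ofReal_le_ofReal ?_
          have h1 : ‖l - sharpPoint‖ ≤ ‖l - latticePoint n‖ + ‖sharpPoint - latticePoint n‖ := by
            rw [norm_sub_rev sharpPoint]
            exact norm_sub_le_norm_sub_add_norm_sub _ _ _
          have h2 := sq_div_le_rpow (A := 1 + ‖l - latticePoint n‖)
            (B := 1 + ‖sharpPoint - latticePoint n‖) (D := 1 + ‖l - sharpPoint‖) (e := e)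
            (by linarith [norm_nonneg (l - latticePoint n)])
            (by linarith [norm_nonneg (sharpPoint - latticePoint n)])
            (by linarith [norm_nonneg (l - sharpPoint)]) (by linarith) he0.le (by linarith)
          have h3 : ‖sharpPoint‖ ≤ 1 := by
            rw [sharpPoint, Prod.norm_def]; norm_num
          have h4 : (1 + ‖l - sharpPoint‖) ^ e ≤ 2 * (1 + ‖l‖) ^ e := by
            calc (1 + ‖l - sharpPoint‖) ^ e ≤ (2 * (1 + ‖l‖)) ^ e :=
                  Real.rpow_le_rpow (by positivity)
                    (by linarith [norm_sub_le l sharpPoint, norm_nonneg l]) he0.le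
              _ = 2 ^ e * (1 + ‖l‖) ^ e := Real.mul_rpow (by norm_num) (by positivity)
              _ ≤ 2 ^ (1 : ℝ) * (1 + ‖l‖) ^ e := by
                  gcongr
                  norm_num
              _ = _ := by rw [Real.rpow_one]
          rw [mul_pow]
          calc (6 * M) ^ 2 * ((1 + ‖l - sharpPoint‖) / ((1 + ‖l - latticePoint n‖)
                * (1 + ‖sharpPoint - latticePoint n‖))) ^ 2
              ≤ (6 * M) ^ 2 * (4 * (2 * (1 + ‖l‖) ^ e)
                * ((1 + ‖l - latticePoint n‖) ^ (-(2 + e))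
                  + (1 + ‖sharpPoint - latticePoint n‖) ^ (-(2 + e)))) := by
                gcongr
                refine h2.trans ?_
                gcongr
            _ = _ := by ring
      _ = ENNReal.ofReal (288 * M ^ 2 * (1 + ‖l‖) ^ e)
          * ((∑' n, ENNReal.ofReal ((1 + ‖l - latticePoint n‖) ^ (-(2 + e))))
            + ∑' n, ENNReal.ofReal ((1 + ‖sharpPoint - latticePoint n‖) ^ (-(2 + e)))) := by
          rw [ENNReal.tsum_mul_left, ENNReal.tsum_add]
      _ ≤ _ := mul_le_mul' le_rfl (add_le_add (hT l) (hT sharpPoint))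
  have hfin : ∫⁻ l : ℝ × ℝ, (∑' n, k n l ^ 2) * invWeight d l < ⊤ := by
    calc ∫⁻ l : ℝ × ℝ, (∑' n, k n l ^ 2) * invWeight d l
        ≤ ∫⁻ l : ℝ × ℝ, (ENNReal.ofReal (288 * M ^ 2 * 4 ^ d) * (T + T))
          * ENNReal.ofReal ((1 + ‖l‖) ^ (-(2 * d - e))) := by
          refine lintegral_mono fun l => ?_
          refine (mul_le_mul' (hksum l) (invWeight_le (by linarith) l)).trans (le_of_eq ?_)
          rw [mul_right_comm, mul_right_comm _ (_ + _), ← ENNReal.ofReal_mul (by positivity),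
            ← ENNReal.ofReal_mul (by positivity)]
          congr 2
          rw [show -(2 * d - e) = e + -(2 * d) by ring, Real.rpow_add (by positivity)]
          ring
      _ < ⊤ := by
          rw [lintegral_const_mul' _ _ (by finiteness)]
          exact ENNReal.mul_lt_top (by finiteness)
            (lintegral_one_add_norm_rpow_lt_top (by linarith))
  refine ⟨(∫⁻ l : ℝ × ℝ, (∑' n, k n l ^ 2) * invWeight d l).toNNReal, fun f hf h0 => ?_⟩
  rw [ENNReal.coe_toNNReal hfin.ne]
  calc ∑' n, ‖dualCoeff n f‖ₑ ^ 2
      ≤ ∑' n, gaborNorm d f ^ 2 * ∫⁻ l, k n l ^ 2 * invWeight d l :=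
        ENNReal.tsum_le_tsum fun n => (pow_le_pow_left₀ zero_le (hle f hf h0 n) 2).trans
          (lintegral_gaborTransform_mul_sq_le d f (hkm n))
    _ = gaborNorm d f ^ 2 * ∫⁻ l, ∑' n, k n l ^ 2 * invWeight d l := by
        have hm : ∀ n, Measurable fun l => k n l ^ 2 * invWeight d l := fun n =>
          ((hkm n).pow_const 2).mul (measurable_invWeight d)
        rw [ENNReal.tsum_mul_left, lintegral_tsum fun n => (hm n).aemeasurable]
    _ = _ := by
        simp only [ENNReal.tsum_mul_right]
        rw [mul_comm]

/-! ### The sharp Poisson functional -/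

theorem sharpPoisson_toDist {f : L2R} (hf : Integrable (gaborTransform f)) :
    sharpPoisson (toDist f) = (Complex.I * gaborTheta 0)⁻¹ * sharpSum f := by
  rw [sharpPoisson, continuousRep_toDist hf, sharpSum]

theorem gaborTheta_zero : gaborTheta 0
    = (((2 : ℝ) ^ (1 / 4 : ℝ) : ℝ) : ℂ) * ∑' q : ℤ, ((Real.exp (-Real.pi * (q : ℝ) ^ 2) : ℝ) : ℂ) := by
  rw [gaborTheta, jacobiTheta₂]
  congr 1
  refine tsum_congr fun q => ?_
  rw [jacobiTheta₂_term, Complex.ofReal_exp]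
  congr 1
  push_cast
  linear_combination (Real.pi : ℂ) * (q : ℂ) ^ 2 * Complex.I_sq

theorem gaborTheta_zero_ne_zero : gaborTheta 0 ≠ 0 := by
  rw [gaborTheta_zero, ← Complex.ofReal_tsum, ← Complex.ofReal_mul]
  have hs : Summable fun q : ℤ => Real.exp (-Real.pi * (q : ℝ) ^ 2) := by
    simpa using summable_exp_neg_pi_sq 0
  have := hs.tsum_pos (fun q => (Real.exp_pos _).le) 0 (Real.exp_pos _)
  have h : 0 < (2 : ℝ) ^ (1 / 4 : ℝ) * ∑' q : ℤ, Real.exp (-Real.pi * (q : ℝ) ^ 2) := by positivity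
  exact_mod_cast h.ne'

/-- The phase exp(2πi(b + 1/2)(q + 1/2)) is (-1)^b (-1)^q i. Its (-1)^q cancels the alternating
sign, so at sharp points the sharp sum becomes a theta series; the i is the one in the normalization
of γ♯. -/
theorem gaborFun_half_integer (a b q : ℤ) :
    (-1 : ℂ) ^ q * gaborFun (latticePoint (a, b) + (1 / 2, 1 / 2)) ((q : ℝ) + 1 / 2)
      = (-1 : ℂ) ^ b * Complex.I * (((2 : ℝ) ^ (1 / 4 : ℝ) : ℝ) : ℂ)
        * ((Real.exp (-Real.pi * ((q - a : ℤ) : ℝ) ^ 2) : ℝ) : ℂ) := by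
  rw [gaborFun]
  have h : (-(Real.pi : ℂ) * ((((q : ℝ) + 1 / 2 : ℝ) : ℂ)
        - ((latticePoint (a, b) + (1 / 2, 1 / 2) : ℝ × ℝ).1 : ℂ)) ^ 2
      + 2 * (Real.pi : ℂ) * Complex.I * ((latticePoint (a, b) + (1 / 2, 1 / 2) : ℝ × ℝ).2 : ℂ)
        * (((q : ℝ) + 1 / 2 : ℝ) : ℂ))
      = ((-Real.pi * ((q - a : ℤ) : ℝ) ^ 2 : ℝ) : ℂ) + ((b * q : ℤ) : ℂ) * (2 * Real.pi * Complex.I)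
        + (b : ℂ) * (Real.pi * Complex.I) + (q : ℂ) * (Real.pi * Complex.I)
        + Real.pi / 2 * Complex.I := by
    simp only [latticePoint, Prod.fst_add, Prod.snd_add]
    push_cast
    ring
  rw [h, Complex.exp_add, Complex.exp_add, Complex.exp_add, Complex.exp_add,
    Complex.exp_int_mul_two_pi_mul_I, Complex.exp_int_mul, Complex.exp_int_mul,
    Complex.exp_pi_mul_I, Complex.exp_pi_div_two_mul_I, Complex.ofReal_exp]
  linear_combination ((-1 : ℂ) ^ b * Complex.I * (((2 : ℝ) ^ (1 / 4 : ℝ) : ℝ) : ℂ)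
        * Complex.exp ((-Real.pi * ((q - a : ℤ) : ℝ) ^ 2 : ℝ) : ℂ)) * neg_one_zpow_mul_self q

theorem sharpSum_gaborVec_of_mem {l : ℝ × ℝ} (hl : l ∈ sharpPoints) :
    sharpSum (gaborVec l) = (-1 : ℂ) ^ ⌊l.2⌋ * (Complex.I * gaborTheta 0) := by
  obtain ⟨⟨a, b⟩, rfl⟩ := hl
  have hfl : ⌊(latticePoint (a, b) + (1 / 2, 1 / 2) : ℝ × ℝ).2⌋ = b := by
    rw [Int.floor_eq_iff]
    simp only [latticePoint, Prod.snd_add]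
    constructor <;> linarith
  rw [sharpSum_gaborVec, hfl]
  simp_rw [gaborFun_half_integer]
  rw [tsum_mul_left, gaborTheta_zero, ← (Equiv.addRight a).tsum_eq]
  simp only [Equiv.coe_addRight, add_sub_cancel_right]
  ring

theorem sharpSum_add {f g : L2R} (hf : Integrable (gaborTransform f))
    (hg : Integrable (gaborTransform g)) : sharpSum (f + g) = sharpSum f + sharpSum g := by
  have h : ∀ x, gaborRep (f + g) x = gaborRep f x + gaborRep g x := by
    have hfg : Integrable (gaborTransform (f + g)) := by
      rw [gaborTransform_add]; exact hf.add hg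
    refine congrFun (((continuous_gaborRep hfg).ae_eq_iff_eq volume
      ((continuous_gaborRep hf).add (continuous_gaborRep hg))).1 ?_)
    filter_upwards [ae_eq_gaborRep hfg, ae_eq_gaborRep hf, ae_eq_gaborRep hg,
      Lp.coeFn_add f g] with x h1 h2 h3 h4
    rw [← h1, h4, Pi.add_apply, h2, h3, Pi.add_apply]
  have hs : ∀ {f : L2R}, Integrable (gaborTransform f) →
      Summable fun q : ℤ => (-1 : ℂ) ^ q * gaborRep f ((q : ℝ) + 1 / 2) := fun hf =>
    Summable.of_norm (by
      simpa only [norm_mul, norm_zpow, norm_neg, norm_one, one_zpow, one_mul]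
        using summable_sharpSum hf)
  rw [sharpSum, sharpSum, sharpSum, ← (hs hf).tsum_add (hs hg)]
  simp only [h, mul_add]

theorem sharpSum_smul (c : ℂ) (f : L2R) : sharpSum (c • f) = c * sharpSum f := by
  have h : ∀ x, gaborRep (c • f) x = c * gaborRep f x := fun x => by
    simp only [gaborRep, gaborTransform_smul, Pi.smul_apply, smul_eq_mul, mul_assoc,
      integral_const_mul]
  rw [sharpSum, sharpSum, ← tsum_mul_left]
  refine tsum_congr fun q => ?_
  rw [h]
  ring

theorem dualCoeff_add (n : ℤ × ℤ) {f g : L2R} (hf : Integrable (f : ℝ → ℂ))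
    (hg : Integrable (g : ℝ → ℂ)) : dualCoeff n (f + g) = dualCoeff n f + dualCoeff n g := by
  rw [dualCoeff, dualCoeff, dualCoeff,
    ← integral_add (integrable_mul_dualAtom hf _ _) (integrable_mul_dualAtom hg _ _)]
  refine integral_congr_ae ?_
  filter_upwards [Lp.coeFn_add f g] with x hx
  rw [hx, Pi.add_apply, add_mul]

/-- The space of functions with integrable Gabor transform. -/
def gaborL1 : Submodule ℂ L2R where
  carrier := {f | Integrable (gaborTransform f)}
  zero_mem' := by
    have : gaborTransform 0 = 0 := by simpa using gaborTransform_smul 0 0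
    rw [Set.mem_ofPred_eq, this]
    exact integrable_zero _ _ _
  add_mem' := fun {f g} hf hg => by
    rw [Set.mem_ofPred_eq, gaborTransform_add]
    exact hf.add hg
  smul_mem' := fun c f hf => by
    rw [Set.mem_ofPred_eq, gaborTransform_smul]
    exact hf.smul c

/-- `sharpSum` as a linear functional. -/
def sharpSumLin : gaborL1 →ₗ[ℂ] ℂ where
  toFun f := sharpSum f
  map_add' f g := sharpSum_add f.2 g.2
  map_smul' c f := sharpSum_smul c f

/-- `annihilationPow` as a linear map. -/
def annihilationPowLin (j : ℕ) : L2R →ₗ[ℂ] 𝓢'(ℝ, ℂ) where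
  toFun := annihilationPow j
  map_add' := annihilationPow_add j
  map_smul' := annihilationPow_smul j

theorem annihilationPow_succ (j : ℕ) (f : L2R) :
    annihilationPow (j + 1) f = annihilation (annihilationPow j f) :=
  Function.iterate_succ_apply' _ _ _

/-! ### The functions `d_{m,j}` -/

/-- The function `aᵏ d_{m,j}`. -/
def sharpVecPow {m : ℕ} (μ : Fin (m + 1) → ℝ × ℝ) (j : Fin (m + 1)) (k : ℕ) : L2R :=
  ∑ s, (sharpCoeff μ j s * phaseToComplex (μ s) ^ k) • gaborVec (μ s)

theorem toDist_sharpVecPow {m : ℕ} (μ : Fin (m + 1) → ℝ × ℝ) (j : Fin (m + 1)) (k : ℕ) :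
    toDist (sharpVecPow μ j k) = annihilationPow k (sharpVec μ j) := by
  have h : annihilationPow k (sharpVec μ j)
      = ∑ s, sharpCoeff μ j s • annihilationPow k (gaborVec (μ s)) := by
    change annihilationPowLin k (sharpVec μ j) = _
    rw [sharpVec, map_sum]
    simp only [map_smul]
    rfl
  rw [h, sharpVecPow, map_sum]
  refine Finset.sum_congr rfl fun s _ => ?_
  rw [annihilationPow_gaborVec, ← map_smul, smul_smul]

theorem sharpVecPow_mem {m : ℕ} (μ : Fin (m + 1) → ℝ × ℝ) (j : Fin (m + 1)) (k : ℕ) :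
    sharpVecPow μ j k ∈ gaborL1 :=
  Submodule.sum_mem _ fun s _ =>
    Submodule.smul_mem _ _ (integrable_gaborTransform_gaborVec (μ s))

theorem gaborNorm_sum_le {ι : Type*} (d : ℝ) (s : Finset ι) (f : ι → L2R) :
    gaborNorm d (∑ i ∈ s, f i) ≤ ∑ i ∈ s, gaborNorm d (f i) :=
  Finset.le_sum_of_subadditive _ (gaborNorm_zero d).le (gaborNorm_add_le d) s f

theorem gaborNorm_sharpVecPow_lt_top {m : ℕ} (μ : Fin (m + 1) → ℝ × ℝ) (j : Fin (m + 1)) (k : ℕ)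
    {d : ℝ} (hd : 0 ≤ d) : gaborNorm d (sharpVecPow μ j k) < ⊤ := by
  refine (gaborNorm_sum_le d _ _).trans_lt (ENNReal.sum_lt_top.2 fun s _ => ?_)
  rw [gaborNorm_smul]
  exact ENNReal.mul_lt_top enorm_lt_top (gaborNorm_gaborVec_lt_top hd _)

theorem phaseToComplex_injective : Function.Injective phaseToComplex := fun l l' h => by
  have h1 := congrArg Complex.re h
  have h2 := congrArg Complex.im h
  simp [phaseToComplex] at h1 h2
  exact Prod.ext h1 h2

/-- The sign in `sharpCoeff` cancels the sign of the sharp sum at μ_s, and what remains is an entry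
of W⁻¹W. W is invertible because the nodes are distinct. -/
theorem sharpSum_sharpVecPow {m : ℕ} {μ : Fin (m + 1) → ℝ × ℝ} (hμ : ∀ s, μ s ∈ sharpPoints)
    (hinj : Function.Injective μ) (j k : Fin (m + 1)) :
    sharpSum (sharpVecPow μ j k) = if k = j then Complex.I * gaborTheta 0 else 0 := by
  set W := Matrix.vandermonde fun i => phaseToComplex (μ i) with hW
  have hdet : IsUnit W.det := by
    rw [isUnit_iff_ne_zero, hW, Matrix.det_vandermonde_ne_zero_iff]
    exact phaseToComplex_injective.comp hinj
  have h1 : sharpSum (sharpVecPow μ j k) = ∑ s, sharpCoeff μ j s * phaseToComplex (μ s) ^ (k : ℕ)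
      * sharpSum (gaborVec (μ s)) := by
    have h2 : (⟨sharpVecPow μ j k, sharpVecPow_mem μ j k⟩ : gaborL1)
        = ∑ s, (sharpCoeff μ j s * phaseToComplex (μ s) ^ (k : ℕ))
          • ⟨gaborVec (μ s), integrable_gaborTransform_gaborVec (μ s)⟩ := by
      ext1
      simp [sharpVecPow]
    have h3 := congrArg sharpSumLin h2
    rw [map_sum] at h3
    simp only [map_smul, smul_eq_mul] at h3
    exact h3
  have h2 : ∑ s, W⁻¹ j s * W s k = if k = j then 1 else 0 := by
    rw [← Matrix.mul_apply, Matrix.nonsing_inv_mul _ hdet, Matrix.one_apply]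
    simp only [eq_comm]
  have h3 : (∑ s, W⁻¹ j s * W s k) * (Complex.I * gaborTheta 0) = sharpSum (sharpVecPow μ j k) := by
    rw [h1, Finset.sum_mul]
    refine Finset.sum_congr rfl fun s _ => ?_
    rw [sharpSum_gaborVec_of_mem (hμ s), sharpCoeff, ← hW]
    have e : W s k = phaseToComplex (μ s) ^ (k : ℕ) := rfl
    rw [e]
    linear_combination (-(W⁻¹ j s) * phaseToComplex (μ s) ^ (k : ℕ) * (Complex.I * gaborTheta 0))
      * neg_one_zpow_mul_self ⌊(μ s).2⌋
  rw [← h3, h2]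
  split_ifs <;> simp

theorem sharpPoisson_annihilationPow_sharpVec {m : ℕ} {μ : Fin (m + 1) → ℝ × ℝ}
    (hμ : ∀ s, μ s ∈ sharpPoints) (hinj : Function.Injective μ) (j k : Fin (m + 1)) :
    sharpPoisson (annihilationPow k (sharpVec μ j)) = if k = j then 1 else 0 := by
  rw [← toDist_sharpVecPow, sharpPoisson_toDist (sharpVecPow_mem μ j k),
    sharpSum_sharpVecPow hμ hinj]
  split_ifs
  · exact inv_mul_cancel₀ (mul_ne_zero Complex.I_ne_zero gaborTheta_zero_ne_zero)
  · rw [mul_zero]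

theorem exists_toDist_eq_of_mem_HM {m : ℕ} {f : L2R} (hf : f ∈ HM m) {j : ℕ} (hj : j ≤ m) :
    ∃ g ∈ gaborL1, toDist g = annihilationPow j f := by
  obtain ⟨d, hd, hf⟩ := hf
  obtain ⟨g, hg, hg'⟩ := (gaborSobolevNorm_lt_top_iff d m f).1 hf j hj
  exact ⟨g, integrable_gaborTransform hd hg', hg⟩

theorem sharpPoisson_annihilationPow_add {m : ℕ} {f g : L2R} (hf : f ∈ HM m) (hg : g ∈ HM m)
    {j : ℕ} (hj : j ≤ m) : sharpPoisson (annihilationPow j (f + g))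
      = sharpPoisson (annihilationPow j f) + sharpPoisson (annihilationPow j g) := by
  obtain ⟨u, hu, hu'⟩ := exists_toDist_eq_of_mem_HM hf hj
  obtain ⟨v, hv, hv'⟩ := exists_toDist_eq_of_mem_HM hg hj
  rw [annihilationPow_add, ← hu', ← hv', ← map_add, sharpPoisson_toDist hu, sharpPoisson_toDist hv,
    sharpPoisson_toDist (gaborL1.add_mem hu hv), sharpSum_add hu hv, mul_add]

theorem sharpPoisson_annihilationPow_smul {m : ℕ} {f : L2R} (hf : f ∈ HM m) (c : ℂ)
    {j : ℕ} (hj : j ≤ m) : sharpPoisson (annihilationPow j (c • f))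
      = c * sharpPoisson (annihilationPow j f) := by
  obtain ⟨u, hu, hu'⟩ := exists_toDist_eq_of_mem_HM hf hj
  rw [annihilationPow_smul, ← hu', ← map_smul, sharpPoisson_toDist hu,
    sharpPoisson_toDist (gaborL1.smul_mem c hu), sharpSum_smul]
  ring

theorem exists_summable_isContinuousRep {m : ℕ} {f : L2R} (hf : f ∈ HM m) {j : ℕ} (hj : j ≤ m) :
    ∃ g : ℝ → ℂ, IsContinuousRep (annihilationPow j f) g ∧
      Summable fun q : ℤ => g ((q : ℝ) + 1 / 2) := by
  obtain ⟨u, hu, hu'⟩ := exists_toDist_eq_of_mem_HM hf hj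
  exact ⟨gaborRep u, hu' ▸ isContinuousRep_gaborRep hu, (summable_sharpSum hu).of_norm⟩

/-! ### The expansion -/

/-- The function `f - ∑_j γ♯(aʲ f) d_{m,j}`. -/
def sharpResidual {m : ℕ} (μ : Fin (m + 1) → ℝ × ℝ) (f : L2R) : L2R :=
  f - ∑ j : Fin (m + 1), sharpPoisson (annihilationPow j f) • sharpVec μ j

theorem sharpVecPow_zero {m : ℕ} (μ : Fin (m + 1) → ℝ × ℝ) (j : Fin (m + 1)) :
    sharpVecPow μ j 0 = sharpVec μ j := by
  simp [sharpVecPow, sharpVec]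

theorem HM_le_gaborL1 (m : ℕ) : HM m ≤ gaborL1 := fun f hf => by
  obtain ⟨g, hg, hg'⟩ := exists_toDist_eq_of_mem_HM hf (Nat.zero_le m)
  rwa [toDist_injective hg'] at hg

theorem sharpResidual_mem_gaborL1 {m : ℕ} (μ : Fin (m + 1) → ℝ × ℝ) {f : L2R} (hf : f ∈ HM m) :
    sharpResidual μ f ∈ gaborL1 :=
  gaborL1.sub_mem (HM_le_gaborL1 m hf) (Submodule.sum_mem _ fun j _ => gaborL1.smul_mem _
    (sharpVecPow_zero μ j ▸ sharpVecPow_mem μ j 0))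

theorem sharpResidual_add {m : ℕ} (μ : Fin (m + 1) → ℝ × ℝ) {f g : L2R} (hf : f ∈ HM m)
    (hg : g ∈ HM m) : sharpResidual μ (f + g) = sharpResidual μ f + sharpResidual μ g := by
  have h : ∀ j : Fin (m + 1), sharpPoisson (annihilationPow j (f + g))
      = sharpPoisson (annihilationPow j f) + sharpPoisson (annihilationPow j g) := fun j =>
    sharpPoisson_annihilationPow_add hf hg (Nat.lt_succ_iff.1 j.2)
  simp only [sharpResidual, h, add_smul, Finset.sum_add_distrib]
  abel

theorem sharpResidual_smul {m : ℕ} (μ : Fin (m + 1) → ℝ × ℝ) (c : ℂ) {f : L2R} (hf : f ∈ HM m) :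
    sharpResidual μ (c • f) = c • sharpResidual μ f := by
  have h : ∀ j : Fin (m + 1), sharpPoisson (annihilationPow j (c • f))
      = c * sharpPoisson (annihilationPow j f) := fun j =>
    sharpPoisson_annihilationPow_smul hf c (Nat.lt_succ_iff.1 j.2)
  simp only [sharpResidual, h, mul_smul, smul_sub, Finset.smul_sum]

/-- The normalizing constant of the dual window. -/
def dualConst : ℂ := (((2 : ℝ) ^ (1 / 4 : ℝ) * altTailSum : ℝ) : ℂ)

theorem dualConst_ne_zero : dualConst ≠ 0 := by
  have h : (2 : ℝ) ^ (1 / 4 : ℝ) * altTailSum ≠ 0 :=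
    mul_ne_zero (by positivity) altTailSum_ne_zero
  exact Complex.ofReal_ne_zero.2 h

/-- The functional `γ_m^λ` for `λ = n`. -/
def latticeCoeff {m : ℕ} (μ : Fin (m + 1) → ℝ × ℝ) (n : ℤ × ℤ) : HM m →ₗ[ℂ] ℂ where
  toFun f := dualConst⁻¹ * dualCoeff n (sharpResidual μ f)
  map_add' f g := by
    rw [Submodule.coe_add, sharpResidual_add μ f.2 g.2,
      dualCoeff_add n (integrable_coeFn (sharpResidual_mem_gaborL1 μ f.2))
        (integrable_coeFn (sharpResidual_mem_gaborL1 μ g.2)), mul_add]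
  map_smul' c f := by
    rw [Submodule.coe_smul, sharpResidual_smul μ c f.2, dualCoeff_smul, RingHom.id_apply,
      smul_eq_mul, mul_left_comm]

theorem exists_toDist_eq_of_mem_HdeltaM {d : ℝ} {m : ℕ} {f : L2R} (hf : f ∈ HdeltaM d m) :
    ∃ g : ℕ → L2R, ∀ j ≤ m, toDist (g j) = annihilationPow j f
      ∧ gaborNorm d (g j) ≤ gaborSobolevNorm d m f := by
  have h : ∀ j, ∃ g : L2R, j ≤ m → toDist g = annihilationPow j f := fun j => by
    by_cases hj : j ≤ m
    · obtain ⟨g, hg, -⟩ := (gaborSobolevNorm_lt_top_iff d m f).1 hf j hj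
      exact ⟨g, fun _ => hg⟩
    · exact ⟨0, fun h => absurd h hj⟩
  choose g hg using h
  refine ⟨g, fun j hj => ⟨hg j hj, ?_⟩⟩
  have h1 : gaborNorm d (g j) ^ 2
      ≤ ∑ j ∈ Finset.range (m + 1), gaborNormDist d (annihilationPow j f) ^ 2 := by
    rw [← gaborNormDist_toDist, hg j hj]
    exact Finset.single_le_sum (f := fun j => gaborNormDist d (annihilationPow j f) ^ 2)
      (fun _ _ => zero_le) (Finset.mem_range.2 (Nat.lt_succ_of_le hj))
  have h2 := ENNReal.rpow_le_rpow h1 (by norm_num : (0 : ℝ) ≤ 1 / 2)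
  rwa [← ENNReal.rpow_natCast, ← ENNReal.rpow_mul, Nat.cast_ofNat, mul_one_div_cancel two_ne_zero,
    ENNReal.rpow_one] at h2

/-- C ≤ (C + 1)² avoids the square root of the constant. -/
theorem le_coe_add_one_mul_of_sq_le {a b : ℝ≥0∞} {C : ℝ≥0} (h : a ^ 2 ≤ C * b ^ 2) :
    a ≤ (C + 1 : ℝ≥0) * b := by
  rw [← ENNReal.pow_le_pow_left_iff two_ne_zero, mul_pow]
  refine h.trans (mul_le_mul' ?_ le_rfl)
  norm_cast
  nlinarith [C.2, sq_nonneg (C : ℝ)]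

theorem exists_enorm_sharpPoisson_le {d : ℝ} (hd : 1 < d) :
    ∃ K : ℝ≥0, ∀ f : L2R, gaborNorm d f < ⊤ →
      ‖sharpPoisson (toDist f)‖ₑ ≤ K * gaborNorm d f := by
  obtain ⟨A, hA⟩ := exists_enorm_sharpSum_le
  obtain ⟨C, hC⟩ := exists_lintegral_gaborTransform_sq_le hd
  refine ⟨‖(Complex.I * gaborTheta 0)⁻¹‖₊ * (A * (C + 1)), fun f hf => ?_⟩
  have h1 : ∫⁻ l, ‖gaborTransform f l‖ₑ ≤ (C + 1 : ℝ≥0) * gaborNorm d f :=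
    le_coe_add_one_mul_of_sq_le (hC f)
  rw [sharpPoisson_toDist (integrable_gaborTransform hd hf), enorm_mul, ENNReal.coe_mul,
    ENNReal.coe_mul, mul_assoc, mul_assoc]
  exact mul_le_mul' le_rfl ((hA f).trans (mul_le_mul' le_rfl h1))

/-- The iterated images `aᵏ f - ∑_j γ♯(aʲ f) aᵏ d_{m,j}`, `k ≤ m`, are functions annihilated by
`γ♯` and bounded by `‖f‖_{δ,m}`. -/
theorem exists_sharpResidual_iterates {m : ℕ} {μ : Fin (m + 1) → ℝ × ℝ}
    (hμ : ∀ s, μ s ∈ sharpPoints) (hinj : Function.Injective μ) {d : ℝ} (hd : 1 < d) :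
    ∃ R : ℝ≥0, ∀ f ∈ HdeltaM d m, ∃ r : ℕ → L2R, r 0 = sharpResidual μ f ∧ ∀ k ≤ m,
      toDist (r k) = annihilationPow k (sharpResidual μ f) ∧ sharpSum (r k) = 0 ∧
        gaborNorm d (r k) ≤ R * gaborSobolevNorm d m f := by
  obtain ⟨K, hK⟩ := exists_enorm_sharpPoisson_le hd
  have hd0 : 0 ≤ d := by linarith
  -- All norms of the a^k d_{m,j}, finite because Gabor functions have finite norm for every δ ≥ 0.
  -- The size of the correction is then controlled by the continuity of γ♯.
  set V : ℝ≥0∞ := ∑ k ∈ Finset.range (m + 1), ∑ j, gaborNorm d (sharpVecPow μ j k) with hV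
  have hVtop : V < ⊤ := ENNReal.sum_lt_top.2 fun k _ => ENNReal.sum_lt_top.2 fun j _ =>
    gaborNorm_sharpVecPow_lt_top μ j k hd0
  refine ⟨1 + K * V.toNNReal, fun f hf => ?_⟩
  have hfin : gaborSobolevNorm d m f < ⊤ := hf
  obtain ⟨g, hg⟩ := exists_toDist_eq_of_mem_HdeltaM hf
  have hglt : ∀ j ≤ m, gaborNorm d (g j) < ⊤ := fun j hj => (hg j hj).2.trans_lt hfin
  have hgL : ∀ j ≤ m, g j ∈ gaborL1 := fun j hj => integrable_gaborTransform hd (hglt j hj)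
  set P : Fin (m + 1) → ℂ := fun j => sharpPoisson (annihilationPow j f) with hP
  have hPle : ∀ j, ‖P j‖ₑ ≤ K * gaborSobolevNorm d m f := fun j => by
    have hj : (j : ℕ) ≤ m := Nat.lt_succ_iff.1 j.2
    rw [hP]
    simp only
    rw [← (hg j hj).1]
    exact (hK _ (hglt j hj)).trans (mul_le_mul' le_rfl (hg j hj).2)
  refine ⟨fun k => g k - ∑ j, P j • sharpVecPow μ j k, ?_, fun k hk => ⟨?_, ?_, ?_⟩⟩
  · simp only [sharpVecPow_zero]
    rw [sharpResidual, toDist_injective (hg 0 (Nat.zero_le m)).1]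
  · have h1 : annihilationPow k (sharpResidual μ f)
        = annihilationPow k f - ∑ j, P j • annihilationPow k (sharpVec μ j) := by
      change annihilationPowLin k (sharpResidual μ f) = _
      rw [sharpResidual, map_sub, map_sum]
      simp only [map_smul]
      rfl
    rw [h1, map_sub, map_sum, (hg k hk).1]
    simp only [map_smul, toDist_sharpVecPow]
  · have h1 : (⟨g k - ∑ j, P j • sharpVecPow μ j k, gaborL1.sub_mem (hgL k hk)
        (Submodule.sum_mem _ fun j _ => gaborL1.smul_mem _ (sharpVecPow_mem μ j k))⟩ : gaborL1)
        = ⟨g k, hgL k hk⟩ - ∑ j, P j • ⟨sharpVecPow μ j k, sharpVecPow_mem μ j k⟩ := by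
      ext1
      simp
    have h2 := congrArg sharpSumLin h1
    rw [map_sub, map_sum] at h2
    simp only [map_smul, smul_eq_mul] at h2
    change sharpSum _ = sharpSum (g k) - ∑ j, P j * sharpSum (sharpVecPow μ j k) at h2
    rw [h2]
    have h3 := fun j => sharpSum_sharpVecPow hμ hinj j ⟨k, Nat.lt_succ_of_le hk⟩
    simp only at h3
    simp only [h3, mul_ite, mul_zero, Finset.sum_ite_eq, Finset.mem_univ, if_true]
    rw [hP]
    simp only
    rw [← (hg k hk).1, sharpPoisson_toDist (hgL k hk)]
    have := mul_ne_zero Complex.I_ne_zero gaborTheta_zero_ne_zero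
    rw [mul_right_comm, inv_mul_cancel₀ this, one_mul, sub_self]
  · have h1 : g k - ∑ j, P j • sharpVecPow μ j k
        = g k + ∑ j, (-P j) • sharpVecPow μ j k := by
      simp only [neg_smul, Finset.sum_neg_distrib, sub_eq_add_neg]
    simp only [h1]
    refine (gaborNorm_add_le d _ _).trans ?_
    have h2 : gaborNorm d (∑ j, (-P j) • sharpVecPow μ j k)
        ≤ K * gaborSobolevNorm d m f * V := by
      calc gaborNorm d (∑ j, (-P j) • sharpVecPow μ j k)
          ≤ ∑ j, gaborNorm d ((-P j) • sharpVecPow μ j k) := gaborNorm_sum_le d _ _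
        _ ≤ ∑ j, K * gaborSobolevNorm d m f * gaborNorm d (sharpVecPow μ j k) := by
            refine Finset.sum_le_sum fun j _ => ?_
            rw [gaborNorm_smul, enorm_neg]
            exact mul_le_mul' (hPle j) le_rfl
        _ = K * gaborSobolevNorm d m f * ∑ j, gaborNorm d (sharpVecPow μ j k) := by
            rw [Finset.mul_sum]
        _ ≤ _ := mul_le_mul' le_rfl (Finset.single_le_sum
            (f := fun k => ∑ j, gaborNorm d (sharpVecPow μ j k)) (fun _ _ => zero_le)
            (Finset.mem_range.2 (Nat.lt_succ_of_le hk)))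
    refine (add_le_add (hg k hk).2 h2).trans (le_of_eq ?_)
    rw [ENNReal.coe_add, ENNReal.coe_mul, ENNReal.coe_toNNReal hVtop.ne, ENNReal.coe_one]
    ring

/-- When the sharp sum vanishes, the integration by parts identity has no right side: each
application of a multiplies the coefficient by λ. -/
theorem dualCoeff_iterate {m : ℕ} {u : L2R} {r : ℕ → L2R} (hr0 : r 0 = u)
    (hr : ∀ k ≤ m, toDist (r k) = annihilationPow k u ∧ sharpSum (r k) = 0 ∧ r k ∈ gaborL1)
    (n : ℤ × ℤ) {k : ℕ} (hk : k ≤ m) :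
    dualCoeff n (r k) = phaseToComplex (latticePoint n) ^ k * dualCoeff n u := by
  induction k with
  | zero => rw [hr0, pow_zero, one_mul]
  | succ k ih =>
    have hk' : k ≤ m := (Nat.le_succ k).trans hk
    have h := dualCoeff_sub_phaseToComplex_mul (hr k hk').2.2 (hr (k + 1) hk).2.2
      (by rw [(hr _ hk).1, (hr _ hk').1, annihilationPow_succ]) n
    have hpi : 2 * (Real.pi : ℂ) ≠ 0 := by
      have : (Real.pi : ℂ) ≠ 0 := by exact_mod_cast Real.pi_ne_zero
      exact mul_ne_zero two_ne_zero this
    rw [(hr k hk').2.1, mul_zero, mul_eq_zero, or_iff_right hpi, sub_eq_zero, ih hk'] at h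
    rw [h]
    ring

/-- With (|λ|² + 1)^m ≤ 2^(m-1)(|λ|^(2m) + 1), the two parts are the unweighted ℓ² bounds for a^m r
and for r, where r is the residual. -/
theorem exists_tsum_weight_mul_dualCoeff_le {m : ℕ} {μ : Fin (m + 1) → ℝ × ℝ}
    (hμ : ∀ s, μ s ∈ sharpPoints) (hinj : Function.Injective μ) {d : ℝ} (hd : 1 < d) :
    ∃ C : ℝ≥0, ∀ f ∈ HdeltaM d m,
      ∑' n : ℤ × ℤ, ENNReal.ofReal ((phaseAbs (latticePoint n) ^ 2 + 1) ^ m)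
          * ‖dualCoeff n (sharpResidual μ f)‖ₑ ^ 2
        ≤ C * gaborSobolevNorm d m f ^ 2 := by
  obtain ⟨R, hR⟩ := exists_sharpResidual_iterates hμ hinj hd
  obtain ⟨C, hC⟩ := exists_tsum_enorm_dualCoeff_sq_le hd
  refine ⟨2 ^ (m - 1) * (C * R ^ 2 + C * R ^ 2), fun f hf => ?_⟩
  have hfin : gaborSobolevNorm d m f < ⊤ := hf
  obtain ⟨r, hr0, hr⟩ := hR f hf
  have hlt : ∀ k ≤ m, gaborNorm d (r k) < ⊤ := fun k hk =>
    (hr k hk).2.2.trans_lt (ENNReal.mul_lt_top ENNReal.coe_lt_top hfin)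
  have hb : ∀ k ≤ m, ∑' n : ℤ × ℤ, ‖dualCoeff n (r k)‖ₑ ^ 2
      ≤ C * R ^ 2 * gaborSobolevNorm d m f ^ 2 := fun k hk => by
    refine (hC (r k) (hlt k hk) (hr k hk).2.1).trans ?_
    rw [mul_assoc, ← mul_pow]
    exact mul_le_mul' le_rfl (pow_le_pow_left₀ zero_le (hr k hk).2.2 2)
  have hit : ∀ n, dualCoeff n (r m)
      = phaseToComplex (latticePoint n) ^ m * dualCoeff n (sharpResidual μ f) := fun n =>
    dualCoeff_iterate hr0 (fun k hk => ⟨(hr k hk).1, (hr k hk).2.1,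
      integrable_gaborTransform hd (hlt k hk)⟩) n le_rfl
  calc ∑' n : ℤ × ℤ, ENNReal.ofReal ((phaseAbs (latticePoint n) ^ 2 + 1) ^ m)
          * ‖dualCoeff n (sharpResidual μ f)‖ₑ ^ 2
      ≤ ∑' n : ℤ × ℤ, 2 ^ (m - 1) * (‖dualCoeff n (r m)‖ₑ ^ 2 + ‖dualCoeff n (r 0)‖ₑ ^ 2) := by
        refine ENNReal.tsum_le_tsum fun n => ?_
        -- For m = 0 the exponent m - 1 is truncated to 0, and the inequality reads 1 ≤ 1 + 1.
        have h1 := add_pow_le (sq_nonneg (phaseAbs (latticePoint n))) zero_le_one m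
        have h2 : ‖dualCoeff n (r m)‖ₑ ^ 2
            = ENNReal.ofReal ((phaseAbs (latticePoint n) ^ 2) ^ m)
              * ‖dualCoeff n (sharpResidual μ f)‖ₑ ^ 2 := by
          rw [hit, enorm_mul, mul_pow, ← ofReal_norm (phaseToComplex _ ^ m), norm_pow,
            norm_phaseToComplex, ← ENNReal.ofReal_pow (pow_nonneg (phaseAbs_nonneg _) _), ← pow_mul,
            ← pow_mul, mul_comm m 2]
        have h3 : ENNReal.ofReal ((phaseAbs (latticePoint n) ^ 2 + 1) ^ m)
            ≤ 2 ^ (m - 1) * (ENNReal.ofReal ((phaseAbs (latticePoint n) ^ 2) ^ m) + 1) := by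
          refine (ENNReal.ofReal_le_ofReal h1).trans (le_of_eq ?_)
          rw [ENNReal.ofReal_mul (by positivity), ENNReal.ofReal_add (by positivity)
            (by positivity), ENNReal.ofReal_pow (by norm_num), one_pow, ENNReal.ofReal_one,
            ENNReal.ofReal_ofNat]
        rw [h2, hr0]
        refine (mul_le_mul' h3 le_rfl).trans (le_of_eq ?_)
        ring
    _ = 2 ^ (m - 1) * ((∑' n : ℤ × ℤ, ‖dualCoeff n (r m)‖ₑ ^ 2)
        + ∑' n : ℤ × ℤ, ‖dualCoeff n (r 0)‖ₑ ^ 2) := by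
        rw [ENNReal.tsum_mul_left, ENNReal.tsum_add]
    _ ≤ 2 ^ (m - 1) * (C * R ^ 2 * gaborSobolevNorm d m f ^ 2
        + C * R ^ 2 * gaborSobolevNorm d m f ^ 2) :=
        mul_le_mul' le_rfl (add_le_add (hb m le_rfl) (hb 0 (Nat.zero_le m)))
    _ = _ := by
        push_cast
        ring

theorem exists_tsum_weight_mul_latticeCoeff_le {m : ℕ} {μ : Fin (m + 1) → ℝ × ℝ}
    (hμ : ∀ s, μ s ∈ sharpPoints) (hinj : Function.Injective μ) {d : ℝ} (hd : 1 < d) :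
    ∃ C : ℝ≥0, ∀ f : HM m, (f : L2R) ∈ HdeltaM d m →
      ∑' n : ℤ × ℤ, ENNReal.ofReal ((phaseAbs (latticePoint n) ^ 2 + 1) ^ m)
          * ‖latticeCoeff μ n f‖ₑ ^ 2
        ≤ C * gaborSobolevNorm d m f ^ 2 := by
  obtain ⟨C, hC⟩ := exists_tsum_weight_mul_dualCoeff_le hμ hinj hd
  refine ⟨‖dualConst⁻¹‖₊ ^ 2 * C, fun f hf => ?_⟩
  have h : ∀ n, ENNReal.ofReal ((phaseAbs (latticePoint n) ^ 2 + 1) ^ m)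
      * ‖latticeCoeff μ n f‖ₑ ^ 2 = ‖dualConst⁻¹‖ₑ ^ 2
        * (ENNReal.ofReal ((phaseAbs (latticePoint n) ^ 2 + 1) ^ m)
          * ‖dualCoeff n (sharpResidual μ f)‖ₑ ^ 2) := fun n => by
    change _ * ‖dualConst⁻¹ * dualCoeff n (sharpResidual μ f)‖ₑ ^ 2 = _
    rw [enorm_mul]
    ring
  simp_rw [h]
  rw [ENNReal.tsum_mul_left, ENNReal.coe_mul, mul_assoc]
  exact mul_le_mul' le_rfl (hC f hf)

theorem one_le_weight (m : ℕ) (l : ℝ × ℝ) : 1 ≤ (phaseAbs l ^ 2 + 1) ^ m :=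
  one_le_pow₀ (by nlinarith [sq_nonneg (phaseAbs l)])

theorem exists_enorm_latticeCoeff_le {m : ℕ} {μ : Fin (m + 1) → ℝ × ℝ}
    (hμ : ∀ s, μ s ∈ sharpPoints) (hinj : Function.Injective μ) {d : ℝ} (hd : 1 < d) :
    ∃ K : ℝ≥0, ∀ (n : ℤ × ℤ) (f : HM m), (f : L2R) ∈ HdeltaM d m →
      ‖latticeCoeff μ n f‖ₑ ≤ K * gaborSobolevNorm d m f := by
  obtain ⟨C, hC⟩ := exists_tsum_weight_mul_latticeCoeff_le hμ hinj hd
  refine ⟨C + 1, fun n f hf => le_coe_add_one_mul_of_sq_le ?_⟩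
  calc ‖latticeCoeff μ n f‖ₑ ^ 2
      ≤ ENNReal.ofReal ((phaseAbs (latticePoint n) ^ 2 + 1) ^ m) * ‖latticeCoeff μ n f‖ₑ ^ 2 :=
        le_mul_of_one_le_left' (ENNReal.one_le_ofReal.2 (one_le_weight m _))
    _ ≤ C * gaborSobolevNorm d m f ^ 2 := (ENNReal.le_tsum n).trans (hC f hf)

/-- The weighted bound for one admissible δ serves twice: without the weight it gives the L₂
reconstruction of the residual, with the weight it upgrades the convergence to W₂^m. -/
theorem tendsto_sobolevNorm_sharpResidual_sub_sum {m : ℕ} {μ : Fin (m + 1) → ℝ × ℝ}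
    (hμ : ∀ s, μ s ∈ sharpPoints) (hinj : Function.Injective μ) (f : HM m) :
    Tendsto (fun S : Finset (ℤ × ℤ) => sobolevNorm m (sharpResidual μ f
      - ∑ n ∈ S, latticeCoeff μ n f • gaborVec (latticePoint n))) atTop (𝓝 0) := by
  obtain ⟨d, hd, hf⟩ := f.2
  obtain ⟨C, hC⟩ := exists_tsum_weight_mul_dualCoeff_le hμ hinj hd
  have hfin : gaborSobolevNorm d m f < ⊤ := hf
  have hs : Summable fun n => (phaseAbs (latticePoint n) ^ 2 + 1) ^ m
      * ‖dualCoeff n (sharpResidual μ f)‖ ^ 2 := by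
    have h : ∑' n : ℤ × ℤ, ENNReal.ofReal ((phaseAbs (latticePoint n) ^ 2 + 1) ^ m
        * ‖dualCoeff n (sharpResidual μ f)‖ ^ 2) ≠ ⊤ := by
      refine ne_of_lt (lt_of_le_of_lt (le_of_eq (tsum_congr fun n => ?_)) ((hC f hf).trans_lt
        (ENNReal.mul_lt_top ENNReal.coe_lt_top (ENNReal.pow_lt_top hfin))))
      rw [ENNReal.ofReal_mul (zero_le_one.trans (one_le_weight m _)),
        ENNReal.ofReal_pow (norm_nonneg _), ofReal_norm]
    refine (ENNReal.summable_toReal h).congr fun n => ENNReal.toReal_ofReal ?_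
    exact mul_nonneg (zero_le_one.trans (one_le_weight m _)) (sq_nonneg _)
  have hs' : Summable fun n => ‖dualCoeff n (sharpResidual μ f)‖ ^ 2 :=
    hs.of_nonneg_of_le (fun n => sq_nonneg _) fun n =>
      le_mul_of_one_le_left (sq_nonneg _) (one_le_weight m _)
  have hsum := (hasSum_dualCoeff_smul_gaborVec
    (integrable_coeFn (sharpResidual_mem_gaborL1 μ f.2)) hs').const_smul dualConst⁻¹
  change HasSum _ (dualConst⁻¹ • dualConst • sharpResidual μ f) at hsum
  rw [inv_smul_smul₀ dualConst_ne_zero] at hsum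
  simp only [smul_smul] at hsum
  refine tendsto_sobolevNorm_sub_sum ?_ hsum
  refine (hs.mul_left (‖dualConst⁻¹‖ ^ 2)).congr fun n => ?_
  change _ = _ * ‖dualConst⁻¹ * dualCoeff n (sharpResidual μ f)‖ ^ 2
  rw [norm_mul]
  ring

end

theorem mainTheorem3 (m : ℕ) (μ : Fin (m + 1) → ℝ × ℝ)
    (hμ : ∀ s, μ s ∈ sharpPoints) (hinj : Function.Injective μ) :
    -- the `d_{m,j}` are biorthogonal to the functionals `γ♯ ∘ aᵏ`
    (∀ j k : Fin (m + 1),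
      sharpPoisson (annihilationPow k (sharpVec μ j)) = if k = j then 1 else 0) ∧
    -- `γ♯(aʲ f)` is given by an absolutely convergent series of values of a continuous function
    (∀ f ∈ HM m, ∀ j ≤ m, ∃ g : ℝ → ℂ, IsContinuousRep (annihilationPow j f) g ∧
      Summable fun q : ℤ => g ((q : ℝ) + 1 / 2)) ∧
    ∃ γ : ℤ × ℤ → (HM m →ₗ[ℂ] ℂ),
      -- continuity of each functional on the union of the spaces `H^{δ,m}`
      (∀ n : ℤ × ℤ, ∀ δ : ℝ, 1 < δ → ∃ K : ℝ≥0, ∀ f : HM m, (f : L2R) ∈ HdeltaM δ m →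
        ‖γ n f‖ₑ ≤ K * gaborSobolevNorm δ m f) ∧
      -- the expansion, unconditionally convergent in `W₂^m(ℝ)`
      (∀ f : HM m, Tendsto
        (fun S : Finset (ℤ × ℤ) => sobolevNorm m
          ((f : L2R)
            - ((∑ j : Fin (m + 1), sharpPoisson (annihilationPow j (f : L2R)) • sharpVec μ j)
              + ∑ n ∈ S, γ n f • gaborVec (latticePoint n))))
        atTop (𝓝 0)) ∧
      -- the estimate of the coefficients
      (∀ δ : ℝ, 1 < δ → ∃ C : ℝ≥0, ∀ f : HM m, (f : L2R) ∈ HdeltaM δ m →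
        ∑' n : ℤ × ℤ,
            ENNReal.ofReal ((phaseAbs (latticePoint n) ^ 2 + 1) ^ m) * ‖γ n f‖ₑ ^ 2
          ≤ C * gaborSobolevNorm δ m f ^ 2) := by
  refine ⟨fun j k => sharpPoisson_annihilationPow_sharpVec hμ hinj j k,
    fun f hf j hj => exists_summable_isContinuousRep hf hj, latticeCoeff μ, fun n δ hδ => ?_,
    fun f => ?_, fun δ hδ => exists_tsum_weight_mul_latticeCoeff_le hμ hinj hδ⟩
  · obtain ⟨K, hK⟩ := exists_enorm_latticeCoeff_le hμ hinj hδ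
    exact ⟨K, hK n⟩
  · simpa only [sharpResidual, sub_sub] using tendsto_sobolevNorm_sharpResidual_sub_sum hμ hinj f
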